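/- Let $\Omega\subset\mathbb R^2$ be a bounded domain whose boundary $\gamma=\partial\Omega$ is a simple smooth closed curve, parametrized by arc length $s$ and oriented counterclockwise. Let $J$ be the rotation by $\pi/2$ and $n=J\dot\gamma$ the inward unit normal, and for $t\in\mathbb R$ let $\gamma_t(s)=\gamma(s)+t\,n(s)$ be the parallel curves. Let $r_0$ be the maximal radius of a tubular neighbourhood of $\gamma$, that is, the supremum of all $\rho>0$ for which $(s,t)\mapsto\gamma_t(s)$, $|t|<\rho$, is a diffeomorphism onto its image. Let $\beta>0$ and assume that $r=1/\beta$ satisfies $r<r_0/2$. Consider the magnetic billiard in $\Omega$: inside $\Omega$ a particle moves with unit speed, counterclockwise along circles of radius $r$, that is $\dot x=v$, $\dot v=\beta Jv$, and at $\gamma$ it is reflected by the law of geometric optics. Let $\Omega_+=\{\gamma_t(s): 0<t<2r\}$ be the annulus bounded by $\gamma$ and $\gamma_{2r}$. Suppose that the billiard flow admits a polynomial in momenta integral, that is, a function on the unit tangent bundle of $\overline{\Omega}_+$ of the form $$\Phi(x,v)=\sum_{0\le k+l\le N}a_{kl}(x)\,v_1^kv_2^l,\qquad a_{kl}\in C^\infty(\overline{\Omega}_+),$$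 such that 1. for every $x\in\gamma$ and every inward unit vector $v$ at $x$, $\Phi$ is constant along the motion that starts at $(x,v)$, up to its next collision with $\gamma$; 2. $\Phi(x,v)=\Phi(x,v-2\langle n,v\rangle n)$ for every $x\in\gamma$ and every unit vector $v$, where $n$ is the unit normal to $\gamma$ at $x$; and suppose that $\Phi$ is not constant on the unit tangent bundle of $\Omega_+$. Then each of the two parallel curves $\gamma_{+r}$ and $\gamma_{-r}$ is a real oval of an irreducible affine algebraic curve that is non-singular in $\mathbb C^2$. That is, for each of the two signs there is a polynomial $f_{\pm r}\in\mathbb R[x,y]$, irreducible over $\mathbb C$, such that the gradient of $f_{\pm r}$ vanishes at no point of $\{f_{\pm r}=0\}\subset\mathbb C^2$, and $\gamma_{\pm r}$ is a connected component of $\{f_{\pm r}=0\}\cap\mathbb R^2$ and is homeomorphic to a circle. -/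

import Mathlib

open scoped ContDiff ENNReal NNReal

/-! The Euclidean plane `ℝ²` is identified with `ℂ`, so that the complex structure `J` (rotation by
a quarter turn, counterclockwise) is multiplication by `Complex.I`. -/

namespace MagneticBilliard

/-- The unit normal `n = J γ̇` of a unit speed plane curve `γ`. -/
noncomputable def normal (γ : ℝ → ℂ) (s : ℝ) : ℂ :=
  Complex.I * deriv γ s

/-- The parallel curve `γ_t(s) = γ(s) + t J γ̇(s)`. -/
noncomputable def parallelCurve (γ : ℝ → ℂ) (t : ℝ) (s : ℝ) : ℂ :=
  γ s + (t : ℂ) * normal γ s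

/-- `Ω` is a bounded domain whose boundary is the simple smooth closed curve `γ` of length `L`,
parametrized by arc length and oriented counterclockwise (the normal `J γ̇` points into `Ω`). -/
structure IsTable (Ω : Set ℂ) (γ : ℝ → ℂ) (L : ℝ) : Prop where
  isOpen : IsOpen Ω
  isConnected : IsConnected Ω
  isBounded : Bornology.IsBounded Ω
  length_pos : 0 < L
  smooth : ContDiff ℝ ∞ γ
  periodic : Function.Periodic γ L
  unit_speed : ∀ s, ‖deriv γ s‖ = 1
  simple : Set.InjOn γ (Set.Ico 0 L)
  frontier_eq : frontier Ω = Set.range γ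
  inward : ∀ s, ∀ᶠ t : ℝ in nhdsWithin 0 (Set.Ioi 0), parallelCurve γ t s ∈ Ω

/-- The normal map `(s, t) ↦ γ(s) + t n(s)`, with `s` modulo `L` and `|t| < ρ`, is a diffeomorphism
onto its image: it is injective, and its differential is invertible. For a unit speed curve
`∂γ_t/∂s = (1 - t k) γ̇` and `∂γ_t/∂t = J γ̇`, so the differential is invertible exactly where
`∂γ_t/∂s ≠ 0`. -/
def IsTubular (γ : ℝ → ℂ) (L ρ : ℝ) : Prop :=
  Set.InjOn (fun p : ℝ × ℝ => parallelCurve γ p.2 p.1) (Set.Ico 0 L ×ˢ Set.Ioo (-ρ) ρ) ∧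
    ∀ t ∈ Set.Ioo (-ρ) ρ, ∀ s, deriv (parallelCurve γ t) s ≠ 0

/-- The maximal radius `r₀` of a tubular neighbourhood of `γ`. -/
noncomputable def tubularRadius (γ : ℝ → ℂ) (L : ℝ) : ℝ≥0∞ :=
  ⨆ (ρ : ℝ≥0) (_ : IsTubular γ L (ρ : ℝ)), (ρ : ℝ≥0∞)

/-- The annulus `Ω₊` bounded by `γ` and `γ_{2r}`, which is swept by the Larmor arcs lying inside
the domain and touching its boundary. -/
def arcRegion (γ : ℝ → ℂ) (r : ℝ) : Set ℂ :=
  {x | ∃ s t : ℝ, 0 < t ∧ t < 2 * r ∧ x = parallelCurve γ t s}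

/-- The velocity at time `t` of the magnetic flow with initial velocity `v`: the solution of
`v' = (1/r) J v`. -/
noncomputable def flowVel (r : ℝ) (v : ℂ) (t : ℝ) : ℂ :=
  Complex.exp (((t / r : ℝ) : ℂ) * Complex.I) * v

/-- The position at time `t` of the magnetic flow with initial data `(x, v)`: a unit speed,
counterclockwise motion along the Larmor circle of radius `r` with centre `x + r J v`. -/
noncomputable def flowPos (r : ℝ) (x v : ℂ) (t : ℝ) : ℂ :=
  (x + (r : ℂ) * (Complex.I * v)) - (r : ℂ) * (Complex.I * flowVel r v t)

/-- On the unit tangent bundle over `D`, the function `Φ(x, v)` is a polynomial in the components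
of `v` with coefficients that are smooth on `D` up to its boundary. -/
def IsPolynomialInMomenta (D : Set ℂ) (Φ : ℂ → ℂ → ℝ) : Prop :=
  ∃ (N : ℕ) (a : ℕ → ℕ → ℂ → ℝ),
    (∀ k l, k + l ≤ N → ContDiffOn ℝ ∞ (a k l) (closure D)) ∧
    ∀ x ∈ closure D, ∀ v : ℂ, ‖v‖ = 1 →
      Φ x v = ∑ k ∈ Finset.range (N + 1), ∑ l ∈ Finset.range (N + 1 - k),
        a k l x * v.re ^ k * v.im ^ l

/-- `Φ` is a polynomial integral of the magnetic billiard flow in `Ω` with Larmor radius `r`. -/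
structure IsPolynomialIntegral (Ω : Set ℂ) (γ : ℝ → ℂ) (r : ℝ) (Φ : ℂ → ℂ → ℝ) : Prop where
  polynomial : IsPolynomialInMomenta (arcRegion γ r) Φ
  /-- Starting from a boundary point with an inward unit velocity, `Φ` is constant along the
  motion as long as it has stayed in `Ω`. -/
  between_collisions : ∀ (s : ℝ) (v : ℂ) (t : ℝ), ‖v‖ = 1 → 0 < inner ℝ (normal γ s) v → 0 ≤ t →
    (∀ τ ∈ Set.Ioc 0 t, flowPos r (γ s) v τ ∈ Ω) →
      Φ (flowPos r (γ s) v t) (flowVel r v t) = Φ (γ s) v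
  /-- `Φ` is preserved by the reflections at the boundary. -/
  reflection : ∀ (s : ℝ) (v : ℂ), ‖v‖ = 1 →
    Φ (γ s) (v - (2 * inner ℝ (normal γ s) v : ℝ) • normal γ s) = Φ (γ s) v

/-- `Φ` is not constant on the unit tangent bundle over `D`. -/
def IsNonconstantOn (D : Set ℂ) (Φ : ℂ → ℂ → ℝ) : Prop :=
  ¬ ∃ c : ℝ, ∀ x ∈ D, ∀ v : ℂ, ‖v‖ = 1 → Φ x v = c

/-- The real points of the plane curve `f = 0`. -/
def realZeros (f : MvPolynomial (Fin 2) ℝ) : Set ℂ :=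
  {z | MvPolynomial.eval ![z.re, z.im] f = 0}

/-- `C` is a real oval of the curve `f = 0`: a connected component of the real zero set that is
homeomorphic to a circle. -/
def IsRealOval (f : MvPolynomial (Fin 2) ℝ) (C : Set ℂ) : Prop :=
  (∃ z ∈ realZeros f, C = connectedComponentIn (realZeros f) z) ∧ Nonempty (C ≃ₜ Circle)

/-- The complex affine curve `{f = 0} ⊆ ℂ²` has no singular points. -/
def IsNonsingular (f : MvPolynomial (Fin 2) ℝ) : Prop :=
  ∀ p : Fin 2 → ℂ, MvPolynomial.aeval p f = 0 →
    ∃ i : Fin 2, MvPolynomial.aeval p (MvPolynomial.pderiv i f) ≠ 0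

end MagneticBilliard

/-!
A Larmor circle of radius `r` is determined by its centre. Since `r < r₀ / 2`, the centres of the
circles that enter `Ω` transversally fill the open strip between `γ_{-r}` and `γ_r`, and since `Φ`
is constant along the arcs, it is, near each transversal boundary vector, a function `F` of the
centre.

*`F` is a polynomial.* With `w = exp(iθ)` for the velocity, the point of the circle with centre `c`
is `x = c - i r w`. For fixed `x`, the function `Φ(x, w)` is a Laurent polynomial in `w` of degree
at most `N`, so that `wᴺ F(x + i r w)` is a polynomial of degree at most `2N` in `w`.
Differentiating `2N + 1` times in `w` at fixed `x`, and comparing, at fixed `c`, the coefficients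
of the powers of `w̄`, gives `∂^{2N+1} F = 0` (`wirtinger_iterate_eq_zero`). As `F` is real, also
`∂̄^{2N+1} F = 0`, and so `F` is locally a polynomial in the coordinates of the centre
(`eventually_eq_planeEval`). By analytic continuation one polynomial `P` serves for all boundary
vectors (`exists_eq_planeEval_larmorCenter`, `eq_planeEval_larmorCenter`). Every vector over the
annulus whose Larmor centre lies in the strip comes from the boundary (`eq_planeEval_of_center`),
so that `P` is not constant when `Φ` is not (`ne_C_of_isNonconstantOn`).

*The reflection law.* It says that `P` takes the same value at the centres `γ(s) + t e^{±iε} n(s)`,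
for `t = r` and for `t = -r`. To first order in `ε`, `P` is constant along `γ_t`, say equal to `c₀`.
A smooth immersed curve does not switch between irreducible components, because the polynomials
which are flat along it at a given parameter form a prime ideal; hence one irreducible factor `f`
of `P - c₀` vanishes on `γ_t` (`exists_irreducible_factor_flat`), and `f` remains irreducible over
`ℂ` (`irreducible_complexify`). Write `P - c₀ = f^{k+1} g` with `f ∤ g`, let `λ` be the normal
derivative of `f` along `γ_t`, and `m = 1 - t k_γ`, where `k_γ` is the curvature of `γ`. The first
odd order in `ε` of the symmetry says that `g³ (λ³ / m)^{k+1}` is constant along `γ_t`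
(`conserved_quantity`), and the constant is not zero, since otherwise `f` would divide its own
partial derivatives (`exists_mul_normalDeriv_ne_zero`).

*Non-singularity.* Along `γ_t` one has `λ² = |∇f|²` and `λ³ / m = λ³ - t H`, where `H` is quadratic
in the first derivatives of `f` (`normalDeriv_sq`, `normalDeriv_pow_three_div`). Eliminating `λ`
turns the conservation law into a polynomial identity on `γ_t`, therefore into a congruence modulo
`f`; at a complex singular point of `f = 0` this congruence would read `c² = 0` with `c ≠ 0`
(`exists_nonsingular_curve`). Finally `λ ≠ 0` along `γ_t` makes `γ_t` open in the real zero set of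
`f`, and being compact and connected, it is a component (`isRealOval_of_isolated`).
-/

namespace MagneticBilliard

open Topology Filter

section

open MvPolynomial

/-! ### Polynomials that are flat along a plane curve -/

theorem ringKrullDim_two_variables (K : Type*) [Field K] :
    ringKrullDim (MvPolynomial (Fin 2) K) = 2 := by
  rw [MvPolynomial.ringKrullDim_of_isNoetherianRing, ringKrullDim_eq_zero_of_field]
  simp

/-- In `K[x, y]`, a prime ideal that contains an irreducible `f` and no non-zero polynomial in the
single variable `x_i` consists of the multiples of `f`: by dimension theory it would otherwise be
maximal, and then `x_i` would be algebraic over `K` modulo it. -/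
theorem dvd_of_mem_prime {K : Type*} [Field K] {I : Ideal (MvPolynomial (Fin 2) K)}
    (hI : I.IsPrime) {f : MvPolynomial (Fin 2) K} (hf : Irreducible f) (hfI : f ∈ I) (i : Fin 2)
    (htr : ∀ R : Polynomial K, R ≠ 0 → Polynomial.aeval (X i : MvPolynomial (Fin 2) K) R ∉ I)
    {h : MvPolynomial (Fin 2) K} (hh : h ∈ I) : f ∣ h := by
  by_contra hdvd
  have hfp : Prime f := hf.prime
  have hP : (Ideal.span {f}).IsPrime := (Ideal.span_singleton_prime hf.ne_zero).2 hfp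
  have h1 : (⊥ : Ideal (MvPolynomial (Fin 2) K)) < Ideal.span {f} := by
    rw [bot_lt_iff_ne_bot, Ne, Ideal.span_singleton_eq_bot]; exact hf.ne_zero
  have h2 : Ideal.span {f} < I := by
    refine lt_of_le_of_ne ((Ideal.span_singleton_le_iff_mem I).2 hfI) ?_
    rintro rfl
    exact hdvd (Ideal.mem_span_singleton.1 hh)
  have hmax : I.IsMaximal := by
    obtain ⟨M, hM, hIM⟩ := Ideal.exists_le_maximal I hI.ne_top
    rcases hIM.eq_or_lt with rfl | hlt
    · exact hM
    exfalso
    let p0 : PrimeSpectrum (MvPolynomial (Fin 2) K) := ⟨⊥, Ideal.isPrime_bot⟩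
    let p1 : PrimeSpectrum (MvPolynomial (Fin 2) K) := ⟨_, hP⟩
    let p2 : PrimeSpectrum (MvPolynomial (Fin 2) K) := ⟨I, hI⟩
    let p3 : PrimeSpectrum (MvPolynomial (Fin 2) K) := ⟨M, hM.isPrime⟩
    have h01 : p0 < p1 := h1
    have h12 : p1 < p2 := h2
    have h23 : p2 < p3 := hlt
    let c0 : LTSeries (PrimeSpectrum (MvPolynomial (Fin 2) K)) := RelSeries.singleton _ p0
    let c1 := c0.snoc p1 h01
    let c2 := c1.snoc p2 ((RelSeries.last_snoc c0 p1 h01).symm ▸ h12)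
    let c3 := c2.snoc p3 ((RelSeries.last_snoc c1 p2 _).symm ▸ h23)
    have := Order.LTSeries.length_le_krullDim c3
    have hd := ringKrullDim_two_variables K
    rw [ringKrullDim] at hd
    rw [hd] at this
    simp [c3, c2, c1, c0] at this
    have : (3 : ℕ) ≤ 2 := by exact_mod_cast this
    omega
  let := Ideal.Quotient.field I
  have : Module.Finite K (MvPolynomial (Fin 2) K ⧸ I) :=
    finite_of_finite_type_of_isJacobsonRing K _
  obtain ⟨R, hR, hR0⟩ := Algebra.IsIntegral.isIntegral (R := K) (Ideal.Quotient.mk I (X i))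
  refine htr R hR.ne_zero ?_
  rw [← Ideal.Quotient.eq_zero_iff_mem]
  have : Ideal.Quotient.mk I (Polynomial.aeval (X i : MvPolynomial (Fin 2) K) R)
      = Polynomial.aeval (Ideal.Quotient.mk I (X i)) R :=
    (Polynomial.aeval_algHom_apply (Ideal.Quotient.mkₐ K I) (X i) R).symm
  rw [this]; exact hR0

/-- The point of `ℂ²` with the real coordinates of `z`. -/
def toPair (z : ℂ) : Fin 2 → ℂ := ![(z.re : ℂ), (z.im : ℂ)]

/-- The restriction of a complex polynomial in two variables to a plane curve. -/
noncomputable def restrict (q : ℝ → ℂ) (h : MvPolynomial (Fin 2) ℂ) (s : ℝ) : ℂ :=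
  eval (toPair (q s)) h

theorem contDiff_restrict {q : ℝ → ℂ} (hq : ContDiff ℝ ∞ q) (h : MvPolynomial (Fin 2) ℂ) :
    ContDiff ℝ ∞ (restrict q h) := by
  induction h using MvPolynomial.induction_on with
  | C a =>
    have : restrict q (C a) = fun _ => a := by ext s; simp [restrict]
    rw [this]; exact contDiff_const
  | add p p' hp hp' =>
    have : restrict q (p + p') = restrict q p + restrict q p' := by ext s; simp [restrict]
    rw [this]; exact hp.add hp'
  | mul_X p i hp =>
    have hi : ContDiff ℝ ∞ fun s => toPair (q s) i := by
      fin_cases i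
      · exact (Complex.ofRealCLM.contDiff.comp (Complex.reCLM.contDiff.comp hq))
      · exact (Complex.ofRealCLM.contDiff.comp (Complex.imCLM.contDiff.comp hq))
    have : restrict q (p * X i) = restrict q p * fun s => toPair (q s) i := by
      ext s; simp [restrict]
    rw [this]; exact hp.mul hi

theorem iteratedDeriv_restrict_mul {q : ℝ → ℂ} (hq : ContDiff ℝ ∞ q)
    (f g : MvPolynomial (Fin 2) ℂ) (n : ℕ) (s : ℝ) :
    iteratedDeriv n (restrict q (f * g)) s = ∑ i ∈ Finset.range (n + 1),
      (n.choose i) * iteratedDeriv i (restrict q f) s * iteratedDeriv (n - i) (restrict q g) s := by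
  have : restrict q (f * g) = restrict q f * restrict q g := by
    ext s; simp [restrict]
  rw [this, iteratedDeriv_mul]
  · exact (contDiff_restrict hq f).contDiffAt.of_le (by exact_mod_cast le_top)
  · exact (contDiff_restrict hq g).contDiffAt.of_le (by exact_mod_cast le_top)

/-- The ideal of the polynomials whose restriction to `q` is flat at the parameter `s`: all its
derivatives vanish there. -/
noncomputable def flatIdeal (q : ℝ → ℂ) (hq : ContDiff ℝ ∞ q) (s : ℝ) :
    Ideal (MvPolynomial (Fin 2) ℂ) where
  carrier := {h | ∀ n, iteratedDeriv n (restrict q h) s = 0}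
  add_mem' := by
    intro f g hf hg n
    have : restrict q (f + g) = restrict q f + restrict q g := by ext s; simp [restrict]
    rw [this, iteratedDeriv_add, hf n, hg n, add_zero]
    · exact (contDiff_restrict hq f).contDiffAt.of_le (by exact_mod_cast le_top)
    · exact (contDiff_restrict hq g).contDiffAt.of_le (by exact_mod_cast le_top)
  zero_mem' := by
    intro n
    have : restrict q 0 = fun _ => 0 := by ext s; simp [restrict]
    rw [this, iteratedDeriv_const]; simp
  smul_mem' := by
    intro f g hg n
    rw [smul_eq_mul, iteratedDeriv_restrict_mul hq]
    exact Finset.sum_eq_zero fun i _ => by rw [hg, mul_zero]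

theorem mem_flatIdeal {q : ℝ → ℂ} {hq : ContDiff ℝ ∞ q} {s : ℝ} {h : MvPolynomial (Fin 2) ℂ} :
    h ∈ flatIdeal q hq s ↔ ∀ n, iteratedDeriv n (restrict q h) s = 0 := Iff.rfl

theorem flatIdeal_isPrime {q : ℝ → ℂ} (hq : ContDiff ℝ ∞ q) (s : ℝ) :
    (flatIdeal q hq s).IsPrime := by
  classical
  refine Ideal.isPrime_iff.2 ⟨?_, ?_⟩
  · rw [Ne, Ideal.eq_top_iff_one, mem_flatIdeal]
    intro h
    simpa [restrict] using h 0
  · intro f g hfg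
    by_contra! hcon
    obtain ⟨hf, hg⟩ := hcon
    rw [mem_flatIdeal] at hf hg
    push Not at hf hg
    -- the lowest non-vanishing derivatives of the factors multiply up
    have hfg' := hfg (Nat.find hf + Nat.find hg)
    rw [iteratedDeriv_restrict_mul hq, Finset.sum_eq_single (Nat.find hf)] at hfg'
    · have h1 := Nat.find_spec hf
      have h2 := Nat.find_spec hg
      rw [Nat.add_sub_cancel_left] at hfg'
      refine mul_ne_zero (mul_ne_zero ?_ h1) h2 hfg'
      exact_mod_cast (Nat.choose_pos (Nat.le_add_right _ _)).ne'
    · intro i _ hi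
      rcases lt_or_gt_of_ne hi with hlt | hgt
      · have := Nat.find_min hf hlt
        push Not at this
        rw [this]; ring
      · have : Nat.find hf + Nat.find hg - i < Nat.find hg ∨ Nat.find hg = 0 := by omega
        rcases this with h | h
        · have := Nat.find_min hg h
          push Not at this
          rw [this]; ring
        · have : i ∉ Finset.range (Nat.find hf + Nat.find hg + 1) := by simp; omega
          contradiction
    · intro h
      exact absurd (Finset.mem_range.2 (by omega)) h

/-- A polynomial in one coordinate has zeros of finite order along a curve on which that coordinate
has non-zero derivative. -/
theorem aeval_X_notMem_flatIdeal {q : ℝ → ℂ} (hq : ContDiff ℝ ∞ q) (s : ℝ) (i : Fin 2)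
    (hi : deriv (fun s => toPair (q s) i) s ≠ 0) (R : Polynomial ℂ) (hR : R ≠ 0) :
    Polynomial.aeval (X i : MvPolynomial (Fin 2) ℂ) R ∉ flatIdeal q hq s := by
  have hp := flatIdeal_isPrime hq s
  set x₀ := toPair (q s) i
  obtain ⟨S, hS, hS0⟩ := Polynomial.exists_eq_pow_rootMultiplicity_mul_and_not_dvd R hR x₀
  intro hmem
  rw [hS, map_mul, map_pow] at hmem
  rcases hp.mem_or_mem hmem with h | h
  · have h := hp.mem_of_pow_mem _ h 1
    rw [iteratedDeriv_one] at h
    have : restrict q (Polynomial.aeval (X i) (Polynomial.X - Polynomial.C x₀))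
        = fun s => toPair (q s) i - x₀ := by
      ext s; simp [restrict]
    rw [this, deriv_sub_const] at h
    exact hi h
  · have h := h 0
    rw [iteratedDeriv_zero, restrict, ← MvPolynomial.coe_aeval_eq_eval, RingHom.coe_coe,
      ← Polynomial.aeval_algHom_apply] at h
    simp only [aeval_X] at h
    exact hS0 (Polynomial.dvd_iff_isRoot.2 (by simpa [Polynomial.aeval_def] using h))

theorem exists_deriv_toPair_ne_zero {q : ℝ → ℂ} (hq : ContDiff ℝ ∞ q) {s : ℝ}
    (hs : deriv q s ≠ 0) : ∃ i, deriv (fun s => toPair (q s) i) s ≠ 0 := by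
  have hd : HasDerivAt q (deriv q s) s := (hq.differentiable (by simp)).differentiableAt.hasDerivAt
  have h0 : HasDerivAt (fun s => ((q s).re : ℂ)) ((deriv q s).re : ℂ) s :=
    (Complex.ofRealCLM.hasFDerivAt.comp_hasDerivAt s
      (Complex.reCLM.hasFDerivAt.comp_hasDerivAt s hd))
  have h1 : HasDerivAt (fun s => ((q s).im : ℂ)) ((deriv q s).im : ℂ) s :=
    (Complex.ofRealCLM.hasFDerivAt.comp_hasDerivAt s
      (Complex.imCLM.hasFDerivAt.comp_hasDerivAt s hd))
  by_contra! hcon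
  refine hs (Complex.ext ?_ ?_)
  · have := h0.deriv.symm.trans (hcon 0); simpa using this
  · have := h1.deriv.symm.trans (hcon 1); simpa using this

/-- A polynomial with real coefficients, seen over `ℂ`. -/
noncomputable abbrev complexify (f : MvPolynomial (Fin 2) ℝ) : MvPolynomial (Fin 2) ℂ :=
  MvPolynomial.map (algebraMap ℝ ℂ) f

theorem eval_toPair_complexify (f : MvPolynomial (Fin 2) ℝ) (z : ℂ) :
    eval (toPair z) (complexify f) = ((eval ![z.re, z.im] f : ℝ) : ℂ) := by
  have : toPair z = fun i => algebraMap ℝ ℂ (![z.re, z.im] i) := by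
    ext i; fin_cases i <;> simp [toPair]
  rw [this, complexify, MvPolynomial.eval_map]
  exact (MvPolynomial.eval₂_comp (algebraMap ℝ ℂ) _ f).symm

/-- All polynomials that are flat at a point of an immersed curve are multiples of any irreducible
one among them. -/
theorem dvd_of_mem_flatIdeal {q : ℝ → ℂ} (hq : ContDiff ℝ ∞ q) {s : ℝ} (hs : deriv q s ≠ 0)
    {f h : MvPolynomial (Fin 2) ℝ} (hf : Irreducible f) (hfI : complexify f ∈ flatIdeal q hq s)
    (hh : complexify h ∈ flatIdeal q hq s) : f ∣ h := by
  obtain ⟨i, hi⟩ := exists_deriv_toPair_ne_zero hq hs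
  have hp := flatIdeal_isPrime hq s
  refine dvd_of_mem_prime (I := (flatIdeal q hq s).comap (MvPolynomial.map (algebraMap ℝ ℂ)))
    (Ideal.comap_isPrime _ _) hf hfI i ?_ hh
  intro R hR hmem
  refine aeval_X_notMem_flatIdeal hq s i hi (R.map (algebraMap ℝ ℂ))
    (by simpa [Polynomial.map_eq_zero] using hR) ?_
  rw [Ideal.mem_comap] at hmem
  convert hmem using 1
  rw [Polynomial.aeval_def, Polynomial.aeval_def, Polynomial.eval₂_map, Polynomial.hom_eval₂,
    MvPolynomial.map_X]
  congr 1
  ext a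
  simp [MvPolynomial.algebraMap_eq]

theorem restrict_complexify (q : ℝ → ℂ) (f : MvPolynomial (Fin 2) ℝ) (s : ℝ) :
    restrict q (complexify f) s = ((eval ![(q s).re, (q s).im] f : ℝ) : ℂ) :=
  eval_toPair_complexify f (q s)

theorem mem_flatIdeal_of_forall {q : ℝ → ℂ} (hq : ContDiff ℝ ∞ q)
    {f : MvPolynomial (Fin 2) ℝ} (hf : ∀ s, eval ![(q s).re, (q s).im] f = 0) (s : ℝ) :
    complexify f ∈ flatIdeal q hq s := by
  intro n
  have : restrict q (complexify f) = fun _ => 0 := by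
    ext s; simp [restrict_complexify, hf]
  rw [this, iteratedDeriv_const]; simp

theorem eval_eq_zero_of_mem_flatIdeal {q : ℝ → ℂ} {hq : ContDiff ℝ ∞ q} {s : ℝ}
    {f : MvPolynomial (Fin 2) ℝ} (hf : complexify f ∈ flatIdeal q hq s) :
    eval ![(q s).re, (q s).im] f = 0 := by
  have := hf 0
  rw [iteratedDeriv_zero, restrict_complexify] at this
  exact_mod_cast this

theorem isClosed_setOf_mem_flatIdeal {q : ℝ → ℂ} (hq : ContDiff ℝ ∞ q)
    (f : MvPolynomial (Fin 2) ℂ) : IsClosed {s | f ∈ flatIdeal q hq s} := by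
  simp only [mem_flatIdeal, Set.ofPred_forall]
  refine isClosed_iInter fun n => isClosed_eq ?_ continuous_const
  exact (contDiff_restrict hq f).continuous_iteratedDeriv n (by exact_mod_cast le_top)

/-- A smooth immersed curve in the zero set of a polynomial does not switch between its
components: at every parameter exactly one irreducible factor is flat, and the sets of parameters
belonging to the different factors are closed. -/
theorem exists_irreducible_factor_flat {q : ℝ → ℂ} (hq : ContDiff ℝ ∞ q) (hq' : ∀ s, deriv q s ≠ 0)
    {Q : MvPolynomial (Fin 2) ℝ} (hQ : Q ≠ 0) (hQq : ∀ s, eval ![(q s).re, (q s).im] Q = 0) :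
    ∃ f, Irreducible f ∧ f ∣ Q ∧ ∀ s, complexify f ∈ flatIdeal q hq s := by
  classical
  have key : ∀ s, ∃ f ∈ UniqueFactorizationMonoid.factors Q,
      complexify f ∈ flatIdeal q hq s := by
    intro s
    have hp : ((flatIdeal q hq s).comap (MvPolynomial.map (algebraMap ℝ ℂ))).IsPrime :=
      have := flatIdeal_isPrime hq s
      Ideal.comap_isPrime _ _
    have h1 : Q ∈ (flatIdeal q hq s).comap (MvPolynomial.map (algebraMap ℝ ℂ)) :=
      mem_flatIdeal_of_forall hq hQq s
    have h2 := Ideal.mem_of_dvd _ (UniqueFactorizationMonoid.factors_prod hQ).symm.dvd h1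
    obtain ⟨f, hf, hfI⟩ := (hp.multiset_prod_mem_iff_exists_mem _).1 h2
    exact ⟨f, hf, hfI⟩
  obtain ⟨f, hfQ, hf0⟩ := key 0
  have hfirr := UniqueFactorizationMonoid.irreducible_of_factor f hfQ
  refine ⟨f, hfirr, UniqueFactorizationMonoid.dvd_of_mem_factors hfQ, ?_⟩
  set A := {s | complexify f ∈ flatIdeal q hq s}
  set B := ⋃ g ∈ (UniqueFactorizationMonoid.factors Q).toFinset.filter (fun g => ¬ f ∣ g),
    {s | complexify g ∈ flatIdeal q hq s}
  have hB : IsClosed B :=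
    isClosed_biUnion_finset fun g _ => isClosed_setOf_mem_flatIdeal hq _
  have hAB : A = Bᶜ := by
    ext s
    simp only [A, B, Set.mem_compl_iff, Set.mem_iUnion, Set.mem_ofPred_eq, Finset.mem_filter,
      Multiset.mem_toFinset, not_exists]
    constructor
    · rintro hs g ⟨_, hdvd⟩ hg
      exact hdvd (dvd_of_mem_flatIdeal hq (hq' s) hfirr hs hg)
    · intro hs
      obtain ⟨g, hgQ, hg⟩ := key s
      by_cases hdvd : f ∣ g
      · have hgf := ((hfirr.dvd_irreducible_iff_associated
          (UniqueFactorizationMonoid.irreducible_of_factor g hgQ)).1 hdvd).symm.dvd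
        exact Ideal.mem_of_dvd _ (map_dvd (MvPolynomial.map (algebraMap ℝ ℂ)) hgf) hg
      · exact absurd hg (hs g ⟨hgQ, hdvd⟩)
  have hclopen : IsClopen A :=
    ⟨isClosed_setOf_mem_flatIdeal hq _, by rw [hAB]; exact hB.isOpen_compl⟩
  have := hclopen.eq_univ ⟨0, hf0⟩
  intro s
  have : s ∈ A := this ▸ Set.mem_univ s
  exact this

theorem exists_complexify_add (g : MvPolynomial (Fin 2) ℂ) :
    ∃ a b : MvPolynomial (Fin 2) ℝ, g = complexify a + C Complex.I * complexify b := by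
  induction g using MvPolynomial.induction_on with
  | C z =>
    refine ⟨C z.re, C z.im, ?_⟩
    simp only [complexify, MvPolynomial.map_C, ← map_mul, ← map_add]
    congr 1
    simpa [mul_comm] using (Complex.re_add_im z).symm
  | add p p' hp hp' =>
    obtain ⟨a, b, rfl⟩ := hp
    obtain ⟨a', b', rfl⟩ := hp'
    exact ⟨a + a', b + b', by simp only [complexify, map_add]; ring⟩
  | mul_X p i hp =>
    obtain ⟨a, b, rfl⟩ := hp
    exact ⟨a * X i, b * X i, by simp only [complexify, map_mul, MvPolynomial.map_X]; ring⟩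

theorem iteratedDeriv_star (F : ℝ → ℂ) (n : ℕ) :
    iteratedDeriv n (fun s => star (F s)) = fun s => star (iteratedDeriv n F s) := by
  induction n with
  | zero => simp
  | succ n ih =>
    rw [iteratedDeriv_succ, ih, iteratedDeriv_succ]
    ext s
    exact deriv.star

/-- An irreducible real polynomial that is flat along a real immersed curve stays irreducible over
`ℂ`, since both the real and the imaginary part of a factor that is flat are multiples of it. -/
theorem irreducible_complexify {q : ℝ → ℂ} (hq : ContDiff ℝ ∞ q) {s : ℝ} (hs : deriv q s ≠ 0)
    {f : MvPolynomial (Fin 2) ℝ} (hf : Irreducible f) (hfI : complexify f ∈ flatIdeal q hq s) :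
    Irreducible (complexify f) := by
  have hp := flatIdeal_isPrime hq s
  have hf0 : complexify f ≠ 0 := by
    rw [← map_zero (MvPolynomial.map (algebraMap ℝ ℂ))]
    exact (MvPolynomial.map_injective _ (algebraMap ℝ ℂ).injective).ne hf.ne_zero
  have h2 := Ideal.mem_of_dvd _ (UniqueFactorizationMonoid.factors_prod hf0).symm.dvd hfI
  obtain ⟨g, hg, hgI⟩ := (hp.multiset_prod_mem_iff_exists_mem _).1 h2
  have hgirr := UniqueFactorizationMonoid.irreducible_of_factor g hg
  have hgf := UniqueFactorizationMonoid.dvd_of_mem_factors hg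
  suffices h : complexify f ∣ g from (associated_of_dvd_dvd hgf h).irreducible hgirr
  obtain ⟨a, b, rfl⟩ := exists_complexify_add g
  have hconj : complexify a - C Complex.I * complexify b ∈ flatIdeal q hq s := by
    intro n
    have : restrict q (complexify a - C Complex.I * complexify b)
        = fun s => star (restrict q (complexify a + C Complex.I * complexify b) s) := by
      ext s
      have ha := restrict_complexify q a s
      have hb := restrict_complexify q b s
      simp only [restrict] at ha hb
      simp [restrict, ha, hb, sub_eq_add_neg]
    rw [this, iteratedDeriv_star]
    simp [hgI n]
  have ha : complexify a ∈ flatIdeal q hq s := by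
    have := Ideal.mul_mem_left _ (C (1 / 2 : ℂ)) (add_mem hgI hconj)
    convert this using 1
    have h2 : (C (1 / 2 : ℂ) : MvPolynomial (Fin 2) ℂ) * 2 = 1 := by
      rw [show (2 : MvPolynomial (Fin 2) ℂ) = C 2 from (map_ofNat C 2).symm, ← map_mul]; simp
    linear_combination -complexify a * h2
  have hb : complexify b ∈ flatIdeal q hq s := by
    have := Ideal.mul_mem_left _ (C (1 / (2 * Complex.I) : ℂ)) (sub_mem hgI hconj)
    convert this using 1
    have h2 : (C (1 / (2 * Complex.I) : ℂ) : MvPolynomial (Fin 2) ℂ) * (2 * C Complex.I) = 1 := by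
      rw [show (2 : MvPolynomial (Fin 2) ℂ) = C 2 from (map_ofNat C 2).symm, ← map_mul,
        ← map_mul, one_div, inv_mul_cancel₀ (by simp), map_one]
    linear_combination -complexify b * h2
  exact dvd_add (map_dvd _ (dvd_of_mem_flatIdeal hq hs hf hfI ha))
    (dvd_mul_of_dvd_right (map_dvd _ (dvd_of_mem_flatIdeal hq hs hf hfI hb)) _)

/-! ### Real polynomials as functions on the plane -/

/-- The value of a real polynomial in two variables at a point of the plane. -/
noncomputable def planeEval (f : MvPolynomial (Fin 2) ℝ) (z : ℂ) : ℝ :=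
  eval ![z.re, z.im] f

theorem planeEval_add (f g : MvPolynomial (Fin 2) ℝ) (z : ℂ) :
    planeEval (f + g) z = planeEval f z + planeEval g z := by simp [planeEval]

theorem planeEval_sub (f g : MvPolynomial (Fin 2) ℝ) (z : ℂ) :
    planeEval (f - g) z = planeEval f z - planeEval g z := by simp [planeEval]

theorem planeEval_mul (f g : MvPolynomial (Fin 2) ℝ) (z : ℂ) :
    planeEval (f * g) z = planeEval f z * planeEval g z := by simp [planeEval]

theorem planeEval_pow (f : MvPolynomial (Fin 2) ℝ) (n : ℕ) (z : ℂ) :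
    planeEval (f ^ n) z = planeEval f z ^ n := by simp [planeEval]

theorem planeEval_C (a : ℝ) (z : ℂ) : planeEval (C a) z = a := by simp [planeEval]

theorem hasStrictFDerivAt_planeEval (f : MvPolynomial (Fin 2) ℝ) (z : ℂ) :
    HasStrictFDerivAt (planeEval f) (planeEval (pderiv 0 f) z • Complex.reCLM +
      planeEval (pderiv 1 f) z • Complex.imCLM) z := by
  induction f using MvPolynomial.induction_on with
  | C a =>
    have : planeEval (C a) = fun _ => a := by ext z; simp [planeEval]
    rw [this]
    simpa [planeEval] using hasStrictFDerivAt_const a z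
  | add p p' hp hp' =>
    have : planeEval (p + p') = fun z => planeEval p z + planeEval p' z := by
      ext z; simp [planeEval]
    rw [this]
    refine (hp.add hp').congr_fderiv ?_
    ext
    simp [planeEval_add, map_add]
    ring
  | mul_X p i hp =>
    have hX : HasStrictFDerivAt (planeEval (X i)) (planeEval (pderiv 0 (X i)) z • Complex.reCLM +
        planeEval (pderiv 1 (X i)) z • Complex.imCLM) z := by
      fin_cases i
      · have : planeEval (X 0) = Complex.reCLM := by ext z; simp [planeEval]
        simpa [this, planeEval, pderiv_X] using Complex.reCLM.hasStrictFDerivAt (x := z)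
      · have : planeEval (X 1) = Complex.imCLM := by ext z; simp [planeEval]
        simpa [this, planeEval, pderiv_X] using Complex.imCLM.hasStrictFDerivAt (x := z)
    have : planeEval (p * X i) = fun z => planeEval p z * planeEval (X i) z := by
      ext z; simp [planeEval]
    rw [this]
    refine (hp.mul hX).congr_fderiv ?_
    simp only [pderiv_mul, planeEval_add, planeEval_mul]
    ext
    simp
    ring

theorem hasDerivAt_planeEval (f : MvPolynomial (Fin 2) ℝ) {z : ℝ → ℂ} {z' : ℂ} {s : ℝ}
    (hz : HasDerivAt z z' s) : HasDerivAt (fun s => planeEval f (z s))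
      (z'.re * planeEval (pderiv 0 f) (z s) + z'.im * planeEval (pderiv 1 f) (z s)) s := by
  have := (hasStrictFDerivAt_planeEval f (z s)).hasFDerivAt.comp_hasDerivAt s hz
  exact this.congr_deriv (by simp [mul_comm])

theorem contDiff_planeEval (f : MvPolynomial (Fin 2) ℝ) : ContDiff ℝ ∞ (planeEval f) := by
  induction f using MvPolynomial.induction_on with
  | C a =>
    have : planeEval (C a) = fun _ => a := by ext z; simp [planeEval]
    rw [this]; exact contDiff_const
  | add p p' hp hp' =>
    have : planeEval (p + p') = fun z => planeEval p z + planeEval p' z := by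
      ext z; simp [planeEval]
    rw [this]; exact hp.add hp'
  | mul_X p i hp =>
    have hX : ContDiff ℝ ∞ (planeEval (X i)) := by
      fin_cases i
      · have : planeEval (X 0) = Complex.reCLM := by ext z; simp [planeEval]
        simpa [this] using Complex.reCLM.contDiff
      · have : planeEval (X 1) = Complex.imCLM := by ext z; simp [planeEval]
        simpa [this] using Complex.imCLM.contDiff
    have : planeEval (p * X i) = fun z => planeEval p z * planeEval (X i) z := by
      ext z; simp [planeEval]
    rw [this]; exact hp.mul hX

theorem pderiv_zero_pderiv_one (f : MvPolynomial (Fin 2) ℝ) :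
    pderiv 0 (pderiv 1 f) = pderiv 1 (pderiv 0 f) := by
  have : ⁅(pderiv 0 : Derivation ℝ (MvPolynomial (Fin 2) ℝ) (MvPolynomial (Fin 2) ℝ)),
      (pderiv 1 : Derivation ℝ (MvPolynomial (Fin 2) ℝ) (MvPolynomial (Fin 2) ℝ))⁆ = 0 := by
    apply MvPolynomial.derivation_ext
    intro i
    rw [Derivation.commutator_apply]
    fin_cases i
    · simp [pderiv_X]
    · simp [pderiv_X]
  have h := congrArg (fun D => D f) this
  simp only [Derivation.commutator_apply] at h
  exact sub_eq_zero.1 h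

theorem totalDegree_pderiv_le {σ K : Type*} [CommSemiring K] (i : σ) (f : MvPolynomial σ K) :
    (pderiv i f).totalDegree ≤ f.totalDegree - 1 := by
  classical
  conv_lhs => rw [f.as_sum, map_sum]
  refine totalDegree_finsetSum_le fun s hs => ?_
  rw [pderiv_monomial]
  by_cases hi : s i = 0
  · simp [hi]
  refine (totalDegree_monomial_le _ _).trans ?_
  have h1 := le_totalDegree hs
  have h2 : (s - Finsupp.single i 1).sum (fun _ e => e) + 1 = s.sum fun _ e => e := by
    conv_rhs => rw [← tsub_add_cancel_of_le (a := Finsupp.single i 1) (b := s)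
      (by simpa using Nat.one_le_iff_ne_zero.2 hi)]
    rw [Finsupp.sum_add_index' (by simp) (by simp)]
    simp
  change (s - Finsupp.single i 1).sum (fun _ e => e) ≤ _
  omega

theorem pderiv_eq_zero_of_dvd {σ K : Type*} [Field K] {i : σ} {f : MvPolynomial σ K}
    (h : f ∣ pderiv i f) : pderiv i f = 0 := by
  by_contra hne
  obtain ⟨g, hg⟩ := h
  have hf0 : f ≠ 0 := by rintro rfl; simp at hne
  have hg0 : g ≠ 0 := by rintro rfl; simp [hg] at hne
  have h1 := totalDegree_pderiv_le i f
  rw [hg, totalDegree_mul_of_isDomain hf0 hg0] at h1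
  have h2 : f.totalDegree = 0 := by omega
  rw [totalDegree_eq_zero_iff_eq_C.1 h2] at hne
  simp at hne

/-- An irreducible real polynomial has a non-zero partial derivative. -/
theorem pderiv_ne_zero_of_irreducible {f : MvPolynomial (Fin 2) ℝ} (hf : Irreducible f) :
    pderiv 0 f ≠ 0 ∨ pderiv 1 f ≠ 0 := by
  by_contra! h
  have hconst : ∀ z, planeEval f z = planeEval f 0 := by
    intro z
    refine is_const_of_fderiv_eq_zero (𝕜 := ℝ) (f := planeEval f)
      (fun z => (hasStrictFDerivAt_planeEval f z).hasFDerivAt.differentiableAt) (fun z => ?_) z 0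
    rw [(hasStrictFDerivAt_planeEval f z).hasFDerivAt.fderiv, h.1, h.2]
    ext
    simp [planeEval]
  have hC : f = C (planeEval f 0) := by
    refine MvPolynomial.funext fun x => ?_
    have h1 := hconst ⟨x 0, x 1⟩
    have h2 : ![x 0, x 1] = x := by ext i; fin_cases i <;> rfl
    simp only [planeEval, h2] at h1
    simp [h1, planeEval]
  rw [hC] at hf
  rcases eq_or_ne (planeEval f 0) 0 with h0 | h0
  · rw [h0, map_zero] at hf; exact hf.ne_zero rfl
  · exact hf.not_isUnit ((isUnit_iff_ne_zero.2 h0).map C)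

/-! ### Even functions -/

/-- If `φ = μ ε² + ν ε³ + o(ε³)` and `φᵏ⁺¹ g` is even, then the first odd coefficient
of `(φ / ε²)ᵏ⁺¹ g` vanishes. -/
theorem odd_coefficient_eq_zero {φ g : ℝ → ℝ} {μ ν g₁ : ℝ} {k : ℕ}
    (hφ : (fun ε => φ ε - (μ * ε ^ 2 + ν * ε ^ 3)) =o[𝓝 0] fun ε => ε ^ 3)
    (hg : HasDerivAt g g₁ 0) (heven : ∀ ε, φ ε ^ (k + 1) * g ε = φ (-ε) ^ (k + 1) * g (-ε))
    (hμ : μ ≠ 0) : (k + 1) * ν * g 0 + μ * g₁ = 0 := by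
  set ψ : ℝ → ℝ := fun ε => if ε = 0 then μ else φ ε / ε ^ 2 with hψ
  have hψ0 : ψ 0 = μ := by simp [hψ]
  have hψ' : HasDerivAt ψ ν 0 := by
    rw [hasDerivAt_iff_isLittleO]
    rw [Asymptotics.isLittleO_iff] at hφ ⊢
    intro c hc
    filter_upwards [hφ hc] with ε hε
    rcases eq_or_ne ε 0 with rfl | h0
    · simp [hψ]
    have h1 : ψ ε - ψ 0 - (ε - 0) • ν = (φ ε - (μ * ε ^ 2 + ν * ε ^ 3)) / ε ^ 2 := by
      simp only [hψ, h0, if_false, if_true, smul_eq_mul, sub_zero]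
      field_simp
      ring
    rw [h1, norm_div, sub_zero, div_le_iff₀ (norm_pos_iff.2 (pow_ne_zero _ h0))]
    refine hε.trans (le_of_eq ?_)
    rw [mul_assoc, ← norm_mul]
    congr 2
    ring
  have hΨ := (hψ'.pow (k + 1)).mul hg
  have hsymm : ∀ ε, (ψ ^ (k + 1) * g) (-ε) = (ψ ^ (k + 1) * g) ε := by
    intro ε
    rcases eq_or_ne ε 0 with rfl | h0
    · simp
    have h := heven ε
    simp only [Pi.mul_apply, Pi.pow_apply, hψ, h0, neg_eq_zero, if_false, even_two, Even.neg_pow,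
      div_pow]
    rw [div_mul_eq_mul_div, div_mul_eq_mul_div, h]
  have hΨ3 := HasDerivAt.scomp_of_eq (0 : ℝ) hΨ (hasDerivAt_neg (0 : ℝ)) (by simp)
  have : (ψ ^ (k + 1) * g) ∘ Neg.neg = ψ ^ (k + 1) * g := funext hsymm
  rw [this] at hΨ3
  have h := hΨ.unique hΨ3
  simp only [Pi.pow_apply, hψ0, Nat.add_sub_cancel] at h
  have hk : μ ^ k ≠ 0 := pow_ne_zero _ hμ
  have h2 : μ ^ k * ((k + 1) * ν * g 0 + μ * g₁) = 0 := by
    simp only [smul_eq_mul] at h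
    push_cast at h
    linear_combination h / 2
  exact (mul_eq_zero.1 h2).resolve_left hk

/-- Taylor's formula at a critical point with value `0`. -/
theorem taylor_order_three {φ φ₁ φ₂ φ₃ : ℝ → ℝ} (hφ : ContDiff ℝ ∞ φ)
    (h1 : ∀ ε, HasDerivAt φ (φ₁ ε) ε) (h2 : ∀ ε, HasDerivAt φ₁ (φ₂ ε) ε)
    (h3 : ∀ ε, HasDerivAt φ₂ (φ₃ ε) ε) (h0 : φ 0 = 0) (h10 : φ₁ 0 = 0) :
    (fun ε => φ ε - (φ₂ 0 / 2 * ε ^ 2 + φ₃ 0 / 6 * ε ^ 3)) =o[𝓝 0] fun ε => ε ^ 3 := by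
  have h := taylor_isLittleO_univ (x₀ := 0) (n := 3) (hφ.of_le (by
    change ((3 : ℕ∞) : WithTop ℕ∞) ≤ _; exact_mod_cast le_top))
  have e1 : deriv φ = φ₁ := funext fun ε => (h1 ε).deriv
  have e2 : deriv φ₁ = φ₂ := funext fun ε => (h2 ε).deriv
  have e3 : deriv φ₂ = φ₃ := funext fun ε => (h3 ε).deriv
  have : (fun x ↦ φ x - taylorWithinEval φ 3 Set.univ 0 x) =
      fun ε => φ ε - (φ₂ 0 / 2 * ε ^ 2 + φ₃ 0 / 6 * ε ^ 3) := by
    ext ε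
    simp only [taylor_within_apply, iteratedDerivWithin_univ, Finset.sum_range_succ,
      Finset.sum_range_zero, iteratedDeriv_succ, iteratedDeriv_zero, e1, e2, e3, h0, h10]
    norm_num [Nat.factorial]
    ring
  rw [this] at h
  simpa using h

/-! ### Frenet equations -/

/-- The signed curvature of a unit speed plane curve, so that `γ'' = k J γ'`. -/
noncomputable def curvature (γ : ℝ → ℂ) (s : ℝ) : ℝ :=
  (deriv γ s).re * (deriv (deriv γ) s).im - (deriv γ s).im * (deriv (deriv γ) s).re

theorem contDiff_deriv {γ : ℝ → ℂ} (hγ : ContDiff ℝ ∞ γ) :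
    ContDiff ℝ ∞ (deriv γ) :=
  ((contDiff_infty_iff_deriv (𝕜 := ℝ)).1 hγ).2

theorem hasDerivAt_curve {γ : ℝ → ℂ} (hγ : ContDiff ℝ ∞ γ)
    (s : ℝ) : HasDerivAt γ (deriv γ s) s :=
  (hγ.differentiable (by simp)).differentiableAt.hasDerivAt

theorem contDiff_curvature {γ : ℝ → ℂ} (hγ : ContDiff ℝ ∞ γ) :
    ContDiff ℝ ∞ (curvature γ) := by
  have h1 := contDiff_deriv hγ
  have h2 := contDiff_deriv h1
  exact ((Complex.reCLM.contDiff.comp h1).mul (Complex.imCLM.contDiff.comp h2)).sub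
    ((Complex.imCLM.contDiff.comp h1).mul (Complex.reCLM.contDiff.comp h2))

theorem contDiff_normal {γ : ℝ → ℂ} (hγ : ContDiff ℝ ∞ γ) :
    ContDiff ℝ ∞ (normal γ) :=
  contDiff_const.mul (contDiff_deriv hγ)

theorem contDiff_parallelCurve {γ : ℝ → ℂ} (hγ : ContDiff ℝ ∞ γ)
    (t : ℝ) : ContDiff ℝ ∞ (parallelCurve γ t) :=
  hγ.add (contDiff_const.mul (contDiff_normal hγ))

theorem sq_add_sq_deriv {γ : ℝ → ℂ} (hu : ∀ s, ‖deriv γ s‖ = 1) (s : ℝ) :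
    (deriv γ s).re ^ 2 + (deriv γ s).im ^ 2 = 1 := by
  have := Complex.sq_norm (deriv γ s)
  rw [hu, Complex.normSq_apply] at this
  linarith

theorem hasDerivAt_re {z : ℝ → ℂ} {z' : ℂ} {s : ℝ} (h : HasDerivAt z z' s) :
    HasDerivAt (fun s => (z s).re) z'.re s := Complex.reCLM.hasFDerivAt.comp_hasDerivAt s h

theorem hasDerivAt_im {z : ℝ → ℂ} {z' : ℂ} {s : ℝ} (h : HasDerivAt z z' s) :
    HasDerivAt (fun s => (z s).im) z'.im s := Complex.imCLM.hasFDerivAt.comp_hasDerivAt s h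

theorem deriv_deriv_curve {γ : ℝ → ℂ} (hγ : ContDiff ℝ ∞ γ) (hu : ∀ s, ‖deriv γ s‖ = 1)
    (s : ℝ) :
    deriv (deriv γ) s = curvature γ s * normal γ s := by
  have h1 := hasDerivAt_curve (contDiff_deriv hγ) s
  have h2 := (((hasDerivAt_re h1).pow 2).add ((hasDerivAt_im h1).pow 2)).unique
    ((hasDerivAt_const s (1 : ℝ)).congr_of_eventuallyEq
      (Eventually.of_forall fun s => sq_add_sq_deriv hu s))
  have h3 := sq_add_sq_deriv hu s
  norm_num at h2
  apply Complex.ext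
  · simp [curvature, normal]
    linear_combination -(deriv (deriv γ) s).re * h3 + (deriv γ s).re * h2 / 2
  · simp [curvature, normal]
    linear_combination -(deriv (deriv γ) s).im * h3 + (deriv γ s).im * h2 / 2

theorem hasDerivAt_normal {γ : ℝ → ℂ} (hγ : ContDiff ℝ ∞ γ) (hu : ∀ s, ‖deriv γ s‖ = 1)
    (s : ℝ) :
    HasDerivAt (normal γ) (-(curvature γ s * deriv γ s)) s := by
  have h := (hasDerivAt_curve (contDiff_deriv hγ) s).const_mul Complex.I
  refine h.congr_deriv ?_
  rw [deriv_deriv_curve hγ hu, normal]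
  linear_combination (curvature γ s * deriv γ s : ℂ) * Complex.I_mul_I

/-- `γ_t' = (1 - t k) γ'`. -/
theorem hasDerivAt_parallelCurve {γ : ℝ → ℂ} (hγ : ContDiff ℝ ∞ γ) (hu : ∀ s, ‖deriv γ s‖ = 1)
    (t s : ℝ) :
    HasDerivAt (parallelCurve γ t) (((1 - t * curvature γ s : ℝ) : ℂ) * deriv γ s) s := by
  refine ((hasDerivAt_curve hγ s).add ((hasDerivAt_normal hγ hu s).const_mul
    (t : ℂ))).congr_deriv ?_
  push_cast
  ring

theorem hasDerivAt_tangent_re {γ : ℝ → ℂ} (hγ : ContDiff ℝ ∞ γ) (hu : ∀ s, ‖deriv γ s‖ = 1)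
    (s : ℝ) : HasDerivAt (fun s => (deriv γ s).re)
    (-(curvature γ s * (deriv γ s).im)) s := by
  refine (hasDerivAt_re (hasDerivAt_curve (contDiff_deriv hγ) s)).congr_deriv ?_
  rw [deriv_deriv_curve hγ hu]
  simp [normal]

theorem hasDerivAt_tangent_im {γ : ℝ → ℂ} (hγ : ContDiff ℝ ∞ γ) (hu : ∀ s, ‖deriv γ s‖ = 1)
    (s : ℝ) : HasDerivAt (fun s => (deriv γ s).im)
    (curvature γ s * (deriv γ s).re) s := by
  refine (hasDerivAt_im (hasDerivAt_curve (contDiff_deriv hγ) s)).congr_deriv ?_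
  rw [deriv_deriv_curve hγ hu]
  simp [normal]

/-! ### The third order expansion of a polynomial at a parallel curve -/

/-- The derivative of the polynomial `f` in the direction of the normal of `γ`, along `γ_t`. -/
noncomputable def normalDeriv (f : MvPolynomial (Fin 2) ℝ) (γ : ℝ → ℂ) (t s : ℝ) : ℝ :=
  (deriv γ s).re * planeEval (pderiv 1 f) (parallelCurve γ t s) -
    (deriv γ s).im * planeEval (pderiv 0 f) (parallelCurve γ t s)

/-- The point at distance `|t|` from `γ(s)`, in the direction of the normal turned by `ε`. For
`t = r` it is the centre of the Larmor circle through `γ(s)` with velocity `exp(iε) γ'(s)`. -/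
noncomputable def larmorCenter (γ : ℝ → ℂ) (t s ε : ℝ) : ℂ :=
  γ s + t * (Complex.exp (ε * Complex.I) * normal γ s)

theorem larmorCenter_zero (γ : ℝ → ℂ) (t s : ℝ) : larmorCenter γ t s 0 = parallelCurve γ t s := by
  simp [larmorCenter, parallelCurve]

theorem hasDerivAt_exp_mul (w : ℂ) (ε : ℝ) :
    HasDerivAt (fun ε : ℝ => Complex.exp (ε * Complex.I) * w)
      (Complex.I * (Complex.exp (ε * Complex.I) * w)) ε := by
  have h := (((Complex.ofRealCLM.hasDerivAt (x := ε)).mul_const Complex.I).cexp).mul_const w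
  refine h.congr_deriv ?_
  simp
  ring

theorem hasDerivAt_larmorCenter (γ : ℝ → ℂ) (t s ε : ℝ) :
    HasDerivAt (larmorCenter γ t s) (-t * (Complex.exp (ε * Complex.I) * deriv γ s)) ε := by
  refine (((hasDerivAt_exp_mul (normal γ s) ε).const_mul (t : ℂ)).const_add (γ s)).congr_deriv ?_
  rw [normal]
  linear_combination (t * Complex.exp (ε * Complex.I) * deriv γ s) * Complex.I_mul_I

/-- The elimination in `third_order_expansion`: `N`, `T`, `H` stand for the mixed second, the
third tangential and the second tangential derivative of `f`, `h1` and `h2` for the second order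
relation and its derivative along `γ_t`. -/
theorem third_order_coefficient_algebra {m t k k' l N T H : ℝ} (hm : m ≠ 0) (hmk : m = 1 - t * k)
    (h1 : k * l + m * H = 0)
    (h2 : k' * l + k * (m * N) - t * k' * H + m * (2 * k * N + m * T) = 0) :
    (3 * t ^ 2 * N - t ^ 3 * T) / 6 =
      t ^ 2 / 6 * (3 * (m * N) / m ^ 2 + t * k' * l / m ^ 3) := by
  have hH : H = -(k * l) / m := by field_simp; linear_combination h1
  have hT : T = -(k' * l + 3 * k * m * N - t * k' * H) / m ^ 2 := by
    field_simp; linear_combination h2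
  rw [hT, hH]
  field_simp
  linear_combination (3 * t ^ 2 * N * m ^ 2 + t ^ 3 * k' * l) * hmk

section

variable {γ : ℝ → ℂ} {t : ℝ} {f : MvPolynomial (Fin 2) ℝ}

/-- If `f` vanishes on `γ_t`, so does its derivative in the direction of the tangent. -/
theorem tangential_deriv_eq_zero (hγ : ContDiff ℝ ∞ γ) (hu : ∀ s, ‖deriv γ s‖ = 1)
    (hm : ∀ s, 1 - t * curvature γ s ≠ 0) (hf : ∀ s, planeEval f (parallelCurve γ t s) = 0)
    (s : ℝ) : (deriv γ s).re * planeEval (pderiv 0 f) (parallelCurve γ t s) +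
      (deriv γ s).im * planeEval (pderiv 1 f) (parallelCurve γ t s) = 0 := by
  have h := (hasDerivAt_planeEval f (hasDerivAt_parallelCurve hγ hu t s)).unique
    ((hasDerivAt_const s (0 : ℝ)).congr_of_eventuallyEq (Eventually.of_forall hf))
  rw [Complex.re_ofReal_mul, Complex.im_ofReal_mul] at h
  exact (mul_eq_zero.1 (by linear_combination h :
    (1 - t * curvature γ s) * ((deriv γ s).re * planeEval (pderiv 0 f) (parallelCurve γ t s) +
      (deriv γ s).im * planeEval (pderiv 1 f) (parallelCurve γ t s)) = 0)).resolve_left (hm s)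

/-- The derivative along `γ_t` of a polynomial. -/
theorem hasDerivAt_planeEval_parallelCurve (hγ : ContDiff ℝ ∞ γ) (hu : ∀ s, ‖deriv γ s‖ = 1)
    (g : MvPolynomial (Fin 2) ℝ) (s : ℝ) :
    HasDerivAt (fun s => planeEval g (parallelCurve γ t s)) ((1 - t * curvature γ s) *
      ((deriv γ s).re * planeEval (pderiv 0 g) (parallelCurve γ t s) +
        (deriv γ s).im * planeEval (pderiv 1 g) (parallelCurve γ t s))) s := by
  refine (hasDerivAt_planeEval g (hasDerivAt_parallelCurve hγ hu t s)).congr_deriv ?_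
  rw [Complex.re_ofReal_mul, Complex.im_ofReal_mul]
  ring

/-- The second derivative along `γ_t` of the equation `f = 0`, divided by `m = 1 - t k`. -/
theorem second_order_relation (hγ : ContDiff ℝ ∞ γ) (hu : ∀ s, ‖deriv γ s‖ = 1)
    (hm : ∀ s, 1 - t * curvature γ s ≠ 0) (hf : ∀ s, planeEval f (parallelCurve γ t s) = 0)
    (s : ℝ) : curvature γ s * normalDeriv f γ t s + (1 - t * curvature γ s) *
      ((deriv γ s).re ^ 2 * planeEval (pderiv 0 (pderiv 0 f)) (parallelCurve γ t s) +
        2 * (deriv γ s).re * (deriv γ s).im *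
          planeEval (pderiv 1 (pderiv 0 f)) (parallelCurve γ t s) +
        (deriv γ s).im ^ 2 * planeEval (pderiv 1 (pderiv 1 f)) (parallelCurve γ t s)) = 0 := by
  have h1 := ((hasDerivAt_tangent_re hγ hu s).mul
    (hasDerivAt_planeEval_parallelCurve (t := t) hγ hu (pderiv 0 f) s)).add
    ((hasDerivAt_tangent_im hγ hu s).mul
    (hasDerivAt_planeEval_parallelCurve (t := t) hγ hu (pderiv 1 f) s))
  have h := h1.unique ((hasDerivAt_const s (0 : ℝ)).congr_of_eventuallyEq
    (Eventually.of_forall fun s => tangential_deriv_eq_zero hγ hu hm hf s))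
  rw [pderiv_zero_pderiv_one] at h
  rw [normalDeriv]
  linear_combination h

theorem hasDerivAt_normalDeriv (hγ : ContDiff ℝ ∞ γ) (hu : ∀ s, ‖deriv γ s‖ = 1)
    (hm : ∀ s, 1 - t * curvature γ s ≠ 0) (hf : ∀ s, planeEval f (parallelCurve γ t s) = 0)
    (s : ℝ) : HasDerivAt (normalDeriv f γ t) ((1 - t * curvature γ s) *
      ((deriv γ s).re * (deriv γ s).im * (planeEval (pderiv 1 (pderiv 1 f)) (parallelCurve γ t s) -
        planeEval (pderiv 0 (pderiv 0 f)) (parallelCurve γ t s)) +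
        ((deriv γ s).re ^ 2 - (deriv γ s).im ^ 2) *
          planeEval (pderiv 1 (pderiv 0 f)) (parallelCurve γ t s))) s := by
  have h1 := ((hasDerivAt_tangent_re hγ hu s).mul
    (hasDerivAt_planeEval_parallelCurve (t := t) hγ hu (pderiv 1 f) s)).sub
    ((hasDerivAt_tangent_im hγ hu s).mul
    (hasDerivAt_planeEval_parallelCurve (t := t) hγ hu (pderiv 0 f) s))
  refine h1.congr_deriv ?_
  have h0 := tangential_deriv_eq_zero hγ hu hm hf s
  rw [pderiv_zero_pderiv_one]
  linear_combination -curvature γ s * h0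

/-- If `f` vanishes on `γ_t`, then its values on the circle of radius `|t|` about `γ(s)` near
`γ_t(s)` are determined up to third order by the normal derivative `λ` along `γ_t`, its
`s`-derivative, and the factor `m = 1 - t k`. -/
theorem third_order_expansion (hγ : ContDiff ℝ ∞ γ) (hu : ∀ s, ‖deriv γ s‖ = 1)
    (hm : ∀ s, 1 - t * curvature γ s ≠ 0) (hf : ∀ s, planeEval f (parallelCurve γ t s) = 0)
    (s : ℝ) : (fun ε => planeEval f (larmorCenter γ t s ε) -
      (-(t * normalDeriv f γ t s / (2 * (1 - t * curvature γ s))) * ε ^ 2 +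
        t ^ 2 / 6 * (3 * deriv (normalDeriv f γ t) s / (1 - t * curvature γ s) ^ 2 +
          t * deriv (curvature γ) s * normalDeriv f γ t s / (1 - t * curvature γ s) ^ 3) * ε ^ 3))
      =o[𝓝 0] fun ε => ε ^ 3 := by
  set u : ℝ → ℂ := fun ε => Complex.exp (ε * Complex.I) * deriv γ s with hu_def
  have hz : ∀ ε, HasDerivAt (larmorCenter γ t s) (-t * u ε) ε :=
    hasDerivAt_larmorCenter γ t s
  have hur : ∀ ε, HasDerivAt (fun ε => (u ε).re) (-(u ε).im) ε := fun ε =>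
    (hasDerivAt_re (hasDerivAt_exp_mul (deriv γ s) ε)).congr_deriv (by simp [hu_def])
  have hui : ∀ ε, HasDerivAt (fun ε => (u ε).im) (u ε).re ε := fun ε =>
    (hasDerivAt_im (hasDerivAt_exp_mul (deriv γ s) ε)).congr_deriv (by simp [hu_def])
  have hE : ∀ (g : MvPolynomial (Fin 2) ℝ) (ε : ℝ),
      HasDerivAt (fun ε => planeEval g (larmorCenter γ t s ε))
        (-t * ((u ε).re * planeEval (pderiv 0 g) (larmorCenter γ t s ε) +
          (u ε).im * planeEval (pderiv 1 g) (larmorCenter γ t s ε))) ε := by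
    intro g ε
    refine (hasDerivAt_planeEval g (hz ε)).congr_deriv ?_
    simp
    ring
  set E : MvPolynomial (Fin 2) ℝ → ℝ → ℝ := fun g ε =>
    planeEval g (larmorCenter γ t s ε) with hE_def
  have h1 : ∀ ε, HasDerivAt (E f) (-t * ((u ε).re * E (pderiv 0 f) ε +
      (u ε).im * E (pderiv 1 f) ε)) ε := hE f
  have h2 : ∀ ε, HasDerivAt (fun ε => -t * ((u ε).re * E (pderiv 0 f) ε +
      (u ε).im * E (pderiv 1 f) ε))
      (-t * (-(u ε).im * E (pderiv 0 f) ε + (u ε).re * E (pderiv 1 f) ε) +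
        t ^ 2 * ((u ε).re ^ 2 * E (pderiv 0 (pderiv 0 f)) ε +
          2 * (u ε).re * (u ε).im * E (pderiv 1 (pderiv 0 f)) ε +
          (u ε).im ^ 2 * E (pderiv 1 (pderiv 1 f)) ε)) ε := by
    intro ε
    refine ((((hur ε).mul (hE (pderiv 0 f) ε)).add ((hui ε).mul (hE (pderiv 1 f) ε))).const_mul
      (-t)).congr_deriv ?_
    rw [pderiv_zero_pderiv_one]
    simp only [hE_def]
    ring
  have h3 : ∀ ε, HasDerivAt (fun ε =>
      -t * (-(u ε).im * E (pderiv 0 f) ε + (u ε).re * E (pderiv 1 f) ε) +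
        t ^ 2 * ((u ε).re ^ 2 * E (pderiv 0 (pderiv 0 f)) ε +
          2 * (u ε).re * (u ε).im * E (pderiv 1 (pderiv 0 f)) ε +
          (u ε).im ^ 2 * E (pderiv 1 (pderiv 1 f)) ε))
      (t * ((u ε).re * E (pderiv 0 f) ε + (u ε).im * E (pderiv 1 f) ε) +
        3 * t ^ 2 * ((u ε).re * (u ε).im * (E (pderiv 1 (pderiv 1 f)) ε -
          E (pderiv 0 (pderiv 0 f)) ε) + ((u ε).re ^ 2 - (u ε).im ^ 2) *
            E (pderiv 1 (pderiv 0 f)) ε) -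
        t ^ 3 * ((u ε).re ^ 2 * ((u ε).re * E (pderiv 0 (pderiv 0 (pderiv 0 f))) ε +
            (u ε).im * E (pderiv 1 (pderiv 0 (pderiv 0 f))) ε) +
          2 * (u ε).re * (u ε).im * ((u ε).re * E (pderiv 0 (pderiv 1 (pderiv 0 f))) ε +
            (u ε).im * E (pderiv 1 (pderiv 1 (pderiv 0 f))) ε) +
          (u ε).im ^ 2 * ((u ε).re * E (pderiv 0 (pderiv 1 (pderiv 1 f))) ε +
            (u ε).im * E (pderiv 1 (pderiv 1 (pderiv 1 f))) ε))) ε := by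
    intro ε
    refine ((((((hui ε).neg).mul (hE (pderiv 0 f) ε)).add
      ((hur ε).mul (hE (pderiv 1 f) ε))).const_mul (-t)).add
      ((((((hur ε).pow 2).mul (hE (pderiv 0 (pderiv 0 f)) ε)).add
        ((((hur ε).const_mul 2).mul (hui ε)).mul (hE (pderiv 1 (pderiv 0 f)) ε))).add
        (((hui ε).pow 2).mul (hE (pderiv 1 (pderiv 1 f)) ε))).const_mul (t ^ 2))).congr_deriv ?_
    rw [pderiv_zero_pderiv_one f]
    simp only [hE_def, Pi.neg_apply, Pi.mul_apply, Pi.pow_apply]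
    norm_num
    ring
  have hu0 : u 0 = deriv γ s := by simp [hu_def]
  have hE0 : ∀ g, E g 0 = planeEval g (parallelCurve γ t s) := by
    intro g; simp only [hE_def, larmorCenter_zero]
  have hsmooth : ContDiff ℝ ∞ (E f) := by
    refine (contDiff_planeEval f).comp ?_
    have : ContDiff ℝ ∞ fun ε : ℝ => (ε : ℂ) := Complex.ofRealCLM.contDiff
    unfold larmorCenter
    fun_prop
  have htan := tangential_deriv_eq_zero hγ hu hm hf s
  have h := taylor_order_three hsmooth h1 h2 h3 (by rw [hE0]; exact hf s)
    (by rw [hE0, hE0, hu0]; linear_combination -t * htan)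
  simp only [hE0, hu0] at h
  convert h using 7
  · -- the second order coefficient
    have h2' := second_order_relation hγ hu hm hf s
    have hms := hm s
    rw [normalDeriv] at h2' ⊢
    field_simp
    linear_combination -t ^ 2 * h2'
  · -- the third derivatives of `f` come from the `s`-derivative of the second order relation
    have h2' := second_order_relation hγ hu hm hf
    have hk : HasDerivAt (curvature γ) (deriv (curvature γ) s) s :=
      ((contDiff_curvature hγ).differentiable (by simp)).differentiableAt.hasDerivAt
    have hl := hasDerivAt_normalDeriv hγ hu hm hf s
    have hP := fun g => hasDerivAt_planeEval_parallelCurve (t := t) hγ hu g s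
    have ha := hasDerivAt_tangent_re hγ hu s
    have hb := hasDerivAt_tangent_im hγ hu s
    have hd := ((hk.mul hl).add (((hk.const_mul t).const_sub 1).mul
      ((((ha.pow 2).mul (hP (pderiv 0 (pderiv 0 f)))).add
        (((ha.const_mul 2).mul hb).mul (hP (pderiv 1 (pderiv 0 f))))).add
        ((hb.pow 2).mul (hP (pderiv 1 (pderiv 1 f))))))).unique
      ((hasDerivAt_const s (0 : ℝ)).congr_of_eventuallyEq (Eventually.of_forall h2'))
    have h2s := h2' s
    have hms := hm s
    rw [hl.deriv, htan, mul_zero, zero_add]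
    refine (third_order_coefficient_algebra hms rfl h2s ?_).symm
    simp only [Pi.pow_apply, Pi.mul_apply, Pi.add_apply, Nat.cast_ofNat, Nat.add_one_sub_one,
      pow_one] at hd
    linear_combination hd

end

/-! ### The conserved quantity along the parallel curve -/

theorem deriv_eq_zero_of_even {φ : ℝ → ℝ} {φ' : ℝ} (h : HasDerivAt φ φ' 0)
    (heven : ∀ ε, φ ε = φ (-ε)) : φ' = 0 := by
  have h2 := HasDerivAt.scomp_of_eq (0 : ℝ) h (hasDerivAt_neg (0 : ℝ)) (by simp)
  have : φ ∘ Neg.neg = φ := funext fun ε => (heven ε).symm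
  rw [this] at h2
  have := h.unique h2
  simp only [smul_eq_mul] at this
  linarith

section

variable {γ : ℝ → ℂ} {t : ℝ} {f g : MvPolynomial (Fin 2) ℝ}

theorem hasDerivAt_planeEval_larmorCenter_zero (g : MvPolynomial (Fin 2) ℝ) (γ : ℝ → ℂ) (t s : ℝ) :
    HasDerivAt (fun ε => planeEval g (larmorCenter γ t s ε))
      (-t * ((deriv γ s).re * planeEval (pderiv 0 g) (parallelCurve γ t s) +
        (deriv γ s).im * planeEval (pderiv 1 g) (parallelCurve γ t s))) 0 := by
  refine (hasDerivAt_planeEval g (hasDerivAt_larmorCenter γ t s 0)).congr_deriv ?_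
  rw [larmorCenter_zero]
  simp
  ring

/-- To first order, evenness on the circles about the points of `γ` makes `f` constant along
`γ_t`. -/
theorem planeEval_parallelCurve_const (hγ : ContDiff ℝ ∞ γ) (hu : ∀ s, ‖deriv γ s‖ = 1)
    (ht : t ≠ 0) (heven : ∀ s ε, planeEval f (larmorCenter γ t s ε) =
      planeEval f (larmorCenter γ t s (-ε))) (s : ℝ) :
    planeEval f (parallelCurve γ t s) = planeEval f (parallelCurve γ t 0) := by
  have hd : ∀ s, HasDerivAt (fun s => planeEval f (parallelCurve γ t s)) 0 s := by
    intro s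
    refine (hasDerivAt_planeEval_parallelCurve hγ hu f s).congr_deriv ?_
    have h := deriv_eq_zero_of_even (hasDerivAt_planeEval_larmorCenter_zero f γ t s) (heven s)
    have := (mul_eq_zero.1 h).resolve_left (neg_ne_zero.2 ht)
    rw [this, mul_zero]
  exact is_const_of_deriv_eq_zero (fun s => (hd s).differentiableAt) (fun s => (hd s).deriv) s 0

/-- The relation that the evenness of `f ^ (k+1) * g` on the circles about the points of `γ`
imposes on the normal derivative `λ` of `f` and on `g` along `γ_t`; it is the logarithmic
derivative of `g³ λ^{3(k+1)} / m^{k+1}`. -/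
theorem log_deriv_relation (hγ : ContDiff ℝ ∞ γ) (hu : ∀ s, ‖deriv γ s‖ = 1) (ht : t ≠ 0)
    (hm : ∀ s, 1 - t * curvature γ s ≠ 0) (hf : ∀ s, planeEval f (parallelCurve γ t s) = 0)
    {k : ℕ} (heven : ∀ s ε, planeEval (f ^ (k + 1) * g) (larmorCenter γ t s ε) =
      planeEval (f ^ (k + 1) * g) (larmorCenter γ t s (-ε))) (s : ℝ)
    (hl : normalDeriv f γ t s ≠ 0) :
    3 * (k + 1) * deriv (normalDeriv f γ t) s * planeEval g (parallelCurve γ t s) *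
        (1 - t * curvature γ s) +
      (k + 1) * t * deriv (curvature γ) s * normalDeriv f γ t s *
        planeEval g (parallelCurve γ t s) +
      3 * deriv (fun s => planeEval g (parallelCurve γ t s)) s * normalDeriv f γ t s *
        (1 - t * curvature γ s) = 0 := by
  have hms := hm s
  have h := odd_coefficient_eq_zero (third_order_expansion hγ hu hm hf s)
    (hasDerivAt_planeEval_larmorCenter_zero g γ t s)
    (fun ε => by simpa only [planeEval_mul, planeEval_pow] using heven s ε)
    (neg_ne_zero.2 (div_ne_zero (mul_ne_zero ht hl) (mul_ne_zero two_ne_zero hms)))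
  rw [(hasDerivAt_planeEval_parallelCurve hγ hu g s).deriv]
  rw [larmorCenter_zero] at h
  generalize (deriv γ s).re * planeEval (pderiv 0 g) (parallelCurve γ t s) +
        (deriv γ s).im * planeEval (pderiv 1 g) (parallelCurve γ t s) = G at h ⊢
  generalize 1 - t * curvature γ s = m at *
  generalize planeEval g (parallelCurve γ t s) = g0 at *
  generalize normalDeriv f γ t s = l at *
  generalize deriv (normalDeriv f γ t) s = l' at *
  generalize deriv (curvature γ) s = k' at *
  field_simp at h
  have h2 : t ^ 2 * (3 * (k + 1) * l' * g0 * m + (k + 1) * t * k' * l * g0 +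
      3 * (m * G) * l * m) = 0 := by linear_combination h / 2
  exact (mul_eq_zero.1 h2).resolve_left (pow_ne_zero _ ht)

/-- The quantity `g³ λ^{3(k+1)} / m^{k+1}` is constant along `γ_t`. -/
theorem conserved_quantity (hγ : ContDiff ℝ ∞ γ) (hu : ∀ s, ‖deriv γ s‖ = 1) (ht : t ≠ 0)
    (hm : ∀ s, 1 - t * curvature γ s ≠ 0) (hf : ∀ s, planeEval f (parallelCurve γ t s) = 0)
    {k : ℕ} (heven : ∀ s ε, planeEval (f ^ (k + 1) * g) (larmorCenter γ t s ε) =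
      planeEval (f ^ (k + 1) * g) (larmorCenter γ t s (-ε))) :
    ∃ c : ℝ, ∀ s, (planeEval g (parallelCurve γ t s) * normalDeriv f γ t s ^ (k + 1)) ^ 3 /
      (1 - t * curvature γ s) ^ (k + 1) = c := by
  refine ⟨_, fun s => is_const_of_deriv_eq_zero (f := fun s =>
    (planeEval g (parallelCurve γ t s) * normalDeriv f γ t s ^ (k + 1)) ^ 3 /
      (1 - t * curvature γ s) ^ (k + 1)) (fun s => ?_) (fun s => ?_) s 0⟩
  all_goals
    have hg' := (hasDerivAt_planeEval_parallelCurve (t := t) hγ hu g s).differentiableAt.hasDerivAt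
    have hl' := (hasDerivAt_normalDeriv hγ hu hm hf s).differentiableAt.hasDerivAt
    have hk' := ((contDiff_curvature hγ).differentiable (by simp) s).hasDerivAt
    have hd := ((hg'.mul (hl'.pow (k + 1))).pow 3).div (((hk'.const_mul t).const_sub 1).pow (k + 1))
      (pow_ne_zero _ (hm s))
  · exact hd.differentiableAt
  · refine hd.deriv.trans ?_
    simp only [Pi.mul_apply, Pi.pow_apply, Nat.add_sub_cancel]
    rw [div_eq_zero_iff]
    left
    by_cases hl : normalDeriv f γ t s = 0
    · simp [hl]
    have h := log_deriv_relation hγ hu ht hm hf heven s hl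
    push_cast
    linear_combination (planeEval g (parallelCurve γ t s) ^ 2 * normalDeriv f γ t s ^ (3 * k + 2) *
      (1 - t * curvature γ s) ^ k) * h

theorem normalDeriv_sq (hγ : ContDiff ℝ ∞ γ) (hu : ∀ s, ‖deriv γ s‖ = 1)
    (hm : ∀ s, 1 - t * curvature γ s ≠ 0) (hf : ∀ s, planeEval f (parallelCurve γ t s) = 0)
    (s : ℝ) : normalDeriv f γ t s ^ 2 =
      planeEval (pderiv 0 f ^ 2 + pderiv 1 f ^ 2) (parallelCurve γ t s) := by
  have h1 := tangential_deriv_eq_zero hγ hu hm hf s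
  have h2 := sq_add_sq_deriv hu s
  simp only [planeEval_add, planeEval_pow, normalDeriv]
  generalize planeEval (pderiv 0 f) (parallelCurve γ t s) = x at *
  generalize planeEval (pderiv 1 f) (parallelCurve γ t s) = y at *
  linear_combination (x ^ 2 + y ^ 2) * h2 - ((deriv γ s).re * x + (deriv γ s).im * y) * h1

/-- The polynomial `f_xx f_y² - 2 f_xy f_x f_y + f_yy f_x²`, which up to sign is the curvature of
the level curves of `f` times the cube of the length of the gradient. -/
noncomputable def levelHessian (f : MvPolynomial (Fin 2) ℝ) : MvPolynomial (Fin 2) ℝ :=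
  pderiv 0 (pderiv 0 f) * pderiv 1 f ^ 2 - C 2 * pderiv 1 (pderiv 0 f) * pderiv 0 f * pderiv 1 f +
    pderiv 1 (pderiv 1 f) * pderiv 0 f ^ 2

/-- Because `1 / m = 1 - t H / λ³` when `λ ≠ 0`: the curvature of `γ_t` can be read off from `f`. -/
theorem normalDeriv_pow_three_div (hγ : ContDiff ℝ ∞ γ) (hu : ∀ s, ‖deriv γ s‖ = 1)
    (hm : ∀ s, 1 - t * curvature γ s ≠ 0) (hf : ∀ s, planeEval f (parallelCurve γ t s) = 0)
    (s : ℝ) : normalDeriv f γ t s ^ 3 / (1 - t * curvature γ s) =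
      normalDeriv f γ t s ^ 3 - t * planeEval (levelHessian f) (parallelCurve γ t s) := by
  have h1 := tangential_deriv_eq_zero hγ hu hm hf s
  have h2 := sq_add_sq_deriv hu s
  have h3 := second_order_relation hγ hu hm hf s
  have hms := hm s
  simp only [planeEval_add, planeEval_sub, planeEval_mul, planeEval_pow, planeEval_C, levelHessian]
  have hx : planeEval (pderiv 0 f) (parallelCurve γ t s) =
      -(deriv γ s).im * normalDeriv f γ t s := by
    rw [normalDeriv]; linear_combination (deriv γ s).re * h1 -
      planeEval (pderiv 0 f) (parallelCurve γ t s) * h2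
  have hy : planeEval (pderiv 1 f) (parallelCurve γ t s) =
      (deriv γ s).re * normalDeriv f γ t s := by
    rw [normalDeriv]; linear_combination (deriv γ s).im * h1 -
      planeEval (pderiv 1 f) (parallelCurve γ t s) * h2
  rw [hx, hy, div_eq_iff hms]
  linear_combination t * normalDeriv f γ t s ^ 2 * h3

/-- The conserved quantity does not vanish: otherwise `f` would divide its own partial
derivatives. -/
theorem exists_mul_normalDeriv_ne_zero (hγ : ContDiff ℝ ∞ γ) (hu : ∀ s, ‖deriv γ s‖ = 1)
    (hm : ∀ s, 1 - t * curvature γ s ≠ 0) (hf : ∀ s, planeEval f (parallelCurve γ t s) = 0)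
    (hirr : Irreducible f)
    (hdvd : ∀ h : MvPolynomial (Fin 2) ℝ, (∀ s, planeEval h (parallelCurve γ t s) = 0) → f ∣ h)
    (hfg : ¬ f ∣ g) :
    ∃ s, planeEval g (parallelCurve γ t s) * normalDeriv f γ t s ≠ 0 := by
  by_contra! h
  have h1 : f ∣ g * (pderiv 0 f ^ 2 + pderiv 1 f ^ 2) := by
    refine hdvd _ fun s => ?_
    rw [planeEval_mul, ← normalDeriv_sq hγ hu hm hf, pow_two, ← mul_assoc, h s, zero_mul]
  have h2 := (hirr.prime.dvd_or_dvd h1).resolve_left hfg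
  have h3 : ∀ s, planeEval (pderiv 0 f) (parallelCurve γ t s) ^ 2 +
      planeEval (pderiv 1 f) (parallelCurve γ t s) ^ 2 = 0 := by
    intro s
    obtain ⟨w, hw⟩ := h2
    rw [← planeEval_pow, ← planeEval_pow, ← planeEval_add, hw, planeEval_mul, hf, zero_mul]
  have h4 : ∀ s, planeEval (pderiv 0 f) (parallelCurve γ t s) = 0 ∧
      planeEval (pderiv 1 f) (parallelCurve γ t s) = 0 := fun s => by
    constructor <;> nlinarith [h3 s]
  have h5 := pderiv_eq_zero_of_dvd (hdvd (pderiv 0 f) fun s => (h4 s).1)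
  have h7 := pderiv_eq_zero_of_dvd (hdvd (pderiv 1 f) fun s => (h4 s).2)
  rcases pderiv_ne_zero_of_irreducible hirr with h6 | h6
  · exact h6 h5
  · exact h6 h7

end

/-! ### Non-singularity -/

/-- The polynomials `A` and `B` in `λ²` with `(λ³ - t H)ⁿ = A + λ B`, for `D = λ²`. -/
noncomputable def evenOddParts {R : Type*} [CommRing R] (t D H : R) : ℕ → R × R
  | 0 => (1, 0)
  | n + 1 => (D ^ 2 * (evenOddParts t D H n).2 - t * H * (evenOddParts t D H n).1,
      D * (evenOddParts t D H n).1 - t * H * (evenOddParts t D H n).2)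

theorem evenOddParts_spec {R : Type*} [CommRing R] (t D H l : R) (hl : l ^ 2 = D) (n : ℕ) :
    (l ^ 3 - t * H) ^ n = (evenOddParts t D H n).1 + l * (evenOddParts t D H n).2 := by
  induction n with
  | zero => simp [evenOddParts]
  | succ n ih =>
    rw [pow_succ, ih]
    simp only [evenOddParts, ← hl]
    ring

theorem evenOddParts_map {R S : Type*} [CommRing R] [CommRing S] (φ : R →+* S) (t D H : R) (n : ℕ) :
    evenOddParts (φ t) (φ D) (φ H) n =
      (φ (evenOddParts t D H n).1, φ (evenOddParts t D H n).2) := by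
  induction n with
  | zero => simp [evenOddParts]
  | succ n ih => simp [evenOddParts, ih]

/-- If a non-constant polynomial `P` is even in the angle on the circles of radius `|t|` about the
points of `γ`, then `P - c₀` has, for its value `c₀` on `γ_t`, an irreducible factor that defines a
non-singular curve through `γ_t`. -/
theorem exists_nonsingular_curve {γ : ℝ → ℂ} {t : ℝ} (hγ : ContDiff ℝ ∞ γ)
    (hu : ∀ s, ‖deriv γ s‖ = 1) (ht : t ≠ 0) (hm : ∀ s, 1 - t * curvature γ s ≠ 0)
    {P : MvPolynomial (Fin 2) ℝ} (hP : ∀ c, P ≠ C c)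
    (heven : ∀ s ε, planeEval P (larmorCenter γ t s ε) =
      planeEval P (larmorCenter γ t s (-ε))) :
    ∃ f : MvPolynomial (Fin 2) ℝ, Irreducible (complexify f) ∧ IsNonsingular f ∧
      (∀ s, planeEval f (parallelCurve γ t s) = 0) ∧ ∀ s, normalDeriv f γ t s ≠ 0 := by
  set q := parallelCurve γ t
  have hq : ContDiff ℝ ∞ q := contDiff_parallelCurve hγ t
  have hq' : ∀ s, deriv q s ≠ 0 := by
    intro s
    rw [(hasDerivAt_parallelCurve hγ hu t s).deriv]
    refine mul_ne_zero (by exact_mod_cast hm s) ?_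
    rw [← norm_ne_zero_iff, hu]; exact one_ne_zero
  set c₀ := planeEval P (q 0)
  have hQ0 : P - C c₀ ≠ 0 := sub_ne_zero.2 (hP c₀)
  have hQq : ∀ s, eval ![(q s).re, (q s).im] (P - C c₀) = 0 := by
    intro s
    change planeEval (P - C c₀) (q s) = 0
    rw [planeEval_sub, planeEval_C, planeEval_parallelCurve_const hγ hu ht heven s, sub_self]
  obtain ⟨f, hirr, hfQ, hflat⟩ := exists_irreducible_factor_flat hq hq' hQ0 hQq
  have hf : ∀ s, planeEval f (q s) = 0 := fun s => eval_eq_zero_of_mem_flatIdeal (hflat s)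
  have hdvd : ∀ h : MvPolynomial (Fin 2) ℝ, (∀ s, planeEval h (q s) = 0) → f ∣ h := fun h hh =>
    dvd_of_mem_flatIdeal hq (hq' 0) hirr (hflat 0) (mem_flatIdeal_of_forall hq hh 0)
  have hfin : FiniteMultiplicity f (P - C c₀) :=
    FiniteMultiplicity.of_not_isUnit hirr.not_isUnit hQ0
  obtain ⟨g, hg, hfg⟩ := hfin.exists_eq_pow_mul_and_not_dvd
  obtain ⟨k, hk⟩ : ∃ k, multiplicity f (P - C c₀) = k + 1 := by
    refine Nat.exists_eq_succ_of_ne_zero ?_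
    rw [multiplicity_ne_zero]
    exact hfQ
  rw [hk] at hg
  have heven' : ∀ s ε, planeEval (f ^ (k + 1) * g) (larmorCenter γ t s ε) =
      planeEval (f ^ (k + 1) * g) (larmorCenter γ t s (-ε)) := by
    intro s ε
    rw [← hg, planeEval_sub, planeEval_sub, heven, planeEval_C, planeEval_C]
  obtain ⟨c, hc⟩ := conserved_quantity hγ hu ht hm hf heven'
  have hc0 : c ≠ 0 := by
    obtain ⟨s, hs⟩ := exists_mul_normalDeriv_ne_zero hγ hu hm hf hirr hdvd hfg
    rw [← hc s]
    refine div_ne_zero (pow_ne_zero _ (mul_ne_zero (left_ne_zero_of_mul hs)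
      (pow_ne_zero _ (right_ne_zero_of_mul hs)))) (pow_ne_zero _ (hm s))
  refine ⟨f, irreducible_complexify hq (hq' 0) hirr (hflat 0), ?_, hf, ?_⟩
  · -- the conserved quantity is `g³ (λ³ - t H)^{k+1}`; eliminating `λ` gives a polynomial relation
    set D := pderiv 0 f ^ 2 + pderiv 1 f ^ 2 with hD
    set H := levelHessian f with hH
    set E := evenOddParts (C t) D H (k + 1) with hE
    have hrel : f ∣ (g ^ 3 * E.1 - C c) ^ 2 - g ^ 6 * D * E.2 ^ 2 := by
      refine hdvd _ fun s => ?_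
      have h1 := hc s
      rw [mul_pow, ← pow_mul, mul_comm (k + 1) 3, pow_mul, mul_div_assoc, ← div_pow,
        normalDeriv_pow_three_div hγ hu hm hf s,
        evenOddParts_spec t _ _ _ (normalDeriv_sq hγ hu hm hf s)] at h1
      have h2 := evenOddParts_map (eval ![(q s).re, (q s).im]) (C t) D H (k + 1)
      rw [eval_C] at h2
      change evenOddParts t (planeEval D (q s)) (planeEval H (q s)) (k + 1) =
        (planeEval E.1 (q s), planeEval E.2 (q s)) at h2
      rw [h2] at h1
      have h3 := normalDeriv_sq hγ hu hm hf s
      simp only [planeEval_sub, planeEval_mul, planeEval_pow, planeEval_C]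
      rw [← h3]
      linear_combination (-(planeEval g (q s)) ^ 3 * (normalDeriv f γ t s * planeEval E.2 (q s)) +
        (planeEval g (q s) ^ 3 * planeEval E.1 (q s) - c)) * h1
    intro p hp
    by_contra! hsing
    have hp' : eval₂Hom (algebraMap ℝ ℂ) p f = 0 := hp
    have hsing' : ∀ i, eval₂Hom (algebraMap ℝ ℂ) p (pderiv i f) = 0 := hsing
    obtain ⟨w, hw⟩ := hrel
    have h1 := congrArg (eval₂Hom (algebraMap ℝ ℂ) p) hw
    have hDp : eval₂Hom (algebraMap ℝ ℂ) p D = 0 := by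
      rw [hD, map_add, map_pow, map_pow, hsing', hsing']; ring
    have hHp : eval₂Hom (algebraMap ℝ ℂ) p H = 0 := by
      simp only [hH, levelHessian, map_add, map_sub, map_mul, map_pow, hsing' 0, hsing' 1]
      ring
    have hEp := evenOddParts_map (eval₂Hom (algebraMap ℝ ℂ) p) (C t) D H (k + 1)
    rw [hDp, hHp] at hEp
    have hE1 : eval₂Hom (algebraMap ℝ ℂ) p E.1 = 0 := by
      refine (congrArg Prod.fst hEp).symm.trans ?_
      simp [evenOddParts]
    rw [map_sub, map_mul, map_mul, map_pow, map_sub, map_mul, hE1, hDp, map_mul, hp'] at h1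
    simp [hc0] at h1
  · intro s hs
    apply hc0
    rw [← hc s, hs]
    simp

/-! ### Tubular coordinates -/

theorem frame_coordinates (u w z : ℂ) {d : ℝ} (hd : u.re * w.im - u.im * w.re = d) (h : d ≠ 0) :
    (d⁻¹ * (w.im * z.re - w.re * z.im)) • u + (d⁻¹ * (u.re * z.im - u.im * z.re)) • w = z := by
  apply Complex.ext
  · simp only [Complex.add_re, Complex.smul_re, smul_eq_mul]
    field_simp
    rw [← hd]; ring
  · simp only [Complex.add_im, Complex.smul_im, smul_eq_mul]
    field_simp
    rw [← hd]; ring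

/-- The linear map `(a, b) ↦ a u + b w`, for linearly independent `u` and `w`. -/
noncomputable def frameEquiv (u w : ℂ) (h : u.re * w.im - u.im * w.re ≠ 0) : (ℝ × ℝ) ≃L[ℝ] ℂ :=
  ContinuousLinearEquiv.equivOfInverse
    ((ContinuousLinearMap.fst ℝ ℝ ℝ).smulRight u + (ContinuousLinearMap.snd ℝ ℝ ℝ).smulRight w)
    (((u.re * w.im - u.im * w.re)⁻¹ • (w.im • Complex.reCLM - w.re • Complex.imCLM)).prod
      ((u.re * w.im - u.im * w.re)⁻¹ • (u.re • Complex.imCLM - u.im • Complex.reCLM)))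
    (by
      rintro ⟨a, b⟩
      ext
      · simp; field_simp; ring
      · simp; field_simp; ring)
    (by
      intro z
      exact frame_coordinates u w z rfl h)

theorem frameEquiv_apply (u w : ℂ) (h : u.re * w.im - u.im * w.re ≠ 0) (p : ℝ × ℝ) :
    frameEquiv u w h p = p.1 • u + p.2 • w := rfl

/-- The normal map `(s, t) ↦ γ_t(s)`. -/
noncomputable def tube (γ : ℝ → ℂ) (p : ℝ × ℝ) : ℂ := parallelCurve γ p.2 p.1

theorem contDiff_tube {γ : ℝ → ℂ} (hγ : ContDiff ℝ ∞ γ) : ContDiff ℝ ∞ (tube γ) :=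
  (hγ.comp contDiff_fst).add ((Complex.ofRealCLM.contDiff.comp contDiff_snd).mul
    ((contDiff_normal hγ).comp contDiff_fst))

theorem tube_frame_det {γ : ℝ → ℂ} (hu : ∀ s, ‖deriv γ s‖ = 1) (m s : ℝ) :
    (((m : ℝ) : ℂ) * deriv γ s).re * (normal γ s).im -
      (((m : ℝ) : ℂ) * deriv γ s).im * (normal γ s).re = m := by
  have := sq_add_sq_deriv hu s
  simp [normal]
  linear_combination m * this

theorem hasStrictFDerivAt_tube {γ : ℝ → ℂ} (hγ : ContDiff ℝ ∞ γ) (hu : ∀ s, ‖deriv γ s‖ = 1)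
    (p : ℝ × ℝ) : HasStrictFDerivAt (tube γ)
      ((ContinuousLinearMap.fst ℝ ℝ ℝ).smulRight (((1 - p.2 * curvature γ p.1 : ℝ) : ℂ) *
        deriv γ p.1) + (ContinuousLinearMap.snd ℝ ℝ ℝ).smulRight (normal γ p.1)) p := by
  refine (contDiff_tube hγ).contDiffAt.hasStrictFDerivAt' ?_ (by simp)
  have hfst : HasFDerivAt (fun p : ℝ × ℝ => p.1) (ContinuousLinearMap.fst ℝ ℝ ℝ) p :=
    hasFDerivAt_fst
  have h1 := (hasDerivAt_curve hγ p.1).hasFDerivAt.comp p hfst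
  have h2 := (hasDerivAt_normal hγ hu p.1).hasFDerivAt.comp p hfst
  have h3 : HasFDerivAt (fun p : ℝ × ℝ => (p.2 : ℂ))
      (Complex.ofRealCLM.comp (ContinuousLinearMap.snd ℝ ℝ ℝ)) p :=
    Complex.ofRealCLM.hasFDerivAt.comp p (ContinuousLinearMap.snd ℝ ℝ ℝ).hasFDerivAt
  refine (h1.add (h3.mul h2)).congr_fderiv ?_
  ext
  · simp
    ring
  · simp

theorem hasStrictFDerivAt_tube_equiv {γ : ℝ → ℂ} (hγ : ContDiff ℝ ∞ γ)
    (hu : ∀ s, ‖deriv γ s‖ = 1) (p : ℝ × ℝ) (hm : 1 - p.2 * curvature γ p.1 ≠ 0) :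
    HasStrictFDerivAt (tube γ) (frameEquiv (((1 - p.2 * curvature γ p.1 : ℝ) : ℂ) * deriv γ p.1)
      (normal γ p.1) (by rw [tube_frame_det hu]; exact hm) : (ℝ × ℝ) →L[ℝ] ℂ) p :=
  hasStrictFDerivAt_tube hγ hu p

/-! ### Real ovals -/

/-- Near a point of the parallel curve where the normal derivative of `f` does not vanish, the real
zeros of `f` lie on the parallel curve. -/
theorem eventually_mem_range_of_planeEval_eq_zero {γ : ℝ → ℂ} {t : ℝ} (hγ : ContDiff ℝ ∞ γ)
    (hu : ∀ s, ‖deriv γ s‖ = 1) {f : MvPolynomial (Fin 2) ℝ}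
    (hf : ∀ s, planeEval f (parallelCurve γ t s) = 0) {s : ℝ} (hm : 1 - t * curvature γ s ≠ 0)
    (hl : normalDeriv f γ t s ≠ 0) :
    ∀ᶠ z in 𝓝 (parallelCurve γ t s), planeEval f z = 0 → z ∈ Set.range (parallelCurve γ t) := by
  have hT := hasStrictFDerivAt_tube_equiv hγ hu (s, t) hm
  have hF := (hasStrictFDerivAt_planeEval f (tube γ (s, t))).comp (s, t) hT
  have hmap := hT.map_nhds_eq_of_equiv
  change ∀ᶠ z in 𝓝 (tube γ (s, t)), _
  rw [← hmap, eventually_map]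
  have hlo := hF.isLittleO
  rw [Asymptotics.isLittleO_iff] at hlo
  have hlo' := hlo (half_pos (abs_pos.2 hl))
  have htend : Tendsto (fun p : ℝ × ℝ => (p, (p.1, t))) (𝓝 (s, t)) (𝓝 ((s, t), (s, t))) := by
    have : Continuous fun p : ℝ × ℝ => (p, (p.1, t)) := by fun_prop
    exact this.tendsto (s, t)
  filter_upwards [htend.eventually hlo'] with p hp hzero
  have h1 : planeEval f (tube γ (p.1, t)) = 0 := hf p.1
  have h2 : planeEval f (tube γ p) = 0 := hzero
  rw [h1, h2] at hp
  have hpt : p - (p.1, t) = (0, p.2 - t) := by ext <;> simp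
  have h3 : ((planeEval (pderiv 0 f) (tube γ (s, t)) • Complex.reCLM +
      planeEval (pderiv 1 f) (tube γ (s, t)) • Complex.imCLM) ∘L
      (frameEquiv (((1 - t * curvature γ s : ℝ) : ℂ) * deriv γ s) (normal γ s)
        (by rw [tube_frame_det hu]; exact hm) : (ℝ × ℝ) →L[ℝ] ℂ)) (0, p.2 - t) =
      (p.2 - t) * normalDeriv f γ t s := by
    simp only [ContinuousLinearMap.comp_apply, ContinuousLinearEquiv.coe_coe, frameEquiv_apply]
    simp [normal, normalDeriv, tube]
    ring
  rw [hpt, h3] at hp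
  have h4 : ‖((0 : ℝ), p.2 - t)‖ = |p.2 - t| := by simp [Prod.norm_def]
  rw [h4, sub_zero, zero_sub, norm_neg, Real.norm_eq_abs, abs_mul] at hp
  have h5 : p.2 = t := by
    by_contra hne
    have : 0 < |p.2 - t| := abs_pos.2 (sub_ne_zero.2 hne)
    nlinarith [abs_pos.2 hl]
  exact ⟨p.1, by rw [tube, h5]⟩

theorem nonempty_homeomorph_circle {q : ℝ → ℂ} {L : ℝ} (hL : 0 < L) (hq : Continuous q)
    (hper : Function.Periodic q L) (hinj : Set.InjOn q (Set.Ico 0 L)) :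
    Nonempty (Set.range q ≃ₜ Circle) := by
  have : Fact (0 < L) := ⟨hL⟩
  have hcont : Continuous (hper.lift : AddCircle L → ℂ) := by
    exact continuous_coinduced_dom.2 hq
  have hinj' : Function.Injective (hper.lift : AddCircle L → ℂ) := by
    intro x y hxy
    obtain ⟨a, ha, rfl⟩ := (AddCircle.coe_image_Ico_eq L 0).symm ▸ Set.mem_univ x
    obtain ⟨b, hb, rfl⟩ := (AddCircle.coe_image_Ico_eq L 0).symm ▸ Set.mem_univ y
    rw [zero_add] at ha hb
    rw [Function.Periodic.lift_coe, Function.Periodic.lift_coe] at hxy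
    rw [hinj ha hb hxy]
  have hrange : Set.range (hper.lift : AddCircle L → ℂ) = Set.range q := by
    ext z
    constructor
    · rintro ⟨x, rfl⟩
      obtain ⟨a, rfl⟩ := QuotientAddGroup.mk_surjective x
      exact ⟨a, rfl⟩
    · rintro ⟨a, rfl⟩
      exact ⟨(a : AddCircle L), rfl⟩
  have e := (hcont.isClosedEmbedding hinj').isEmbedding.toHomeomorph
  exact ⟨((Homeomorph.setCongr hrange).symm.trans e.symm).trans
    (AddCircle.homeomorphCircle hL.ne')⟩

/-- A simple closed curve that is open in the real zero set is one of its components. -/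
theorem isRealOval_of_isolated {f : MvPolynomial (Fin 2) ℝ} {q : ℝ → ℂ} {L : ℝ} (hL : 0 < L)
    (hq : Continuous q) (hper : Function.Periodic q L) (hinj : Set.InjOn q (Set.Ico 0 L))
    (hf : ∀ s, planeEval f (q s) = 0)
    (hiso : ∀ s, ∀ᶠ z in 𝓝 (q s), planeEval f z = 0 → z ∈ Set.range q) :
    IsRealOval f (Set.range q) := by
  obtain ⟨e⟩ := nonempty_homeomorph_circle hL hq hper hinj
  refine ⟨⟨q 0, hf 0, ?_⟩, ⟨e⟩⟩
  have hsub : Set.range q ⊆ realZeros f := by rintro _ ⟨s, rfl⟩; exact hf s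
  apply Set.Subset.antisymm
  · exact (isPreconnected_range hq).subset_connectedComponentIn ⟨0, rfl⟩ hsub
  · have hclosed : IsClosed (Set.range q) := by
      have : CompactSpace (Set.range q) := e.symm.compactSpace
      exact (isCompact_iff_compactSpace.2 this).isClosed
    set U := interior {z | planeEval f z = 0 → z ∈ Set.range q}
    have hU : ∀ x ∈ Set.range q, x ∈ U := by
      rintro _ ⟨s, rfl⟩
      exact mem_interior_iff_mem_nhds.2 (hiso s)
    intro x hx
    by_contra hxq
    have hS := connectedComponentIn_subset (realZeros f) (q 0)
    obtain ⟨y, hy, hyU, hyq⟩ := isPreconnected_connectedComponentIn (x := q 0) U (Set.range q)ᶜ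
      isOpen_interior hclosed.isOpen_compl
      (fun y _ => (em (y ∈ Set.range q)).imp (hU y) id)
      ⟨q 0, mem_connectedComponentIn (hf 0), hU _ ⟨0, rfl⟩⟩ ⟨x, hx, hxq⟩
    exact hyq (interior_subset hyU (hS hy))

/-! ### The two sides of the boundary -/

/-- Coordinates near a boundary point: the signed distance `h` to `γ` and the foot point `S`. -/
theorem exists_local_coordinates {γ : ℝ → ℂ} (hγ : ContDiff ℝ ∞ γ) (hu : ∀ s, ‖deriv γ s‖ = 1)
    (s₀ : ℝ) : ∃ (h S : ℂ → ℝ) (h' : ℂ →L[ℝ] ℝ), HasStrictFDerivAt h h' (γ s₀) ∧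
      (∀ v, h' v = inner ℝ (normal γ s₀) v) ∧
      (∀ᶠ x in 𝓝 (γ s₀), x = parallelCurve γ (h x) (S x)) ∧ ∀ᶠ s in 𝓝 s₀, h (γ s) = 0 := by
  have hT := hasStrictFDerivAt_tube_equiv hγ hu (s₀, 0) (by simp)
  have h0 : ∀ s, tube γ (s, 0) = γ s := fun s => by simp [tube, parallelCurve]
  have hinv := hT.to_localInverse
  have hr := hT.eventually_right_inverse
  have hl := hT.eventually_left_inverse
  set e := hT.localInverse with he
  rw [h0] at hinv hr
  refine ⟨fun x => (e x).2, fun x => (e x).1, _,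
    (ContinuousLinearMap.snd ℝ ℝ ℝ).hasStrictFDerivAt.comp (γ s₀) hinv, ?_, ?_, ?_⟩
  · intro v
    have h1 : (1 - (0 : ℝ) * curvature γ s₀ : ℝ) = 1 := by ring
    have h2 := sq_add_sq_deriv hu s₀
    simp only [ContinuousLinearMap.comp_apply, ContinuousLinearMap.coe_snd']
    change ((((1 - (0 : ℝ) * curvature γ s₀ : ℝ) : ℂ) * deriv γ s₀).re * (normal γ s₀).im -
      (((1 - (0 : ℝ) * curvature γ s₀ : ℝ) : ℂ) * deriv γ s₀).im * (normal γ s₀).re)⁻¹ *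
      ((((1 - (0 : ℝ) * curvature γ s₀ : ℝ) : ℂ) * deriv γ s₀).re * v.im -
      (((1 - (0 : ℝ) * curvature γ s₀ : ℝ) : ℂ) * deriv γ s₀).im * v.re) = _
    rw [tube_frame_det hu, h1, Complex.inner]
    simp [normal]
    ring
  · filter_upwards [hr] with x hx using hx.symm
  · have hc : Tendsto (fun s : ℝ => (s, (0 : ℝ))) (𝓝 s₀) (𝓝 (s₀, 0)) :=
      (by fun_prop : Continuous fun s : ℝ => (s, (0 : ℝ))).tendsto s₀
    filter_upwards [hc.eventually hl] with s hs
    rw [h0] at hs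
    rw [hs]

theorem deriv_periodic {γ : ℝ → ℂ} {L : ℝ} (h : Function.Periodic γ L) :
    Function.Periodic (deriv γ) L := by
  intro s
  rw [← deriv_comp_add_const, show (fun x => γ (x + L)) = γ from funext h]

theorem parallelCurve_periodic {γ : ℝ → ℂ} {L : ℝ} (h : Function.Periodic γ L) (t : ℝ) :
    Function.Periodic (parallelCurve γ t) L := by
  intro s
  simp [parallelCurve, normal, h s, deriv_periodic h s]

theorem exists_mem_Ico_parallelCurve_eq {γ : ℝ → ℂ} {L : ℝ} (hL : 0 < L)
    (h : Function.Periodic γ L) (s : ℝ) :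
    ∃ s₁ ∈ Set.Ico 0 L, ∀ t, parallelCurve γ t s = parallelCurve γ t s₁ := by
  refine ⟨toIcoMod hL 0 s, by simpa using toIcoMod_mem_Ico hL 0 s, fun t => ?_⟩
  have := (parallelCurve_periodic h t).sub_zsmul_eq (n := toIcoDiv hL 0 s) (x := s)
  rw [← this]
  rfl

/-- Points with normal coordinates of different heights are distinct. -/
theorem height_eq_of_parallelCurve_eq {γ : ℝ → ℂ} {L ρ : ℝ} (hL : 0 < L)
    (hper : Function.Periodic γ L) (hρ : IsTubular γ L ρ) {s s' t t' : ℝ}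
    (ht : t ∈ Set.Ioo (-ρ) ρ) (ht' : t' ∈ Set.Ioo (-ρ) ρ)
    (h : parallelCurve γ t s = parallelCurve γ t' s') : t = t' := by
  obtain ⟨s₁, hs₁, h1⟩ := exists_mem_Ico_parallelCurve_eq hL hper s
  obtain ⟨s₂, hs₂, h2⟩ := exists_mem_Ico_parallelCurve_eq hL hper s'
  have h3 : (s₁, t) = (s₂, t') := hρ.1 ⟨hs₁, ht⟩ ⟨hs₂, ht'⟩ (by simpa [← h1, ← h2] using h)
  exact congrArg Prod.snd h3

theorem parallelCurve_zero (γ : ℝ → ℂ) : parallelCurve γ 0 = γ := by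
  ext s; simp [parallelCurve]

theorem isPreconnected_tube_image {γ : ℝ → ℂ} (hγ : ContDiff ℝ ∞ γ) (a b : ℝ) :
    IsPreconnected (tube γ '' (Set.univ ×ˢ Set.Ioo a b)) :=
  (isPreconnected_univ.prod isPreconnected_Ioo).image _ (contDiff_tube hγ).continuous.continuousOn

/-- Each side of the boundary within the tubular neighbourhood is connected and disjoint from the
boundary, so it lies in `Ω` as soon as it meets `Ω`. -/
theorem tube_image_subset {Ω : Set ℂ} {γ : ℝ → ℂ} {L ρ : ℝ} (hΩ : IsTable Ω γ L)
    (hρ : IsTubular γ L ρ) {a b : ℝ} (ha : -ρ ≤ a) (hb : b ≤ ρ) (h0 : (0 : ℝ) ∉ Set.Ioo a b)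
    (hne : (tube γ '' (Set.univ ×ˢ Set.Ioo a b) ∩ Ω).Nonempty) :
    tube γ '' (Set.univ ×ˢ Set.Ioo a b) ⊆ Ω := by
  have hfr : ∀ y ∈ tube γ '' (Set.univ ×ˢ Set.Ioo a b), y ∉ frontier Ω := by
    rintro _ ⟨⟨s, t⟩, ⟨_, ht⟩, rfl⟩ hy
    rw [hΩ.frontier_eq] at hy
    obtain ⟨s', hs'⟩ := hy
    dsimp only at ht
    have hρ0 : 0 < ρ := by
      by_contra hneg
      linarith [ht.1, ht.2]
    have := height_eq_of_parallelCurve_eq hΩ.length_pos hΩ.periodic hρ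
      (t := t) (t' := 0) (s := s) (s' := s') ⟨by linarith [ht.1], by linarith [ht.2]⟩
      ⟨by linarith, hρ0⟩ (by rw [parallelCurve_zero, hs']; rfl)
    exact h0 (this ▸ ht)
  have hcl : ∀ y ∈ tube γ '' (Set.univ ×ˢ Set.Ioo a b), y ∉ Ω → y ∈ (closure Ω)ᶜ := by
    intro y hy hyΩ hycl
    exact hfr y hy (by rw [hΩ.isOpen.frontier_eq]; exact ⟨hycl, hyΩ⟩)
  intro x hx
  by_contra hxΩ
  obtain ⟨y, hy, hy1, hy2⟩ := isPreconnected_tube_image hΩ.smooth a b Ω (closure Ω)ᶜ hΩ.isOpen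
    isClosed_closure.isOpen_compl (fun y hy => (em (y ∈ Ω)).imp id (hcl y hy)) hne
    ⟨x, hx, hcl x hx hxΩ⟩
  exact hy2 (subset_closure hy1)

theorem parallelCurve_mem {Ω : Set ℂ} {γ : ℝ → ℂ} {L ρ : ℝ} (hΩ : IsTable Ω γ L)
    (hρ : IsTubular γ L ρ) {t : ℝ} (ht : 0 < t) (htρ : t < ρ) (s : ℝ) :
    parallelCurve γ t s ∈ Ω := by
  refine tube_image_subset hΩ hρ (a := 0) (b := ρ) (by linarith) le_rfl (by simp) ?_
    ⟨(s, t), ⟨trivial, ht, htρ⟩, rfl⟩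
  have h1 := hΩ.inward 0
  have h2 : ∀ᶠ u : ℝ in 𝓝[>] 0, u ∈ Set.Ioo 0 ρ := Ioo_mem_nhdsGT (ht.trans htρ)
  obtain ⟨u, hu1, hu2⟩ := (h1.and h2).exists
  exact ⟨_, ⟨(0, u), ⟨trivial, hu2⟩, rfl⟩, hu1⟩

/-- Were the outer side of the boundary in `Ω`, then `Ω` would be dense in the plane, although it is
bounded. -/
theorem parallelCurve_notMem {Ω : Set ℂ} {γ : ℝ → ℂ} {L ρ : ℝ} (hΩ : IsTable Ω γ L)
    (hρ : IsTubular γ L ρ) {t : ℝ} (ht : t < 0) (htρ : -ρ < t) (s : ℝ) :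
    parallelCurve γ t s ∉ Ω := by
  intro hmem
  have hρ0 : 0 < ρ := by linarith
  have hneg : ∀ u : ℝ, u < 0 → -ρ < u → ∀ s', parallelCurve γ u s' ∈ Ω := by
    intro u hu0 huρ s'
    exact tube_image_subset hΩ hρ (a := -ρ) (b := 0) le_rfl hρ0.le (by simp)
      ⟨_, ⟨(s, t), ⟨trivial, htρ, ht⟩, rfl⟩, hmem⟩ ⟨(s', u), ⟨trivial, huρ, hu0⟩, rfl⟩
  -- if both sides of the boundary belonged to `Ω`, its closure would be open and closed
  have hopen : IsOpen (closure Ω) := by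
    rw [isOpen_iff_mem_nhds]
    intro x hx
    by_cases hxΩ : x ∈ Ω
    · exact mem_of_superset (hΩ.isOpen.mem_nhds hxΩ) subset_closure
    have hxf : x ∈ frontier Ω := by rw [hΩ.isOpen.frontier_eq]; exact ⟨hx, hxΩ⟩
    rw [hΩ.frontier_eq] at hxf
    obtain ⟨s₀, rfl⟩ := hxf
    obtain ⟨h, S, h', hh, _, hS, h0⟩ := exists_local_coordinates hΩ.smooth hΩ.unit_speed s₀
    have hcont : ∀ᶠ x in 𝓝 (γ s₀), h x ∈ Set.Ioo (-ρ) ρ := by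
      refine hh.hasFDerivAt.continuousAt.eventually_mem (Ioo_mem_nhds ?_ ?_)
      · rw [h0.self_of_nhds]; linarith
      · rw [h0.self_of_nhds]; exact hρ0
    filter_upwards [hS, hcont] with y hy hyρ
    rw [hy]
    rcases lt_trichotomy (h y) 0 with hlt | heq | hgt
    · exact subset_closure (hneg _ hlt hyρ.1 _)
    · rw [heq, parallelCurve_zero]
      exact frontier_subset_closure (hΩ.frontier_eq ▸ ⟨S y, rfl⟩)
    · exact subset_closure (parallelCurve_mem hΩ hρ hgt hyρ.2 _)
  have huniv : closure Ω = Set.univ :=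
    IsClopen.eq_univ ⟨isClosed_closure, hopen⟩ hΩ.isConnected.nonempty.closure
  have hcomp : IsCompact (closure Ω) := hΩ.isBounded.isCompact_closure
  rw [huniv] at hcomp
  exact noncompact_univ ℂ hcomp

end

/-! ### First order operators with constant coefficients -/

/-- The operator `a ∂/∂x + b ∂/∂y` on complex valued functions in the plane. -/
noncomputable def diffOp (a b : ℂ) (G : ℂ → ℂ) (c : ℂ) : ℂ :=
  a * fderiv ℝ G c 1 + b * fderiv ℝ G c Complex.I

section

variable {U : Set ℂ} {F G : ℂ → ℂ} {a b a' b' : ℂ}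

theorem contDiffOn_fderiv_apply (hU : IsOpen U) (hG : ContDiffOn ℝ ∞ G U) (v : ℂ) :
    ContDiffOn ℝ ∞ (fun c => fderiv ℝ G c v) U :=
  (hG.fderiv_of_isOpen hU (m := ∞) (by simp)).clm_apply contDiffOn_const

theorem contDiffOn_diffOp (hU : IsOpen U) (hG : ContDiffOn ℝ ∞ G U) :
    ContDiffOn ℝ ∞ (diffOp a b G) U :=
  (contDiffOn_const.mul (contDiffOn_fderiv_apply hU hG 1)).add
    (contDiffOn_const.mul (contDiffOn_fderiv_apply hU hG Complex.I))

theorem diffOp_congr (hU : IsOpen U) (h : Set.EqOn F G U) :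
    Set.EqOn (diffOp a b F) (diffOp a b G) U := by
  intro c hc
  have : fderiv ℝ F c = fderiv ℝ G c :=
    (h.eventuallyEq_of_mem (hU.mem_nhds hc)).fderiv_eq
  simp [diffOp, this]

theorem diffOp_iterate_congr (hU : IsOpen U) (h : Set.EqOn F G U) (n : ℕ) :
    Set.EqOn ((diffOp a b)^[n] F) ((diffOp a b)^[n] G) U := by
  induction n generalizing F G with
  | zero => exact h
  | succ n ih => exact ih (diffOp_congr hU h)

theorem differentiableAt_of_contDiffOn (hU : IsOpen U) (hG : ContDiffOn ℝ ∞ G U) {c : ℂ}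
    (hc : c ∈ U) : DifferentiableAt ℝ G c :=
  (hG.contDiffAt (hU.mem_nhds hc)).differentiableAt (by simp)

theorem diffOp_add_smul (hU : IsOpen U) (hF : ContDiffOn ℝ ∞ F U) (hG : ContDiffOn ℝ ∞ G U)
    (α β : ℂ) : Set.EqOn (diffOp a b (fun c => α * F c + β * G c))
      (fun c => α * diffOp a b F c + β * diffOp a b G c) U := by
  intro c hc
  have hF' := differentiableAt_of_contDiffOn hU hF hc
  have hG' := differentiableAt_of_contDiffOn hU hG hc
  have : fderiv ℝ (fun c => α * F c + β * G c) c = α • fderiv ℝ F c + β • fderiv ℝ G c :=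
    ((hF'.hasFDerivAt.const_mul α).add (hG'.hasFDerivAt.const_mul β)).fderiv
  simp only [diffOp, this]
  simp
  ring

theorem diffOp_iterate_add_smul (hU : IsOpen U) (hF : ContDiffOn ℝ ∞ F U)
    (hG : ContDiffOn ℝ ∞ G U) (α β : ℂ) (n : ℕ) :
    Set.EqOn ((diffOp a b)^[n] (fun c => α * F c + β * G c))
      (fun c => α * (diffOp a b)^[n] F c + β * (diffOp a b)^[n] G c) U := by
  induction n generalizing F G with
  | zero => exact fun c _ => rfl
  | succ n ih =>
    exact (diffOp_iterate_congr hU (diffOp_add_smul hU hF hG α β) n).trans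
      (ih (contDiffOn_diffOp hU hF) (contDiffOn_diffOp hU hG))

theorem diffOp_iterate_zero (hU : IsOpen U) (h : Set.EqOn G 0 U) (n : ℕ) :
    Set.EqOn ((diffOp a b)^[n] G) 0 U := by
  have h0 : diffOp a b 0 = 0 := by ext c; simp [diffOp]
  have : (diffOp a b)^[n] 0 = 0 := Function.iterate_fixed h0 n
  exact (diffOp_iterate_congr hU h n).trans (fun c _ => by rw [this])

theorem diffOp_comm (hU : IsOpen U) (hG : ContDiffOn ℝ ∞ G U) :
    Set.EqOn (diffOp a b (diffOp a' b' G)) (diffOp a' b' (diffOp a b G)) U := by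
  intro c hc
  have hd : DifferentiableAt ℝ (fderiv ℝ G) c :=
    ((hG.fderiv_of_isOpen hU (m := ∞) (by simp)).contDiffAt (hU.mem_nhds hc)).differentiableAt
      (by simp)
  have key : ∀ p q : ℂ, fderiv ℝ (diffOp p q G) c =
      p • (ContinuousLinearMap.apply ℝ ℂ (1 : ℂ)).comp (fderiv ℝ (fderiv ℝ G) c) +
        q • (ContinuousLinearMap.apply ℝ ℂ Complex.I).comp (fderiv ℝ (fderiv ℝ G) c) := by
    intro p q
    have h1 := (ContinuousLinearMap.apply ℝ ℂ (1 : ℂ)).hasFDerivAt.comp c hd.hasFDerivAt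
    have h2 := (ContinuousLinearMap.apply ℝ ℂ Complex.I).hasFDerivAt.comp c hd.hasFDerivAt
    exact ((h1.const_mul p).add (h2.const_mul q)).fderiv
  have hsymm : IsSymmSndFDerivAt ℝ G c :=
    (hG.contDiffAt (hU.mem_nhds hc)).isSymmSndFDerivAt (by
      simp only [minSmoothness_of_isRCLikeNormedField]
      change ((2 : ℕ∞) : WithTop ℕ∞) ≤ _
      exact_mod_cast le_top)
  have h1I := hsymm.eq 1 Complex.I
  rw [diffOp, diffOp, key, key]
  simp [h1I]
  ring

theorem diffOp_iterate_comm (hU : IsOpen U) (hG : ContDiffOn ℝ ∞ G U) (n : ℕ) :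
    Set.EqOn ((diffOp a b)^[n] (diffOp a' b' G)) (diffOp a' b' ((diffOp a b)^[n] G)) U := by
  induction n generalizing G with
  | zero => exact fun c _ => rfl
  | succ n ih =>
    exact (diffOp_iterate_congr hU (diffOp_comm hU hG) n).trans (ih (contDiffOn_diffOp hU hG))

/-- If `G` is annihilated by powers of two operators, it is annihilated by a power of every linear
combination of them. -/
theorem diffOp_iterate_combination (hU : IsOpen U) (hG : ContDiffOn ℝ ∞ G U) (α β : ℂ) {m n : ℕ}
    (hm : Set.EqOn ((diffOp a b)^[m] G) 0 U) (hn : Set.EqOn ((diffOp a' b')^[n] G) 0 U) :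
    Set.EqOn ((diffOp (α * a + β * a') (α * b + β * b'))^[m + n] G) 0 U := by
  induction hk : m + n generalizing m n G with
  | zero =>
    obtain rfl : m = 0 := by omega
    exact hm
  | succ k ih =>
    rcases m with _ | m
    · exact diffOp_iterate_zero hU hm _
    rcases n with _ | n
    · exact diffOp_iterate_zero hU hn _
    have e : diffOp (α * a + β * a') (α * b + β * b') G =
        fun c => α * diffOp a b G c + β * diffOp a' b' G c := by
      ext c; simp only [diffOp]; ring
    rw [Function.iterate_succ_apply, e]
    have h1 := contDiffOn_diffOp (a := a) (b := b) hU hG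
    have h2 := contDiffOn_diffOp (a := a') (b := b') hU hG
    refine (diffOp_iterate_add_smul hU h1 h2 α β k).trans ?_
    have h3 := ih (m := m) (n := n + 1) h1 hm ((diffOp_iterate_comm hU hG (n + 1)).trans
      (diffOp_iterate_zero hU hn 1)) (by omega)
    have h4 := ih (m := m + 1) (n := n) h2 ((diffOp_iterate_comm hU hG (m + 1)).trans
      (diffOp_iterate_zero hU hm 1)) hn (by omega)
    intro c hc
    simp [h3 hc, h4 hc]

end

/-! ### Functions annihilated by powers of both partial derivatives -/

theorem exists_polynomial_derivative_eq (p : Polynomial ℂ) {n : ℕ} (hp : p.degree < n) :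
    ∃ P : Polynomial ℂ, P.derivative = p ∧ P.degree < (n + 1 : ℕ) := by
  refine ⟨∑ i ∈ Finset.range n, Polynomial.C (p.coeff i / (i + 1)) * Polynomial.X ^ (i + 1),
    ?_, ?_⟩
  · ext j
    rw [Polynomial.derivative_sum, Polynomial.finsetSum_coeff]
    simp only [Polynomial.derivative_C_mul_X_pow, Polynomial.coeff_C_mul_X_pow,
      Nat.add_sub_cancel]
    rw [Finset.sum_ite_eq]
    split_ifs with hj
    · push_cast
      have : (j : ℂ) + 1 ≠ 0 := by exact_mod_cast Nat.succ_ne_zero j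
      field_simp
    · rw [Finset.mem_range, not_lt] at hj
      exact (Polynomial.coeff_eq_zero_of_degree_lt (hp.trans_le (by exact_mod_cast hj))).symm
  · refine (Polynomial.degree_sum_le _ _).trans_lt ?_
    rw [Finset.sup_lt_iff (by exact WithBot.bot_lt_coe _)]
    intro i hi
    refine (Polynomial.degree_C_mul_X_pow_le _ _).trans_lt ?_
    have := Finset.mem_range.1 hi
    exact_mod_cast (by omega : i + 1 < n + 1)

/-- A function annihilated by the `n`-th power of the derivative in the direction `e` is a
polynomial of degree less than `n` on segments in this direction. -/
theorem eq_polynomial_on_segment {U : Set ℂ} (hU : IsOpen U) {e z : ℂ} {a b : ℝ}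
    {A B : ℂ}
    (hD : ∀ (G : ℂ → ℂ) (c : ℂ), fderiv ℝ G c e = diffOp A B G c)
    (hseg : ∀ x ∈ Set.Ioo a b, z + (x : ℝ) * e ∈ U) (n : ℕ) {G : ℂ → ℂ}
    (hG : ContDiffOn ℝ ∞ G U) (hn : Set.EqOn ((diffOp A B)^[n] G) 0 U) :
    ∃ p : Polynomial ℂ, p.degree < n ∧ ∀ x ∈ Set.Ioo a b, G (z + (x : ℝ) * e) = p.eval (x : ℂ) := by
  induction n generalizing G with
  | zero =>
    refine ⟨0, by simp, fun x hx => ?_⟩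
    simpa using hn (hseg x hx)
  | succ n ih =>
    obtain ⟨p, hp, hpG⟩ := ih (contDiffOn_diffOp hU hG) hn
    obtain ⟨P, hP, hPd⟩ := exists_polynomial_derivative_eq p hp
    have hder : ∀ x ∈ Set.Ioo a b,
        HasDerivAt (fun x : ℝ => G (z + (x : ℝ) * e) - P.eval (x : ℂ)) 0 x := by
      intro x hx
      have h1 : HasDerivAt (fun x : ℝ => z + (x : ℂ) * e) e x := by
        simpa using ((Complex.ofRealCLM.hasDerivAt (x := x)).mul_const e).const_add z
      have h2 := (differentiableAt_of_contDiffOn hU hG (hseg x hx)).hasFDerivAt.comp_hasDerivAt x h1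
      have h3 := (P.hasDerivAt (x : ℂ)).comp_ofReal
      refine (h2.sub h3).congr_deriv ?_
      rw [hD, hpG x hx, hP, sub_self]
    rcases Set.eq_empty_or_nonempty (Set.Ioo a b) with hempty | ⟨x₀, hx₀⟩
    · exact ⟨0, by rw [Polynomial.degree_zero]; exact WithBot.bot_lt_coe _, by simp [hempty]⟩
    refine ⟨P + Polynomial.C (G (z + (x₀ : ℝ) * e) - P.eval (x₀ : ℂ)), ?_, fun x hx => ?_⟩
    · refine (Polynomial.degree_add_le _ _).trans_lt (max_lt hPd ?_)
      exact Polynomial.degree_C_le.trans_lt (by exact_mod_cast Nat.succ_pos n)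
    · have := isOpen_Ioo.is_const_of_deriv_eq_zero isPreconnected_Ioo
        (fun x hx => (hder x hx).differentiableAt.differentiableWithinAt)
        (fun x hx => (hder x hx).deriv) hx hx₀
      rw [Polynomial.eval_add, Polynomial.eval_C, ← this]
      ring

/-- A function that is a polynomial in each variable separately, of bounded degree, is a polynomial:
Lagrange interpolation in the first variable expresses it through its values on finitely many lines
on which it is a polynomial in the second. -/
theorem eventually_eq_mvPolynomial {U : Set ℂ} (hU : IsOpen U) {c₀ : ℂ} (hc₀ : c₀ ∈ U) {M : ℕ}
    {G : ℂ → ℂ} (hG : ContDiffOn ℝ ∞ G U) (hx : Set.EqOn ((diffOp 1 0)^[M] G) 0 U)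
    (hy : Set.EqOn ((diffOp 0 1)^[M] G) 0 U) :
    ∃ P : MvPolynomial (Fin 2) ℂ, ∀ᶠ c in 𝓝 c₀, G c = MvPolynomial.eval (toPair c) P := by
  obtain ⟨ε, hε, hball⟩ := Metric.isOpen_iff.1 hU c₀ hc₀
  set δ := ε / 2
  have hδ : 0 < δ := half_pos hε
  have hrect : ∀ x ∈ Set.Ioo (c₀.re - δ) (c₀.re + δ), ∀ y ∈ Set.Ioo (c₀.im - δ) (c₀.im + δ),
      (x : ℂ) + y * Complex.I ∈ U := by
    intro x hx y hy
    apply hball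
    rw [Metric.mem_ball, Complex.dist_eq]
    refine (Complex.norm_le_abs_re_add_abs_im _).trans_lt ?_
    simp only [Complex.sub_re, Complex.add_re, Complex.ofReal_re, Complex.re_ofReal_mul,
      Complex.I_re, mul_zero, add_zero, Complex.sub_im, Complex.add_im, Complex.ofReal_im,
      Complex.im_ofReal_mul, Complex.I_im, mul_one, zero_add]
    have h1 : |x - c₀.re| < δ := abs_lt.2 ⟨by linarith [hx.1], by linarith [hx.2]⟩
    have h2 : |y - c₀.im| < δ := abs_lt.2 ⟨by linarith [hy.1], by linarith [hy.2]⟩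
    have h3 : δ + δ = ε := add_halves ε
    linarith
  -- interpolation nodes for the variable `x`
  set ν : ℕ → ℝ := fun i => c₀.re + δ * i / (M + 1) with hν
  have hνmem : ∀ i ∈ Finset.range M, ν i ∈ Set.Ioo (c₀.re - δ) (c₀.re + δ) := by
    intro i hi
    have hiM : (i : ℝ) < M := by exact_mod_cast Finset.mem_range.1 hi
    have h1 : 0 ≤ δ * i / (M + 1) := by positivity
    have h2 : δ * i / (M + 1) < δ := by
      rw [div_lt_iff₀ (by positivity)]
      nlinarith
    exact ⟨by simp only [hν]; linarith, by simp only [hν]; linarith⟩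
  have hνinj : Set.InjOn (fun i => (ν i : ℂ)) (Finset.range M : Finset ℕ) := by
    intro i _ j _ hij
    have h1 : ν i = ν j := Complex.ofReal_injective hij
    simp only [hν] at h1
    have h2 : (M : ℝ) + 1 ≠ 0 := by positivity
    field_simp at h1
    have h3 := mul_left_cancel₀ hδ.ne' (by linarith : δ * (i : ℝ) = δ * j)
    exact_mod_cast h3
  have hcol : ∀ i, ∃ q : Polynomial ℂ, i ∈ Finset.range M →
      ∀ y ∈ Set.Ioo (c₀.im - δ) (c₀.im + δ), G (ν i + y * Complex.I) = q.eval (y : ℂ) := by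
    intro i
    by_cases hi : i ∈ Finset.range M
    · obtain ⟨q, -, hq⟩ := eq_polynomial_on_segment hU (e := Complex.I) (A := 0) (B := 1)
        (by intro G c; simp [diffOp]) (fun y hy => hrect _ (hνmem i hi) y hy) M hG hy
      exact ⟨q, fun _ => hq⟩
    · exact ⟨0, fun h => absurd h hi⟩
  choose q hq using hcol
  refine ⟨∑ i ∈ Finset.range M, Polynomial.aeval (MvPolynomial.X 1) (q i) *
    Polynomial.aeval (MvPolynomial.X 0)
      (Lagrange.basis (Finset.range M) (fun i => (ν i : ℂ)) i), ?_⟩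
  have hre : ∀ᶠ c in 𝓝 c₀, c.re ∈ Set.Ioo (c₀.re - δ) (c₀.re + δ) :=
    Complex.continuous_re.continuousAt.eventually_mem (Ioo_mem_nhds (by linarith) (by linarith))
  have him : ∀ᶠ c in 𝓝 c₀, c.im ∈ Set.Ioo (c₀.im - δ) (c₀.im + δ) :=
    Complex.continuous_im.continuousAt.eventually_mem (Ioo_mem_nhds (by linarith) (by linarith))
  filter_upwards [hre, him] with c hcre hcim
  obtain ⟨p, hpdeg, hp⟩ := eq_polynomial_on_segment hU (e := 1) (z := c.im * Complex.I) (A := 1)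
    (B := 0) (a := c₀.re - δ) (b := c₀.re + δ) (by intro G c; simp [diffOp])
    (fun x hx => by simpa [add_comm] using hrect x hx _ hcim) M hG hx
  have hinterp := Lagrange.eq_interpolate (s := Finset.range M) hνinj
    (f := p) (by simpa using hpdeg)
  have hGc : G c = p.eval (c.re : ℂ) := by
    rw [← hp _ hcre]
    congr 1
    rw [mul_one, add_comm, Complex.re_add_im]
  rw [hGc, hinterp, Lagrange.interpolate_apply, Polynomial.eval_finsetSum, map_sum]
  refine Finset.sum_congr rfl fun i hi => ?_
  rw [map_mul, Polynomial.eval_mul, Polynomial.eval_C, ← hp _ (hνmem i hi)]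
  have h1 : G (c.im * Complex.I + (ν i : ℂ) * 1) = (q i).eval (c.im : ℂ) := by
    rw [← hq i hi _ hcim, mul_one, add_comm]
  rw [h1]
  have hev : ∀ (j : Fin 2) (R : Polynomial ℂ), MvPolynomial.eval (toPair c)
      (Polynomial.aeval (MvPolynomial.X j) R) = R.eval (toPair c j) := by
    intro j R
    rw [← MvPolynomial.coe_aeval_eq_eval, RingHom.coe_coe, ← Polynomial.aeval_algHom_apply]
    simp [Polynomial.aeval_def, Polynomial.eval₂_eq_eval_map]
  rw [hev, hev]
  rfl

/-! ### Polynomials in the velocity and the top Wirtinger derivative -/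

theorem hasDerivAt_exp_I (θ : ℝ) :
    HasDerivAt (fun θ : ℝ => Complex.exp (θ * Complex.I))
      (Complex.I * Complex.exp (θ * Complex.I)) θ := by
  simpa using hasDerivAt_exp_mul 1 θ

theorem conj_exp_I (θ : ℝ) :
    (starRingEnd ℂ) (Complex.exp (θ * Complex.I)) = Complex.exp (-(θ * Complex.I)) := by
  rw [← Complex.exp_conj]; simp

theorem infinite_conj_exp {V : Set ℝ} (hV : IsOpen V) (hne : V.Nonempty) :
    ((fun θ : ℝ => Complex.exp (-(θ * Complex.I))) '' V).Infinite := by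
  obtain ⟨θ₀, hθ₀⟩ := hne
  obtain ⟨ε, hε, hball⟩ := Metric.isOpen_iff.1 hV θ₀ hθ₀
  set δ := min ε 1
  have hδ : 0 < δ := lt_min hε one_pos
  have hsub : Set.Icc θ₀ (θ₀ + δ / 2) ⊆ V := by
    intro θ hθ
    apply hball
    rw [Metric.mem_ball, Real.dist_eq, abs_lt]
    have := min_le_left ε 1
    constructor <;> linarith [hθ.1, hθ.2]
  refine Set.Infinite.mono (Set.image_mono hsub) ?_
  refine Set.Infinite.image ?_ (Set.Icc_infinite (by linarith))
  intro x hx y hy hxy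
  have h1 : Circle.exp x = Circle.exp y := by
    apply Subtype.ext
    have := congrArg (starRingEnd ℂ) hxy
    simp only [← conj_exp_I, Complex.conj_conj] at this
    simpa using this
  refine Circle.exp_injOn_Icc (a := θ₀) (b := θ₀ + δ / 2) ?_ hx hy h1
  have := min_le_right ε 1
  linarith [Real.pi_gt_three]

/-- The real differential is `v ∂G + v̄ ∂̄G`. -/
theorem fderiv_eq_wirtinger (G : ℂ → ℂ) (c v : ℂ) : fderiv ℝ G c v =
    v * diffOp (1 / 2) (-Complex.I / 2) G c +
      (starRingEnd ℂ) v * diffOp (1 / 2) (Complex.I / 2) G c := by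
  have h0 : fderiv ℝ G c v = v.re * fderiv ℝ G c 1 + v.im * fderiv ℝ G c Complex.I := by
    have h : v = v.re • (1 : ℂ) + v.im • Complex.I := by simp
    conv_lhs => rw [h]
    rw [map_add, map_smul, map_smul, Complex.real_smul, Complex.real_smul]
  have h1 : (starRingEnd ℂ) v = v.re - v.im * Complex.I := by
    apply Complex.ext <;> simp
  have h2 : v = v.re + v.im * Complex.I := (Complex.re_add_im v).symm
  rw [h0, h1]
  conv_rhs => enter [1, 1]; rw [h2]
  simp only [diffOp]
  linear_combination ((v.im : ℂ) * fderiv ℝ G c Complex.I) * Complex.I_mul_I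

/-- Suppose that a function on the centres `c` and the directions `w` which is a polynomial in `w̄`
(up to the factor `wᴺ`) becomes a polynomial of degree less than `n` in `w` when the point
`x = c - i r w` of the Larmor circle is held fixed. Then its constant coefficient in `w̄` is
annihilated by the `n`-th power of `∂`. The induction step differentiates along the motion of `w`
with `x` fixed: this lowers the degree in `w` and applies `i r ∂` to the constant coefficient. -/
theorem wirtinger_iterate_eq_zero {U : Set ℂ} (hU : IsOpen U) {V : Set ℝ} (hV : IsOpen V)
    (hVne : V.Nonempty) {r : ℝ} (hr : r ≠ 0) (N n : ℕ) {ι : Type} [Fintype ι] (e : ι → ℕ)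
    {G : ℂ → ℂ} {H : ι → ℂ → ℂ} (hG : ContDiffOn ℝ ∞ G U) (hH : ∀ i, ContDiffOn ℝ ∞ (H i) U)
    (p : ℂ → Polynomial ℂ) (hp : ∀ x, Polynomial.derivative^[n] (p x) = 0)
    (heq : ∀ c ∈ U, ∀ θ ∈ V, Complex.exp (θ * Complex.I) ^ N * (G c +
      ∑ i, Complex.exp (-(θ * Complex.I)) ^ (e i + 1) * H i c) =
      (p (c - Complex.I * r * Complex.exp (θ * Complex.I))).eval (Complex.exp (θ * Complex.I))) :
    Set.EqOn ((diffOp (1 / 2) (-Complex.I / 2))^[n] G) 0 U := by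
  induction n generalizing ι G p with
  | zero =>
    intro c hc
    set R : Polynomial ℂ := Polynomial.C (G c) +
      ∑ i, Polynomial.C (H i c) * Polynomial.X ^ (e i + 1) with hR
    have hR0 : R = 0 := by
      refine Polynomial.eq_zero_of_infinite_isRoot _ ((infinite_conj_exp hV hVne).mono ?_)
      rintro _ ⟨θ, hθ, rfl⟩
      have h1 := heq c hc θ hθ
      have hp0 : ∀ x, p x = 0 := hp
      rw [hp0, Polynomial.eval_zero] at h1
      have h2 := (mul_eq_zero.1 h1).resolve_left (pow_ne_zero _ (Complex.exp_ne_zero _))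
      simpa [hR, Polynomial.IsRoot, Polynomial.eval_finsetSum, mul_comm (H _ c)] using h2
    have := congrArg (Polynomial.eval 0) hR0
    simpa [hR, Polynomial.eval_finsetSum] using this
  | succ n ih =>
    set D := diffOp (1 / 2) (-Complex.I / 2)
    set D' := diffOp (1 / 2) (Complex.I / 2)
    set κ : ℂ := -Complex.I / r
    let e' : Fin 2 ⊕ ι × Fin 3 → ℕ :=
      Sum.elim ![0, 1] fun i => ![e i.1 + 1, e i.1, e i.1 + 2] i.2
    let H' : Fin 2 ⊕ ι × Fin 3 → ℂ → ℂ := Sum.elim ![fun c => κ * N * G c, D' G]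
      fun i => ![fun c => κ * (N - (e i.1 + 1)) * H i.1 c, D (H i.1), D' (H i.1)] i.2
    refine ih (ι := Fin 2 ⊕ ι × Fin 3) e' (G := D G) (H := H') (contDiffOn_diffOp hU hG) ?_
      (fun x => Polynomial.C κ * Polynomial.derivative (p x)) ?_ ?_
    · rintro (i | ⟨i, j⟩)
      · fin_cases i
        · exact contDiffOn_const.mul hG
        · exact contDiffOn_diffOp hU hG
      · fin_cases j
        · exact contDiffOn_const.mul (hH i)
        · exact contDiffOn_diffOp hU (hH i)
        · exact contDiffOn_diffOp hU (hH i)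
    · intro x
      rw [Polynomial.iterate_derivative_C_mul]
      have := hp x
      rw [Function.iterate_succ_apply] at this
      rw [this, mul_zero]
    intro c hc θ hθ
    set x := c - Complex.I * r * Complex.exp (θ * Complex.I) with hx
    set W : ℝ → ℂ := fun θ => Complex.exp (θ * Complex.I) with hW
    set B : ℝ → ℂ := fun θ => Complex.exp (-(θ * Complex.I)) with hB
    have hWB : W θ * B θ = 1 := by simp [hW, hB, ← Complex.exp_add]
    have hW' : HasDerivAt W (Complex.I * W θ) θ := hasDerivAt_exp_I θ
    have hB' : HasDerivAt B (-Complex.I * B θ) θ := by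
      have := (hasDerivAt_exp_I (-θ)).scomp θ (hasDerivAt_neg θ)
      refine (this.congr_deriv ?_).congr_of_eventuallyEq (Eventually.of_forall fun θ => ?_)
      · simp [hB]
      · simp [hB]
    have hWN : HasDerivAt (fun θ => W θ ^ N) (Complex.I * N * W θ ^ N) θ := by
      refine (hW'.pow N).congr_deriv ?_
      rcases N with _ | N
      · simp
      · push_cast
        ring_nf
    have hc' : HasDerivAt (fun θ => x + Complex.I * r * W θ) (-r * W θ) θ := by
      refine ((hW'.const_mul (Complex.I * r)).const_add x).congr_deriv ?_
      linear_combination (r * W θ) * Complex.I_mul_I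
    have hxc : x + Complex.I * r * W θ = c := by rw [hx]; ring
    have hcomp : ∀ {K : ℂ → ℂ}, ContDiffOn ℝ ∞ K U →
        HasDerivAt (fun θ => K (x + Complex.I * r * W θ))
          (-r * (W θ * D K c + B θ * D' K c)) θ := by
      intro K hK
      have h1 := (differentiableAt_of_contDiffOn hU hK hc).hasFDerivAt
      rw [← hxc] at h1
      refine (h1.comp_hasDerivAt θ hc').congr_deriv ?_
      have hconj : (starRingEnd ℂ) (W θ) = B θ := conj_exp_I θ
      rw [fderiv_eq_wirtinger, hxc, map_mul, hconj, map_neg, Complex.conj_ofReal]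
      ring
    have hlhs := hWN.mul ((hcomp hG).add (HasDerivAt.fun_sum (u := Finset.univ) fun i _ =>
      (hB'.pow (e i + 1)).mul (hcomp (hH i))))
    have hrhs : HasDerivAt (fun θ => (p x).eval (W θ))
        ((Polynomial.derivative (p x)).eval (W θ) * (Complex.I * W θ)) θ :=
      ((p x).hasDerivAt (W θ)).comp θ hW'
    have hnear : ∀ᶠ θ' in 𝓝 θ, x + Complex.I * r * W θ' ∈ U ∧ θ' ∈ V := by
      refine (hc'.continuousAt.eventually_mem ?_).and (hV.mem_nhds hθ)
      rw [hxc]; exact hU.mem_nhds hc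
    have hderiv := hlhs.unique (hrhs.congr_of_eventuallyEq (by
      filter_upwards [hnear] with θ' h'
      have h2 := heq _ h'.1 θ' h'.2
      rw [show x + Complex.I * r * W θ' - Complex.I * r * Complex.exp (θ' * Complex.I) = x by
        simp [hW]] at h2
      exact h2))
    simp only [Nat.add_sub_cancel, Pi.pow_apply, hxc] at hderiv
    have hr' : (r : ℂ) ≠ 0 := by exact_mod_cast hr
    have hκ : κ * Complex.I * r = 1 := by
      simp only [κ]
      field_simp
      simp
    have hsum : ∑ i, (B θ ^ (e i + 1 + 1) * (κ * (N - (e i + 1)) * H i c) +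
        B θ ^ (e i + 1) * D (H i) c + B θ ^ (e i + 2 + 1) * D' (H i) c) =
        κ * (-Complex.I) * B θ * (Complex.I * N * (∑ i, B θ ^ (e i + 1) * H i c) +
          ∑ i, (((e i + 1 : ℕ) : ℂ) * B θ ^ e i * (-Complex.I * B θ) * H i c +
            B θ ^ (e i + 1) * (-r * (W θ * D (H i) c + B θ * D' (H i) c)))) := by
      rw [Finset.mul_sum, ← Finset.sum_add_distrib, Finset.mul_sum]
      refine Finset.sum_congr rfl fun i _ => ?_
      push_cast
      linear_combination (B θ ^ (e i + 2) * κ * (N - (e i + 1)) * H i c) * Complex.I_mul_I -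
        B θ ^ (e i + 1) * D (H i) c * hWB - (B θ * W θ * B θ ^ (e i + 1) * D (H i) c +
          B θ ^ (e i + 3) * D' (H i) c) * hκ
    rw [Fintype.sum_sum_type, Fin.sum_univ_two, Fintype.sum_prod_type]
    simp only [Fin.sum_univ_three, e', H', Sum.elim_inl, Sum.elim_inr, Matrix.cons_val_zero,
      Matrix.cons_val_one, Matrix.cons_val]
    change W θ ^ N * (D G c + (B θ ^ (0 + 1) * (κ * N * G c) + B θ ^ (1 + 1) * D' G c +
      ∑ i, (B θ ^ (e i + 1 + 1) * (κ * (N - (e i + 1)) * H i c) +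
        B θ ^ (e i + 1) * D (H i) c + B θ ^ (e i + 2 + 1) * D' (H i) c))) =
      (Polynomial.C κ * Polynomial.derivative (p x)).eval (W θ)
    rw [hsum, Polynomial.eval_mul, Polynomial.eval_C]
    simp only [Pi.add_apply, Pi.mul_apply, Pi.pow_apply, hxc] at hderiv
    generalize (∑ i, B θ ^ (e i + 1) * H i c) = X at hderiv ⊢
    generalize (∑ i, (((e i + 1 : ℕ) : ℂ) * B θ ^ e i * (-Complex.I * B θ) * H i c +
      B θ ^ (e i + 1) * (-r * (W θ * D (H i) c + B θ * D' (H i) c)))) = Y at hderiv ⊢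
    generalize (Polynomial.derivative (p x)).eval (W θ) = q at hderiv ⊢
    linear_combination (κ * (-Complex.I) * B θ) * hderiv +
      (W θ ^ N * κ * N * B θ * G c - κ * q * W θ * B θ) * Complex.I_mul_I -
      W θ ^ N * D G c * hWB - (W θ ^ N * D G c * B θ * W θ + W θ ^ N * B θ ^ 2 * D' G c) * hκ +
      κ * q * hWB

theorem diffOp_iterate_conj (K : ℂ → ℂ) (n : ℕ) :
    (diffOp (1 / 2) (Complex.I / 2))^[n] (fun c => star (K c)) =
      fun c => star ((diffOp (1 / 2) (-Complex.I / 2))^[n] K c) := by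
  induction n generalizing K with
  | zero => rfl
  | succ n ih =>
    have h : diffOp (1 / 2) (Complex.I / 2) (fun c => star (K c)) =
        fun c => star (diffOp (1 / 2) (-Complex.I / 2) K c) := by
      ext c
      have : fderiv ℝ (fun c => star (K c)) c = _ := fderiv_star
      rw [diffOp, this]
      simp [diffOp]
    rw [Function.iterate_succ_apply, h, ih, Function.iterate_succ_apply]

/-- The Laurent polynomial in `w = exp(iθ)` given by a polynomial in the components of `w`,
multiplied by `wᴺ`. -/
noncomputable def velocityPolynomial (N : ℕ) (a : ℕ → ℕ → ℝ) : Polynomial ℂ :=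
  ∑ k ∈ Finset.range (N + 1), ∑ l ∈ Finset.range (N + 1 - k),
    Polynomial.C (a k l : ℂ) * Polynomial.X ^ (N - k - l) *
      (Polynomial.C (1 / 2) * (Polynomial.X ^ 2 + 1)) ^ k *
      (Polynomial.C (-Complex.I / 2) * (Polynomial.X ^ 2 - 1)) ^ l

theorem iterate_derivative_velocityPolynomial (N : ℕ) (a : ℕ → ℕ → ℝ) :
    Polynomial.derivative^[2 * N + 1] (velocityPolynomial N a) = 0 := by
  refine Polynomial.iterate_derivative_eq_zero (Nat.lt_succ_of_le ?_)
  refine Polynomial.natDegree_sum_le_of_forall_le _ _ fun k hk => ?_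
  refine Polynomial.natDegree_sum_le_of_forall_le _ _ fun l hl => ?_
  rw [Finset.mem_range] at hk hl
  have h1 : (Polynomial.C (1 / 2 : ℂ) * (Polynomial.X ^ 2 + 1)).natDegree ≤ 2 := by compute_degree
  have h2 : (Polynomial.C (-Complex.I / 2) * (Polynomial.X ^ 2 - 1)).natDegree ≤ 2 := by
    compute_degree
  have h3 := Polynomial.natDegree_pow_le_of_le k h1
  have h4 := Polynomial.natDegree_pow_le_of_le l h2
  have h5 := Polynomial.natDegree_C_mul_X_pow_le (a k l : ℂ) (N - k - l)
  refine (Polynomial.natDegree_mul_le_of_le (Polynomial.natDegree_mul_le_of_le h5 h3) h4).trans ?_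
  omega

theorem eval_velocityPolynomial (N : ℕ) (a : ℕ → ℕ → ℝ) {w : ℂ} (hw : ‖w‖ = 1) :
    (velocityPolynomial N a).eval w = w ^ N *
      ((∑ k ∈ Finset.range (N + 1), ∑ l ∈ Finset.range (N + 1 - k),
        a k l * w.re ^ k * w.im ^ l : ℝ) : ℂ) := by
  have hww : w * (starRingEnd ℂ) w = 1 := by
    rw [Complex.mul_conj, Complex.normSq_eq_norm_sq, hw]; simp
  have hre : 1 / 2 * (w ^ 2 + 1) = w * w.re := by
    rw [Complex.re_eq_add_conj]
    linear_combination (-1 / 2) * hww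
  have him : -Complex.I / 2 * (w ^ 2 - 1) = w * w.im := by
    rw [Complex.im_eq_sub_conj]
    field_simp
    linear_combination (-(w ^ 2) + 1) * Complex.I_sq + hww
  rw [velocityPolynomial, Polynomial.eval_finsetSum]
  push_cast
  rw [Finset.mul_sum]
  refine Finset.sum_congr rfl fun k hk => ?_
  rw [Polynomial.eval_finsetSum, Finset.mul_sum]
  refine Finset.sum_congr rfl fun l hl => ?_
  rw [Finset.mem_range] at hk hl
  simp only [Polynomial.eval_mul, Polynomial.eval_pow, Polynomial.eval_C, Polynomial.eval_X,
    Polynomial.eval_add, Polynomial.eval_sub, Polynomial.eval_one]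
  rw [hre, him]
  have : w ^ N = w ^ (N - k - l) * w ^ k * w ^ l := by
    rw [← pow_add, ← pow_add]; congr 1; omega
  rw [this]
  ring

theorem norm_exp_I (θ : ℝ) : ‖Complex.exp (θ * Complex.I)‖ = 1 := Complex.norm_exp_ofReal_mul_I θ

/-- A function of the centre of the Larmor circle that is polynomial in the velocity when expressed
through the point and the velocity is polynomial in the centre. -/
theorem eventually_eq_planeEval {D : Set ℂ} {Φ : ℂ → ℂ → ℝ} (hΦ : IsPolynomialInMomenta D Φ)
    {r : ℝ} (hr : r ≠ 0) {U : Set ℂ} (hU : IsOpen U) {c₀ : ℂ} (hc₀ : c₀ ∈ U) {V : Set ℝ}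
    (hV : IsOpen V) {θ₀ : ℝ} (hθ₀ : θ₀ ∈ V)
    (hmem : ∀ c ∈ U, ∀ θ ∈ V, c - Complex.I * r * Complex.exp (θ * Complex.I) ∈ D)
    {F : ℂ → ℝ} (hF : ∀ c ∈ U, ∀ θ ∈ V,
      Φ (c - Complex.I * r * Complex.exp (θ * Complex.I)) (Complex.exp (θ * Complex.I)) = F c) :
    ∃ P : MvPolynomial (Fin 2) ℝ, ∀ᶠ c in 𝓝 c₀, F c = planeEval P c := by
  obtain ⟨N, a, ha, hΦa⟩ := hΦ
  set w₀ := Complex.exp (θ₀ * Complex.I)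
  set G : ℂ → ℂ := fun c => (F c : ℂ) with hGdef
  have hG : ContDiffOn ℝ ∞ G U := by
    have h1 : ContDiffOn ℝ ∞ (fun c => ∑ k ∈ Finset.range (N + 1), ∑ l ∈ Finset.range (N + 1 - k),
        a k l (c - Complex.I * r * w₀) * w₀.re ^ k * w₀.im ^ l) U := by
      refine ContDiffOn.sum fun k hk => ContDiffOn.sum fun l hl => ?_
      rw [Finset.mem_range] at hk hl
      refine ContDiffOn.mul (ContDiffOn.mul ?_ contDiffOn_const) contDiffOn_const
      exact (ha k l (by omega)).comp (contDiffOn_id.sub contDiffOn_const)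
        fun c hc => subset_closure (hmem c hc θ₀ hθ₀)
    refine (Complex.ofRealCLM.contDiff.comp_contDiffOn h1).congr fun c hc => ?_
    have h2 := hΦa _ (subset_closure (hmem c hc θ₀ hθ₀)) w₀ (norm_exp_I θ₀)
    rw [hF c hc θ₀ hθ₀] at h2
    simp only [hGdef, h2]
    rfl
  have h1 := wirtinger_iterate_eq_zero hU hV ⟨θ₀, hθ₀⟩ hr N (2 * N + 1) (ι := Fin 0) (fun _ => 0)
    (G := G) (H := fun _ _ => 0) hG (fun _ => contDiffOn_const)
    (fun x => velocityPolynomial N fun k l => a k l x)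
    (fun x => iterate_derivative_velocityPolynomial N _)
    (by
      intro c hc θ hθ
      rw [eval_velocityPolynomial _ _ (norm_exp_I θ),
        ← hΦa _ (subset_closure (hmem c hc θ hθ)) _ (norm_exp_I θ), hF c hc θ hθ]
      simp [hGdef])
  have h2 : Set.EqOn ((diffOp (1 / 2) (Complex.I / 2))^[2 * N + 1] G) 0 U := by
    have hGstar : G = fun c => star (G c) := by
      ext c; simp [hGdef]
    rw [hGstar, diffOp_iterate_conj]
    intro c hc
    change star ((diffOp (1 / 2) (-Complex.I / 2))^[2 * N + 1] G c) = 0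
    rw [h1 hc]
    simp
  have hx := diffOp_iterate_combination hU hG 1 1 h1 h2
  have hy := diffOp_iterate_combination hU hG Complex.I (-Complex.I) h1 h2
  have e1 : (1 : ℂ) * (1 / 2) + 1 * (1 / 2) = 1 := by norm_num
  have e2 : (1 : ℂ) * (-Complex.I / 2) + 1 * (Complex.I / 2) = 0 := by ring
  have e3 : Complex.I * (1 / 2) + -Complex.I * (1 / 2) = 0 := by ring
  have e4 : Complex.I * (-Complex.I / 2) + -Complex.I * (Complex.I / 2) = 1 := by
    linear_combination -Complex.I_mul_I
  rw [e1, e2] at hx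
  rw [e3, e4] at hy
  obtain ⟨P, hP⟩ := eventually_eq_mvPolynomial hU hc₀ hG hx hy
  obtain ⟨A, B, rfl⟩ := exists_complexify_add P
  refine ⟨A, ?_⟩
  filter_upwards [hP] with c hc
  rw [map_add, map_mul, MvPolynomial.eval_C, eval_toPair_complexify, eval_toPair_complexify] at hc
  have := congrArg Complex.re hc
  simpa [hGdef, planeEval] using this

/-! ### The motion near the boundary -/

theorem hasDerivAt_flowVel {r : ℝ} (v : ℂ) (t : ℝ) :
    HasDerivAt (flowVel r v) (Complex.I / r * flowVel r v t) t := by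
  have h1 : HasDerivAt (fun t : ℝ => t / r) (1 / r) t := (hasDerivAt_id t).div_const r
  have h2 := (hasDerivAt_exp_mul v (t / r)).scomp t h1
  refine h2.congr_deriv ?_
  rw [flowVel, Complex.real_smul]
  push_cast
  ring

theorem hasDerivAt_flowPos {r : ℝ} (hr : r ≠ 0) (x v : ℂ) (t : ℝ) :
    HasDerivAt (flowPos r x v) (flowVel r v t) t := by
  have hr' : (r : ℂ) ≠ 0 := by exact_mod_cast hr
  refine ((((hasDerivAt_flowVel (r := r) v t).const_mul Complex.I).const_mul (r : ℂ)).const_sub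
    (x + r * (Complex.I * v))).congr_deriv ?_
  field_simp
  linear_combination -(flowVel r v t) * Complex.I_sq

theorem flowPos_zero (r : ℝ) (x v : ℂ) : flowPos r x v 0 = x := by
  simp [flowPos, flowVel]

theorem flowVel_zero (r : ℝ) (v : ℂ) : flowVel r v 0 = v := by
  simp [flowVel]

theorem norm_flowVel (r : ℝ) (v : ℂ) (t : ℝ) : ‖flowVel r v t‖ = ‖v‖ := by
  rw [flowVel, norm_mul, norm_exp_I, one_mul]

theorem add_flowVel (r : ℝ) (x v : ℂ) (t : ℝ) :
    flowPos r x v t + r * (Complex.I * flowVel r v t) = x + r * (Complex.I * v) := by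
  simp [flowPos]

theorem contDiff_flowPos {r : ℝ} {E : Type*} [NormedAddCommGroup E] [NormedSpace ℝ E]
    {x v : E → ℂ} {t : E → ℝ} (hx : ContDiff ℝ ∞ x) (hv : ContDiff ℝ ∞ v) (ht : ContDiff ℝ ∞ t) :
    ContDiff ℝ ∞ fun e => flowPos r (x e) (v e) (t e) := by
  have h1 : ContDiff ℝ ∞ fun e => ((t e / r : ℝ) : ℂ) :=
    Complex.ofRealCLM.contDiff.comp (ht.div_const r)
  unfold flowPos flowVel
  fun_prop

/-- The height above the boundary of a motion that starts at the boundary grows at the rate given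
by the normal component of its velocity, uniformly in the initial data. -/
theorem height_expansion {γ : ℝ → ℂ} (hγ : ContDiff ℝ ∞ γ) (hu : ∀ s, ‖deriv γ s‖ = 1) {r : ℝ}
    (hr : r ≠ 0) {E : Type*} [NormedAddCommGroup E] [NormedSpace ℝ E] {s : E → ℝ} {v : E → ℂ}
    (hs : ContDiff ℝ ∞ s) (hv : ContDiff ℝ ∞ v) (e₀ : E) {η : ℝ} (hη : 0 < η) :
    ∃ h S : ℂ → ℝ, ContinuousAt h (γ (s e₀)) ∧ h (γ (s e₀)) = 0 ∧
      ∀ᶠ p : E × ℝ in 𝓝 (e₀, 0),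
        flowPos r (γ (s p.1)) (v p.1) p.2 =
          parallelCurve γ (h (flowPos r (γ (s p.1)) (v p.1) p.2))
            (S (flowPos r (γ (s p.1)) (v p.1) p.2)) ∧
        |h (flowPos r (γ (s p.1)) (v p.1) p.2) - p.2 * inner ℝ (normal γ (s e₀)) (v e₀)| ≤
          η * |p.2| := by
  obtain ⟨h, S, h', hh, hh', hS, h0⟩ := exists_local_coordinates hγ hu (s e₀)
  set X : E × ℝ → ℂ := fun p => flowPos r (γ (s p.1)) (v p.1) p.2 with hX
  have hXs : ContDiff ℝ ∞ X :=
    contDiff_flowPos ((hγ.comp hs).comp contDiff_fst) (hv.comp contDiff_fst) contDiff_snd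
  have hX0 : ∀ e, X (e, 0) = γ (s e) := fun e => flowPos_zero _ _ _
  have hXd : HasStrictFDerivAt X (fderiv ℝ X (e₀, 0)) (e₀, 0) :=
    hXs.contDiffAt.hasStrictFDerivAt (by simp)
  have hXτ : fderiv ℝ X (e₀, 0) (0, 1) = v e₀ := by
    have h1 : HasDerivAt (fun τ : ℝ => (e₀, τ)) ((0 : E), (1 : ℝ)) 0 :=
      (hasDerivAt_const _ _).prodMk (hasDerivAt_id _)
    have h2 := hXd.hasFDerivAt.comp_hasDerivAt (0 : ℝ) h1
    have h3 := h2.unique (hasDerivAt_flowPos hr (γ (s e₀)) (v e₀) 0)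
    rw [h3, flowVel_zero]
  have hcomp : HasStrictFDerivAt (fun p => h (X p)) (h' ∘L fderiv ℝ X (e₀, 0)) (e₀, 0) := by
    refine HasStrictFDerivAt.comp _ ?_ hXd
    rw [hX0]; exact hh
  have hlo := hcomp.isLittleO
  rw [Asymptotics.isLittleO_iff] at hlo
  have htend : Tendsto (fun p : E × ℝ => (p, (p.1, (0 : ℝ)))) (𝓝 (e₀, 0)) (𝓝 ((e₀, 0), (e₀, 0))) :=
    (by fun_prop : Continuous fun p : E × ℝ => (p, (p.1, (0 : ℝ)))).tendsto (e₀, 0)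
  have hXt : Tendsto X (𝓝 (e₀, 0)) (𝓝 (γ (s e₀))) := by
    rw [← hX0]; exact hXs.continuous.tendsto _
  have hst : Tendsto (fun p : E × ℝ => s p.1) (𝓝 (e₀, 0)) (𝓝 (s e₀)) :=
    (hs.continuous.comp continuous_fst).tendsto (e₀, 0)
  refine ⟨h, S, hh.hasFDerivAt.continuousAt, h0.self_of_nhds, ?_⟩
  filter_upwards [htend.eventually (hlo hη), hXt.eventually hS, hst.eventually h0] with p hp hpS hp0
  refine ⟨hpS, ?_⟩
  rw [hX0, hp0, sub_zero] at hp
  have h1 : p - (p.1, 0) = p.2 • ((0 : E), (1 : ℝ)) := by ext <;> simp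
  have h2 : ‖p.2 • ((0 : E), (1 : ℝ))‖ = |p.2| := by simp [Prod.norm_def]
  rw [h1, map_smul, h2, ContinuousLinearMap.comp_apply, hXτ, hh', smul_eq_mul] at hp
  exact hp

theorem inner_normal_exp {γ : ℝ → ℂ} (hu : ∀ s, ‖deriv γ s‖ = 1) (s α : ℝ) :
    inner ℝ (normal γ s) (Complex.exp (α * Complex.I) * deriv γ s) = Real.sin α := by
  have := sq_add_sq_deriv hu s
  rw [Complex.inner]
  simp [normal, Complex.exp_ofReal_mul_I_re, Complex.exp_ofReal_mul_I_im]
  linear_combination Real.sin α * this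

theorem norm_exp_mul_deriv {γ : ℝ → ℂ} (hu : ∀ s, ‖deriv γ s‖ = 1) (s α : ℝ) :
    ‖Complex.exp (α * Complex.I) * deriv γ s‖ = 1 := by
  rw [norm_mul, norm_exp_I, hu, one_mul]

theorem contDiff_exp_I : ContDiff ℝ ∞ fun α : ℝ => Complex.exp (α * Complex.I) := by
  have : ContDiff ℝ ∞ fun α : ℝ => (α : ℂ) := Complex.ofRealCLM.contDiff
  fun_prop

theorem contDiff_initial_velocity {γ : ℝ → ℂ} (hγ : ContDiff ℝ ∞ γ) :
    ContDiff ℝ ∞ fun p : ℝ × ℝ => Complex.exp (p.2 * Complex.I) * deriv γ p.1 :=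
  (contDiff_exp_I.comp contDiff_snd).mul ((contDiff_deriv hγ).comp contDiff_fst)

/-- Motions that start from the boundary with transversal inward velocity run inside the annulus
for a time that is locally uniform in the initial data. -/
theorem exists_time_mem_arcRegion {γ : ℝ → ℂ} (hγ : ContDiff ℝ ∞ γ) (hu : ∀ s, ‖deriv γ s‖ = 1)
    {r : ℝ} (hr : 0 < r) {p₀ : ℝ × ℝ} (hp₀ : p₀.2 ∈ Set.Ioo 0 Real.pi) :
    ∃ δ > 0, ∀ᶠ p : ℝ × ℝ in 𝓝 p₀, ∀ τ ∈ Set.Ioc 0 δ,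
      flowPos r (γ p.1) (Complex.exp (p.2 * Complex.I) * deriv γ p.1) τ ∈ arcRegion γ r := by
  have hsin : 0 < Real.sin p₀.2 := Real.sin_pos_of_mem_Ioo hp₀
  obtain ⟨h, S, hc, h0, hev⟩ := height_expansion hγ hu hr.ne' (s := Prod.fst)
    (v := fun p : ℝ × ℝ => Complex.exp (p.2 * Complex.I) * deriv γ p.1) contDiff_fst
    (contDiff_initial_velocity hγ) p₀ (half_pos hsin)
  have hXt : Tendsto (fun p : (ℝ × ℝ) × ℝ => flowPos r (γ p.1.1)
      (Complex.exp (p.1.2 * Complex.I) * deriv γ p.1.1) p.2) (𝓝 (p₀, 0)) (𝓝 (γ p₀.1)) := by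
    have h1 := (contDiff_flowPos (r := r) ((hγ.comp contDiff_fst).comp contDiff_fst)
      ((contDiff_initial_velocity hγ).comp contDiff_fst)
      (contDiff_snd (E := ℝ × ℝ) (F := ℝ))).continuous.tendsto (p₀, 0)
    simpa only [Function.comp_def, flowPos_zero] using h1
  have hsmall : ∀ᶠ x in 𝓝 (γ p₀.1), h x < 2 * r :=
    hc.eventually_lt continuousAt_const (by rw [h0]; linarith)
  have hall := hev.and (hXt.eventually hsmall)
  rw [nhds_prod_eq, eventually_prod_iff] at hall
  obtain ⟨pa, hpa, pb, hpb, hpab⟩ := hall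
  obtain ⟨δ, hδ, hball⟩ := Metric.eventually_nhds_iff.1 hpb
  refine ⟨δ / 2, half_pos hδ, ?_⟩
  filter_upwards [hpa] with p hp τ hτ
  have hτ' : pb τ := hball (by
    rw [Real.dist_eq, sub_zero, abs_of_pos hτ.1]; linarith [hτ.2])
  obtain ⟨⟨h1, h2⟩, h3⟩ := hpab hp hτ'
  dsimp only at h1 h2 h3
  rw [inner_normal_exp hu, abs_of_pos hτ.1] at h2
  have h4 := (abs_le.1 h2).1
  have h5 : 0 < τ * Real.sin p₀.2 := mul_pos hτ.1 hsin
  exact ⟨_, _, by nlinarith, h3, h1⟩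

theorem hasStrictFDerivAt_larmorCenter {γ : ℝ → ℂ} (hγ : ContDiff ℝ ∞ γ)
    (hu : ∀ s, ‖deriv γ s‖ = 1) (r : ℝ) (p : ℝ × ℝ) :
    HasStrictFDerivAt (fun p : ℝ × ℝ => larmorCenter γ r p.1 p.2)
      ((ContinuousLinearMap.fst ℝ ℝ ℝ).smulRight ((1 - r * curvature γ p.1 *
        Complex.exp (p.2 * Complex.I)) * deriv γ p.1) +
        (ContinuousLinearMap.snd ℝ ℝ ℝ).smulRight
          (-r * (Complex.exp (p.2 * Complex.I) * deriv γ p.1))) p := by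
  have hsm : ContDiff ℝ ∞ fun p : ℝ × ℝ => larmorCenter γ r p.1 p.2 :=
    (hγ.comp contDiff_fst).add (contDiff_const.mul ((contDiff_exp_I.comp contDiff_snd).mul
      ((contDiff_normal hγ).comp contDiff_fst)))
  refine hsm.contDiffAt.hasStrictFDerivAt' ?_ (by simp)
  have hfst : HasFDerivAt (fun p : ℝ × ℝ => p.1) (ContinuousLinearMap.fst ℝ ℝ ℝ) p :=
    hasFDerivAt_fst
  have hsnd : HasFDerivAt (fun p : ℝ × ℝ => p.2) (ContinuousLinearMap.snd ℝ ℝ ℝ) p :=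
    hasFDerivAt_snd
  have h1 := (hasDerivAt_curve hγ p.1).hasFDerivAt.comp p hfst
  have h2 := (hasDerivAt_normal hγ hu p.1).hasFDerivAt.comp p hfst
  have h3 := (hasDerivAt_exp_I p.2).hasFDerivAt.comp p hsnd
  refine (h1.add ((h3.mul h2).const_mul (r : ℂ))).congr_fderiv ?_
  ext
  · simp
    ring
  · simp [normal]
    linear_combination (r * Complex.exp (p.2 * Complex.I) * deriv γ p.1) * Complex.I_mul_I

theorem larmorCenter_frame_det {γ : ℝ → ℂ} (hu : ∀ s, ‖deriv γ s‖ = 1) (r s α : ℝ) :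
    ((1 - r * curvature γ s * Complex.exp (α * Complex.I)) * deriv γ s).re *
      (-r * (Complex.exp (α * Complex.I) * deriv γ s)).im -
    ((1 - r * curvature γ s * Complex.exp (α * Complex.I)) * deriv γ s).im *
      (-r * (Complex.exp (α * Complex.I) * deriv γ s)).re = -r * Real.sin α := by
  have := sq_add_sq_deriv hu s
  have hI : Complex.exp (α * Complex.I) = Real.cos α + Real.sin α * Complex.I := by
    rw [Complex.exp_mul_I]; simp
  rw [hI]
  simp [-Complex.ofReal_cos, -Complex.ofReal_sin]
  linear_combination (-r * Real.sin α) * this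

/-- The Larmor centres of the boundary vectors near a transversal one fill a neighbourhood. -/
theorem map_larmorCenter_nhds {γ : ℝ → ℂ} (hγ : ContDiff ℝ ∞ γ) (hu : ∀ s, ‖deriv γ s‖ = 1)
    {r : ℝ} (hr : 0 < r) {p₀ : ℝ × ℝ} (hp₀ : p₀.2 ∈ Set.Ioo 0 Real.pi) :
    map (fun p : ℝ × ℝ => larmorCenter γ r p.1 p.2) (𝓝 p₀) = 𝓝 (larmorCenter γ r p₀.1 p₀.2) := by
  have hdet : ((1 - r * curvature γ p₀.1 * Complex.exp (p₀.2 * Complex.I)) * deriv γ p₀.1).re *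
      (-r * (Complex.exp (p₀.2 * Complex.I) * deriv γ p₀.1)).im -
      ((1 - r * curvature γ p₀.1 * Complex.exp (p₀.2 * Complex.I)) * deriv γ p₀.1).im *
      (-r * (Complex.exp (p₀.2 * Complex.I) * deriv γ p₀.1)).re ≠ 0 := by
    rw [larmorCenter_frame_det hu]
    exact mul_ne_zero (neg_ne_zero.2 hr.ne') (Real.sin_pos_of_mem_Ioo hp₀).ne'
  have h : HasStrictFDerivAt (fun p : ℝ × ℝ => larmorCenter γ r p.1 p.2)
    (frameEquiv _ _ hdet : (ℝ × ℝ) →L[ℝ] ℂ) p₀ := hasStrictFDerivAt_larmorCenter hγ hu r p₀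
  exact h.map_nhds_eq_of_equiv

/-! ### The integral as a polynomial in the centre of the Larmor circle -/

theorem arcRegion_subset {Ω : Set ℂ} {γ : ℝ → ℂ} {L ρ r : ℝ} (hΩ : IsTable Ω γ L)
    (hρ : IsTubular γ L ρ) (hrρ : 2 * r < ρ) : arcRegion γ r ⊆ Ω := by
  rintro _ ⟨s, t, ht, htr, rfl⟩
  exact parallelCurve_mem hΩ hρ ht (htr.trans hrρ) s

theorem mem_closure_arcRegion {γ : ℝ → ℂ} {r : ℝ} (hr : 0 < r) (s : ℝ) :
    γ s ∈ closure (arcRegion γ r) := by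
  have hc : Continuous fun t : ℝ => parallelCurve γ t s := by
    unfold parallelCurve
    fun_prop
  have h1 : Tendsto (fun t : ℝ => parallelCurve γ t s) (𝓝[>] 0) (𝓝 (γ s)) := by
    have := (hc.tendsto 0).mono_left (nhdsWithin_le_nhds (s := Set.Ioi 0))
    rwa [parallelCurve_zero] at this
  refine mem_closure_of_tendsto h1 ?_
  filter_upwards [Ioo_mem_nhdsGT (show (0 : ℝ) < 2 * r by linarith)] with t ht
  exact ⟨s, t, ht.1, ht.2, rfl⟩

theorem larmorCenter_eq_add (γ : ℝ → ℂ) (r s α : ℝ) :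
    larmorCenter γ r s α =
      γ s + r * (Complex.I * (Complex.exp (α * Complex.I) * deriv γ s)) := by
  rw [larmorCenter, normal]; ring

/-- Near a transversal boundary vector, the integral is a polynomial in the Larmor centre. -/
theorem exists_eventually_eq_planeEval_larmorCenter {Ω : Set ℂ} {γ : ℝ → ℂ} {L ρ r : ℝ}
    (hΩ : IsTable Ω γ L) (hρ : IsTubular γ L ρ) (hr : 0 < r) (hrρ : 2 * r < ρ)
    {Φ : ℂ → ℂ → ℝ} (hΦ : IsPolynomialIntegral Ω γ r Φ) {p₀ : ℝ × ℝ}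
    (hp₀ : p₀.2 ∈ Set.Ioo 0 Real.pi) :
    ∃ P : MvPolynomial (Fin 2) ℝ, ∀ᶠ p : ℝ × ℝ in 𝓝 p₀,
      Φ (γ p.1) (Complex.exp (p.2 * Complex.I) * deriv γ p.1) =
        planeEval P (larmorCenter γ r p.1 p.2) := by
  have hγ := hΩ.smooth
  have hu := hΩ.unit_speed
  have hr' : (r : ℂ) ≠ 0 := by exact_mod_cast hr.ne'
  obtain ⟨δ, hδ, hev⟩ := exists_time_mem_arcRegion hγ hu hr hp₀
  set E : ℝ × ℝ → ℂ := fun p => Complex.exp (p.2 * Complex.I) * deriv γ p.1 with hE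
  have hEc : Continuous E := (contDiff_initial_velocity hγ).continuous
  have hE1 : ∀ p, ‖E p‖ = 1 := fun p => norm_exp_mul_deriv hu _ _
  have hE0 : ∀ p, E p ≠ 0 := fun p => norm_ne_zero_iff.1 (by rw [hE1]; exact one_ne_zero)
  set κ := δ / (2 * r) with hκ
  have hκ0 : 0 < κ := by positivity
  set θ₀ := κ + (E p₀).arg with hθ₀
  -- the velocity `exp(iθ)` is reached at the time `δ / 2 + r arg u`
  set u : (ℝ × ℝ) × ℝ → ℂ := fun q =>
    Complex.exp (q.2 * Complex.I) / (Complex.exp (κ * Complex.I) * E q.1) with hu'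
  have hu1 : ∀ q, ‖u q‖ = 1 := fun q => by
    rw [hu', norm_div, norm_mul, norm_exp_I, norm_exp_I, hE1]; norm_num
  have huc : Continuous u := by
    refine Continuous.div₀ (by fun_prop) (by fun_prop) fun q => ?_
    exact mul_ne_zero (Complex.exp_ne_zero _) (hE0 _)
  have harg : ∀ z : ℂ, ‖z‖ = 1 → Complex.exp (z.arg * Complex.I) = z := fun z hz => by
    have := Complex.norm_mul_exp_arg_mul_I z
    rwa [hz, Complex.ofReal_one, one_mul] at this
  have hub : u (p₀, θ₀) = 1 := by
    have h1 : Complex.exp (θ₀ * Complex.I) = Complex.exp (κ * Complex.I) * E p₀ := by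
      rw [← harg (E p₀) (hE1 p₀), hθ₀, ← Complex.exp_add]
      congr 1
      push_cast
      ring
    rw [hu']
    dsimp only
    rw [h1]
    exact div_self (mul_ne_zero (Complex.exp_ne_zero _) (hE0 _))
  have hargc : Tendsto (fun q => (u q).arg) (𝓝 (p₀, θ₀)) (𝓝 0) := by
    have h1 : ContinuousAt Complex.arg (u (p₀, θ₀)) := by
      rw [hub]; exact Complex.continuousAt_arg (by simp)
    have h2 : ContinuousAt (fun q => (u q).arg) (p₀, θ₀) :=
      ContinuousAt.comp (f := u) h1 huc.continuousAt
    have h3 := h2.tendsto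
    rwa [hub, Complex.arg_one] at h3
  have hall : ∀ᶠ q : (ℝ × ℝ) × ℝ in 𝓝 (p₀, θ₀), ((∀ τ ∈ Set.Ioc 0 δ,
      flowPos r (γ q.1.1) (E q.1) τ ∈ arcRegion γ r) ∧ q.1.2 ∈ Set.Ioo 0 Real.pi) ∧
      (u q).arg ∈ Set.Ioo (-κ) κ := by
    refine Eventually.and ?_ (hargc.eventually (Ioo_mem_nhds (by linarith) hκ0))
    have h1 : Tendsto (fun q : (ℝ × ℝ) × ℝ => q.1) (𝓝 (p₀, θ₀)) (𝓝 p₀) :=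
      continuous_fst.tendsto (p₀, θ₀)
    exact h1.eventually (hev.and (continuous_snd.continuousAt.eventually_mem
      (Ioo_mem_nhds hp₀.1 hp₀.2)))
  have hkey : ∀ᶠ q : (ℝ × ℝ) × ℝ in 𝓝 (p₀, θ₀),
      larmorCenter γ r q.1.1 q.1.2 - Complex.I * r * Complex.exp (q.2 * Complex.I) ∈
        arcRegion γ r ∧
      Φ (larmorCenter γ r q.1.1 q.1.2 - Complex.I * r * Complex.exp (q.2 * Complex.I))
        (Complex.exp (q.2 * Complex.I)) = Φ (γ q.1.1) (E q.1) := by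
    filter_upwards [hall] with q hq
    obtain ⟨⟨hreg, hα⟩, ha1, ha2⟩ := hq
    set τ := δ / 2 + r * (u q).arg with hτ
    have hrκ : r * κ = δ / 2 := by rw [hκ]; field_simp
    have hτ1 : τ ∈ Set.Ioc 0 δ := ⟨by nlinarith, by nlinarith⟩
    have hvel : flowVel r (E q.1) τ = Complex.exp (q.2 * Complex.I) := by
      have h1 : ((τ / r : ℝ) : ℂ) * Complex.I = (u q).arg * Complex.I + κ * Complex.I := by
        rw [hτ, ← hrκ]
        push_cast
        field_simp
        ring
      rw [flowVel, h1, Complex.exp_add, harg _ (hu1 q), mul_assoc]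
      exact div_mul_cancel₀ _ (mul_ne_zero (Complex.exp_ne_zero _) (hE0 _))
    have hpos : flowPos r (γ q.1.1) (E q.1) τ =
        larmorCenter γ r q.1.1 q.1.2 - Complex.I * r * Complex.exp (q.2 * Complex.I) := by
      rw [larmorCenter_eq_add, ← hvel, flowPos]
      ring
    rw [← hpos, ← hvel]
    refine ⟨hreg τ hτ1, hΦ.between_collisions _ _ _ (hE1 _) ?_ hτ1.1.le fun σ hσ =>
      arcRegion_subset hΩ hρ hrρ (hreg σ ⟨hσ.1, hσ.2.trans hτ1.2⟩)⟩
    rw [hE, inner_normal_exp hu]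
    exact Real.sin_pos_of_mem_Ioo hα
  rw [nhds_prod_eq, eventually_prod_iff] at hkey
  obtain ⟨pa, hpa, pb, hpb, hab⟩ := hkey
  have hmap := map_larmorCenter_nhds hγ hu hr hp₀
  have hUn : (fun p : ℝ × ℝ => larmorCenter γ r p.1 p.2) '' {p | pa p} ∈
      𝓝 (larmorCenter γ r p₀.1 p₀.2) := by
    rw [← hmap]; exact image_mem_map hpa
  obtain ⟨P, hP⟩ := eventually_eq_planeEval hΦ.polynomial hr.ne' isOpen_interior
    (mem_interior_iff_mem_nhds.2 hUn) isOpen_interior (mem_interior_iff_mem_nhds.2 hpb)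
    (F := fun c => Φ (c - Complex.I * r * Complex.exp (θ₀ * Complex.I))
      (Complex.exp (θ₀ * Complex.I)))
    (by
      intro c hc θ hθ
      obtain ⟨p, hp, rfl⟩ := interior_subset hc
      exact (hab hp (interior_subset hθ)).1)
    (by
      intro c hc θ hθ
      obtain ⟨p, hp, rfl⟩ := interior_subset hc
      exact (hab hp (interior_subset hθ)).2.trans (hab hp hpb.self_of_nhds).2.symm)
  refine ⟨P, ?_⟩
  rw [← hmap, eventually_map] at hP
  filter_upwards [hP, hpa] with p hp hpa'
  exact ((hab hpa' hpb.self_of_nhds).2.symm.trans hp :)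

theorem eq_of_eventually_planeEval_eq {P Q : MvPolynomial (Fin 2) ℝ} {z : ℂ}
    (h : ∀ᶠ w in 𝓝 z, planeEval P w = planeEval Q w) : P = Q := by
  have hc : Continuous fun q : ℝ × ℝ => (⟨q.1, q.2⟩ : ℂ) :=
    Complex.equivRealProdCLM.symm.continuous
  have h2 : ∀ᶠ q : ℝ × ℝ in 𝓝 (z.re, z.im), planeEval P ⟨q.1, q.2⟩ = planeEval Q ⟨q.1, q.2⟩ :=
    (hc.tendsto (z.re, z.im)).eventually h
  rw [nhds_prod_eq, eventually_prod_iff] at h2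
  obtain ⟨pa, hpa, pb, hpb, hab⟩ := h2
  refine MvPolynomial.funext_set (s := ![{x | pa x}, {y | pb y}]) ?_ ?_
  · intro i
    fin_cases i
    · exact infinite_of_mem_nhds _ hpa
    · exact infinite_of_mem_nhds _ hpb
  · intro x hx
    have h3 := hab (hx 0 trivial) (hx 1 trivial)
    have h4 : ![x 0, x 1] = x := by ext i; fin_cases i <;> rfl
    simpa [planeEval, h4] using h3

/-- The local polynomials agree by analytic continuation along the boundary vectors. -/
theorem exists_eq_planeEval_larmorCenter {Ω : Set ℂ} {γ : ℝ → ℂ} {L ρ r : ℝ}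
    (hΩ : IsTable Ω γ L) (hρ : IsTubular γ L ρ) (hr : 0 < r) (hrρ : 2 * r < ρ)
    {Φ : ℂ → ℂ → ℝ} (hΦ : IsPolynomialIntegral Ω γ r Φ) :
    ∃ P : MvPolynomial (Fin 2) ℝ, ∀ s, ∀ α ∈ Set.Ioo 0 Real.pi,
      Φ (γ s) (Complex.exp (α * Complex.I) * deriv γ s) = planeEval P (larmorCenter γ r s α) := by
  have hloc := fun (p : ℝ × ℝ) (hp : p.2 ∈ Set.Ioo 0 Real.pi) =>
    exists_eventually_eq_planeEval_larmorCenter hΩ hρ hr hrρ hΦ hp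
  have hmid : (0, Real.pi / 2).2 ∈ Set.Ioo 0 Real.pi :=
    ⟨by have := Real.pi_pos; dsimp only; linarith, by have := Real.pi_pos; dsimp only; linarith⟩
  obtain ⟨P, hP⟩ := hloc (0, Real.pi / 2) hmid
  have hpre : IsPreconnected ((Set.univ : Set ℝ) ×ˢ Set.Ioo 0 Real.pi) :=
    isPreconnected_univ.prod isPreconnected_Ioo
  have hopen : IsOpen ((Set.univ : Set ℝ) ×ˢ Set.Ioo 0 Real.pi) := isOpen_univ.prod isOpen_Ioo
  have hsub := hpre.subset_of_closure_inter_subset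
    (u := {p : ℝ × ℝ | ∀ᶠ q : ℝ × ℝ in 𝓝 p,
      Φ (γ q.1) (Complex.exp (q.2 * Complex.I) * deriv γ q.1) =
        planeEval P (larmorCenter γ r q.1 q.2)}) isOpen_setOfPred_eventually_nhds
    ⟨(0, Real.pi / 2), ⟨trivial, hmid⟩, hP⟩ (by
      rintro p ⟨hpc, hpS⟩
      obtain ⟨Q, hQ⟩ := hloc p hpS.2
      obtain ⟨q, hq, hqQ, hqS⟩ := (mem_closure_iff_frequently.1 hpc).and_eventually
        (hQ.eventually_nhds.and (hopen.mem_nhds hpS)) |>.exists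
      have h1 : ∀ᶠ c in 𝓝 (larmorCenter γ r q.1 q.2), planeEval P c = planeEval Q c := by
        rw [← map_larmorCenter_nhds hΩ.smooth hΩ.unit_speed hr hqS.2, eventually_map]
        filter_upwards [hq, hqQ] with x hx1 hx2
        exact hx1.symm.trans hx2
      rw [eq_of_eventually_planeEval_eq h1]
      exact hQ)
  exact ⟨P, fun s α hα => (hsub (show (s, α) ∈ _ from ⟨trivial, hα⟩)).self_of_nhds⟩

theorem analyticAt_exp_mul_re (w : ℂ) (α : ℝ) :
    AnalyticAt ℝ (fun α : ℝ => (Complex.exp (α * Complex.I) * w).re) α := by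
  simp only [Complex.mul_re, Complex.exp_ofReal_mul_I_re, Complex.exp_ofReal_mul_I_im]
  fun_prop

theorem analyticAt_exp_mul_im (w : ℂ) (α : ℝ) :
    AnalyticAt ℝ (fun α : ℝ => (Complex.exp (α * Complex.I) * w).im) α := by
  simp only [Complex.mul_im, Complex.exp_ofReal_mul_I_re, Complex.exp_ofReal_mul_I_im]
  fun_prop

theorem IsPolynomialInMomenta.analyticOnNhd {D : Set ℂ} {Φ : ℂ → ℂ → ℝ}
    (hΦ : IsPolynomialInMomenta D Φ) {x : ℂ} (hx : x ∈ closure D) {w : ℂ} (hw : ‖w‖ = 1) :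
    AnalyticOnNhd ℝ (fun α : ℝ => Φ x (Complex.exp (α * Complex.I) * w)) Set.univ := by
  obtain ⟨N, a, -, ha⟩ := hΦ
  have h : (fun α : ℝ => Φ x (Complex.exp (α * Complex.I) * w)) = fun α : ℝ =>
      ∑ k ∈ Finset.range (N + 1), ∑ l ∈ Finset.range (N + 1 - k),
        a k l x * (Complex.exp (α * Complex.I) * w).re ^ k *
          (Complex.exp (α * Complex.I) * w).im ^ l := by
    ext α
    exact ha x hx _ (by rw [norm_mul, norm_exp_I, hw, one_mul])
  rw [h]
  intro α _
  refine Finset.analyticAt_fun_sum _ fun k _ => Finset.analyticAt_fun_sum _ fun l _ => ?_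
  exact (analyticAt_const.mul ((analyticAt_exp_mul_re w α).pow k)).mul
    ((analyticAt_exp_mul_im w α).pow l)

theorem analyticOnNhd_planeEval_add_exp_mul (P : MvPolynomial (Fin 2) ℝ) (x w : ℂ) :
    AnalyticOnNhd ℝ (fun α : ℝ => planeEval P (x + Complex.exp (α * Complex.I) * w)) Set.univ := by
  intro α _
  simp only [planeEval, ← MvPolynomial.coe_aeval_eq_eval, RingHom.coe_coe]
  refine AnalyticAt.aeval_mvPolynomial (f := fun α : ℝ =>
    ![(x + Complex.exp (α * Complex.I) * w).re, (x + Complex.exp (α * Complex.I) * w).im]) ?_ P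
  intro i
  fin_cases i
  · exact (analyticAt_const (v := x.re)).add (analyticAt_exp_mul_re w α)
  · exact (analyticAt_const (v := x.im)).add (analyticAt_exp_mul_im w α)

/-- Over a boundary point, both the integral and the polynomial are analytic functions of the angle,
so that they also agree on outward and tangential vectors. -/
theorem eq_planeEval_larmorCenter {γ : ℝ → ℂ} (hu : ∀ s, ‖deriv γ s‖ = 1) {r : ℝ} (hr : 0 < r)
    {Φ : ℂ → ℂ → ℝ} (hΦ : IsPolynomialInMomenta (arcRegion γ r) Φ) {P : MvPolynomial (Fin 2) ℝ}
    (hP : ∀ s, ∀ α ∈ Set.Ioo 0 Real.pi,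
      Φ (γ s) (Complex.exp (α * Complex.I) * deriv γ s) = planeEval P (larmorCenter γ r s α))
    (s α : ℝ) :
    Φ (γ s) (Complex.exp (α * Complex.I) * deriv γ s) = planeEval P (larmorCenter γ r s α) := by
  have h1 := hΦ.analyticOnNhd (mem_closure_arcRegion hr s) (hu s)
  have h2 := analyticOnNhd_planeEval_add_exp_mul P (γ s) (r * normal γ s)
  have h3 : ∀ β : ℝ, γ s + Complex.exp (β * Complex.I) * (r * normal γ s) =
      larmorCenter γ r s β := fun β => by rw [larmorCenter]; ring
  simp only [h3] at h2
  refine congrFun (h1.eq_of_eventuallyEq h2 (z₀ := Real.pi / 2) ?_) α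
  filter_upwards [Ioo_mem_nhds (show 0 < Real.pi / 2 by have := Real.pi_pos; linarith)
    (show Real.pi / 2 < Real.pi by have := Real.pi_pos; linarith)] with β hβ
  exact hP s β hβ

/-- The reflection law says that the polynomial is even in the angle between velocity and
boundary. -/
theorem planeEval_larmorCenter_neg {Ω : Set ℂ} {γ : ℝ → ℂ} (hu : ∀ s, ‖deriv γ s‖ = 1) {r : ℝ}
    {Φ : ℂ → ℂ → ℝ} (hΦ : IsPolynomialIntegral Ω γ r Φ) {P : MvPolynomial (Fin 2) ℝ}
    (hP : ∀ s α : ℝ,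
      Φ (γ s) (Complex.exp (α * Complex.I) * deriv γ s) = planeEval P (larmorCenter γ r s α))
    (s α : ℝ) : planeEval P (larmorCenter γ r s α) = planeEval P (larmorCenter γ r s (-α)) := by
  rw [← hP, ← hP, ← hΦ.reflection s _ (norm_exp_mul_deriv hu s α), inner_normal_exp hu]
  congr 1
  rw [normal, Complex.real_smul, Complex.exp_mul_I, Complex.exp_mul_I]
  push_cast
  rw [Complex.cos_neg, Complex.sin_neg]
  ring

theorem larmorCenter_neg_left (γ : ℝ → ℂ) (r s ε : ℝ) :
    larmorCenter γ (-r) s ε = larmorCenter γ r s (ε + Real.pi) := by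
  rw [larmorCenter, larmorCenter]
  push_cast
  rw [add_mul, Complex.exp_add, Complex.exp_pi_mul_I]
  ring

theorem larmorCenter_add_two_pi (γ : ℝ → ℂ) (r s ε : ℝ) :
    larmorCenter γ r s (ε + 2 * Real.pi) = larmorCenter γ r s ε := by
  rw [larmorCenter, larmorCenter]
  push_cast
  rw [add_mul, Complex.exp_add, Complex.exp_two_pi_mul_I]
  ring

/-! ### Arcs that come from the boundary -/

theorem flowVel_flowVel (r : ℝ) (v : ℂ) (t t' : ℝ) :
    flowVel r (flowVel r v t) t' = flowVel r v (t + t') := by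
  rw [flowVel, flowVel, flowVel, ← mul_assoc, ← Complex.exp_add]
  congr 2
  push_cast
  ring

theorem flowPos_flowPos (r : ℝ) (x v : ℂ) (t t' : ℝ) :
    flowPos r (flowPos r x v t) (flowVel r v t) t' = flowPos r x v (t + t') := by
  rw [flowPos, add_flowVel, flowVel_flowVel, flowPos]

theorem exists_eq_exp_mul {v w : ℂ} (hv : ‖v‖ = 1) (hw : ‖w‖ = 1) :
    ∃ α : ℝ, α ≤ Real.pi ∧ v = Complex.exp (α * Complex.I) * w := by
  refine ⟨(v / w).arg, Complex.arg_le_pi _, ?_⟩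
  have h := Complex.norm_mul_exp_arg_mul_I (v / w)
  rw [norm_div, hv, hw, div_one, Complex.ofReal_one, one_mul] at h
  rw [h]
  exact (div_mul_cancel₀ _ (norm_ne_zero_iff.1 (by rw [hw]; exact one_ne_zero))).symm

/-- A Larmor circle whose centre is at distance less than `r` from the boundary leaves `Ω`. -/
theorem exists_flowPos_neg_notMem {Ω : Set ℂ} {γ : ℝ → ℂ} {L ρ r : ℝ} (hΩ : IsTable Ω γ L)
    (hρ : IsTubular γ L ρ) (hr : 0 < r) (hrρ : 2 * r < ρ) {x v : ℂ} (hv : ‖v‖ = 1) {u s : ℝ}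
    (hu : |u| < r) (hc : x + r * (Complex.I * v) = parallelCurve γ u s) :
    ∃ τ > 0, flowPos r x v (-τ) ∉ Ω := by
  obtain ⟨β, hβ, h⟩ := exists_eq_exp_mul (hΩ.unit_speed s) hv
  have hu' := abs_lt.1 hu
  have hπ := Real.pi_pos
  refine ⟨r * (2 * Real.pi - β), mul_pos hr (by linarith), ?_⟩
  have hr' : (r : ℂ) ≠ 0 := by exact_mod_cast hr.ne'
  have hvel : flowVel r v (-(r * (2 * Real.pi - β))) = deriv γ s := by
    rw [h, flowVel]
    congr 1
    have : (((-(r * (2 * Real.pi - β))) / r : ℝ) : ℂ) * Complex.I =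
        β * Complex.I - 2 * Real.pi * Complex.I := by
      push_cast
      field_simp
      ring
    rw [this, Complex.exp_sub, Complex.exp_two_pi_mul_I, div_one]
  have hpos : flowPos r x v (-(r * (2 * Real.pi - β))) = parallelCurve γ (u - r) s := by
    rw [flowPos, hvel, hc, parallelCurve, parallelCurve, normal]
    push_cast
    ring
  rw [hpos]
  exact parallelCurve_notMem hΩ hρ (by linarith) (by linarith) s

/-- Motions that start from the boundary with transversal outward velocity leave `Ω` at once. -/
theorem exists_flowPos_notMem {Ω : Set ℂ} {γ : ℝ → ℂ} {L ρ r : ℝ} (hΩ : IsTable Ω γ L)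
    (hρ : IsTubular γ L ρ) (hr : 0 < r) (hρ0 : 0 < ρ) {s : ℝ} {v : ℂ}
    (hv : inner ℝ (normal γ s) v < 0) {T : ℝ} (hT : 0 < T) :
    ∃ τ ∈ Set.Ioc 0 T, flowPos r (γ s) v τ ∉ Ω := by
  obtain ⟨h, S, hc, h0, hev⟩ := height_expansion hΩ.smooth hΩ.unit_speed hr.ne' (E := ℝ)
    (s := fun _ => s) (v := fun _ => v) contDiff_const contDiff_const 0
    (η := -inner ℝ (normal γ s) v / 2) (by linarith)
  have h1 : Tendsto (fun τ : ℝ => ((0 : ℝ), τ)) (𝓝[>] 0) (𝓝 (0, 0)) :=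
    ((by fun_prop : Continuous fun τ : ℝ => ((0 : ℝ), τ)).tendsto 0).mono_left nhdsWithin_le_nhds
  have h2 : Tendsto (flowPos r (γ s) v) (𝓝[>] 0) (𝓝 (γ s)) := by
    have := (hasDerivAt_flowPos hr.ne' (γ s) v 0).continuousAt.tendsto
    rw [flowPos_zero] at this
    exact this.mono_left nhdsWithin_le_nhds
  have h3 : ∀ᶠ y in 𝓝 (γ s), -ρ < h y :=
    continuousAt_const.eventually_lt hc (by rw [h0]; linarith)
  obtain ⟨τ, ⟨⟨h4, h5⟩, h6⟩, hτ⟩ :=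
    (((h1.eventually hev).and (h2.eventually h3)).and (Ioc_mem_nhdsGT hT)).exists
  refine ⟨τ, hτ, ?_⟩
  dsimp only at h4 h5
  rw [h4]
  refine parallelCurve_notMem hΩ hρ ?_ h6 _
  rw [abs_of_pos hτ.1] at h5
  have h7 := (abs_le.1 h5).2
  have h8 : τ * inner ℝ (normal γ s) v < 0 := mul_neg_of_pos_of_neg hτ.1 hv
  linarith

/-- The last boundary point met by a motion before it reaches `(x, v)`. -/
theorem exists_last_collision {Ω : Set ℂ} {γ : ℝ → ℂ} {L r : ℝ} (hΩ : IsTable Ω γ L) (hr : r ≠ 0)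
    {x v : ℂ} (hx : x ∈ Ω) {T : ℝ} (hT : 0 < T) (hTx : flowPos r x v (-T) ∉ Ω) :
    ∃ τ > 0, ∃ s, flowPos r x v (-τ) = γ s ∧ ∀ σ ∈ Set.Ioc 0 τ, flowPos r x v (-τ + σ) ∈ Ω := by
  have hyc : Continuous fun τ => flowPos r x v (-τ) :=
    (continuous_iff_continuousAt.2 fun t =>
      (hasDerivAt_flowPos hr x v t).continuousAt).comp continuous_neg
  set A : Set ℝ := {τ | 0 ≤ τ ∧ flowPos r x v (-τ) ∉ Ω} with hA
  have hAc : IsClosed A := isClosed_Ici.inter (hΩ.isOpen.isClosed_compl.preimage hyc)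
  have hAb : BddBelow A := ⟨0, fun τ hτ => hτ.1⟩
  obtain ⟨h0, hout⟩ := hAc.csInf_mem ⟨T, hT.le, hTx⟩ hAb
  have hin : ∀ σ, 0 ≤ σ → σ < sInf A → flowPos r x v (-σ) ∈ Ω := by
    intro σ hσ hlt
    by_contra hne
    exact absurd (csInf_le hAb ⟨hσ, hne⟩) (not_le.2 hlt)
  have hpos : 0 < sInf A := by
    refine lt_of_le_of_ne h0 fun h => hout ?_
    rw [← h, neg_zero, flowPos_zero]
    exact hx
  have hcl : flowPos r x v (-sInf A) ∈ closure Ω := by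
    refine mem_closure_of_tendsto
      ((hyc.tendsto (sInf A)).mono_left (nhdsWithin_le_nhds (s := Set.Iio (sInf A)))) ?_
    filter_upwards [Ioo_mem_nhdsLT hpos] with σ hσ
    exact hin σ hσ.1.le hσ.2
  have hfr : flowPos r x v (-sInf A) ∈ frontier Ω := by
    rw [hΩ.isOpen.frontier_eq]; exact ⟨hcl, hout⟩
  rw [hΩ.frontier_eq] at hfr
  obtain ⟨s, hs⟩ := hfr
  refine ⟨sInf A, hpos, s, hs.symm, fun σ hσ => ?_⟩
  have := hin (sInf A - σ) (by linarith [hσ.2]) (by linarith [hσ.1])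
  rwa [neg_sub, sub_eq_neg_add] at this

/-- The integral is the given polynomial of the Larmor centre, at every vector whose Larmor centre
is at distance less than `r` from the boundary. -/
theorem eq_planeEval_of_center {Ω : Set ℂ} {γ : ℝ → ℂ} {L ρ r : ℝ} (hΩ : IsTable Ω γ L)
    (hρ : IsTubular γ L ρ) (hr : 0 < r) (hrρ : 2 * r < ρ) {Φ : ℂ → ℂ → ℝ}
    (hΦ : IsPolynomialIntegral Ω γ r Φ) {P : MvPolynomial (Fin 2) ℝ}
    (hP : ∀ s α : ℝ,
      Φ (γ s) (Complex.exp (α * Complex.I) * deriv γ s) = planeEval P (larmorCenter γ r s α))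
    {x v : ℂ} (hx : x ∈ Ω) (hv : ‖v‖ = 1) {u s : ℝ} (hu : |u| < r)
    (hc : x + r * (Complex.I * v) = parallelCurve γ u s) :
    Φ x v = planeEval P (x + r * (Complex.I * v)) := by
  obtain ⟨T, hT, hTx⟩ := exists_flowPos_neg_notMem hΩ hρ hr hrρ hv hu hc
  obtain ⟨τ, hτ, s', hs', hin⟩ := exists_last_collision hΩ hr.ne' hx hT hTx
  have hu' := abs_lt.1 hu
  set w := flowVel r v (-τ) with hw
  have hw1 : ‖w‖ = 1 := by rw [hw, norm_flowVel, hv]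
  have hpos : ∀ σ, flowPos r (γ s') w σ = flowPos r x v (-τ + σ) := fun σ => by
    rw [← hs', hw, flowPos_flowPos]
  have hcen : γ s' + r * (Complex.I * w) = x + r * (Complex.I * v) := by
    rw [← hs', hw, add_flowVel]
  obtain ⟨α, -, hα⟩ := exists_eq_exp_mul hw1 (hΩ.unit_speed s')
  have hinner : inner ℝ (normal γ s') w = Real.sin α := by
    rw [hα, inner_normal_exp hΩ.unit_speed]
  rcases lt_trichotomy 0 (Real.sin α) with hlt | heq | hgt
  · have h1 := hΦ.between_collisions s' w τ hw1 (by rw [hinner]; exact hlt) hτ.le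
      fun σ hσ => by rw [hpos]; exact hin σ hσ
    rw [hpos, hw, flowVel_flowVel, neg_add_cancel, flowPos_zero, flowVel_zero, ← hw] at h1
    rw [h1, ← hcen, hα, hP, larmorCenter_eq_add]
  · -- a tangential collision would put the centre at distance exactly `r` from the boundary
    exfalso
    have hsign : ∃ t : ℝ, (t = r ∨ t = -r) ∧ γ s' + r * (Complex.I * w) = parallelCurve γ t s' := by
      have h1 : Complex.exp (α * Complex.I) = (Real.cos α : ℂ) := by
        rw [Complex.exp_mul_I, ← Complex.ofReal_sin, ← heq]; simp
      rcases (Real.sin_eq_zero_iff_cos_eq).1 heq.symm with h | h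
      · refine ⟨r, Or.inl rfl, ?_⟩
        rw [hα, h1, h, parallelCurve, normal]
        push_cast
        ring
      · refine ⟨-r, Or.inr rfl, ?_⟩
        rw [hα, h1, h, parallelCurve, normal]
        push_cast
        ring
    obtain ⟨t, ht, h⟩ := hsign
    have hut : t = u := by
      refine height_eq_of_parallelCurve_eq hΩ.length_pos hΩ.periodic hρ (s := s') (s' := s)
        ?_ ⟨by linarith, by linarith⟩ (by rw [← h, hcen, hc])
      rcases ht with rfl | rfl <;> constructor <;> linarith
    rcases ht with h | h <;> linarith
  · exfalso
    obtain ⟨σ, hσ, hσΩ⟩ := exists_flowPos_notMem hΩ hρ hr (by linarith)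
      (by rw [hinner]; exact hgt) hτ
    exact hσΩ (by rw [hpos]; exact hin σ hσ)

/-- If the integral is not constant, neither is the polynomial of the Larmor centre. -/
theorem ne_C_of_isNonconstantOn {Ω : Set ℂ} {γ : ℝ → ℂ} {L ρ r : ℝ} (hΩ : IsTable Ω γ L)
    (hρ : IsTubular γ L ρ) (hm : ∀ t ∈ Set.Ioo (-ρ) ρ, ∀ s, 1 - t * curvature γ s ≠ 0)
    (hr : 0 < r) (hrρ : 2 * r < ρ) {Φ : ℂ → ℂ → ℝ}
    (hΦ : IsPolynomialIntegral Ω γ r Φ) (hne : IsNonconstantOn (arcRegion γ r) Φ)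
    {P : MvPolynomial (Fin 2) ℝ} (hP : ∀ s α : ℝ,
      Φ (γ s) (Complex.exp (α * Complex.I) * deriv γ s) = planeEval P (larmorCenter γ r s α))
    (c : ℝ) : P ≠ MvPolynomial.C c := by
  rintro rfl
  refine hne ⟨c, fun x hx v hv => ?_⟩
  have hxΩ := arcRegion_subset hΩ hρ hrρ hx
  have hxcl := subset_closure hx
  obtain ⟨s, t, ht, htr, rfl⟩ := hx
  have hw : ‖-deriv γ s‖ = 1 := by rw [norm_neg, hΩ.unit_speed]
  obtain ⟨α, -, rfl⟩ := exists_eq_exp_mul hv hw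
  refine congrFun ((hΦ.polynomial.analyticOnNhd hxcl hw).eq_of_eventuallyEq
    (g := fun _ => c) (z₀ := 0) (fun _ _ => analyticAt_const) ?_) α
  -- the vectors close to `-γ̇(s)` have Larmor centres close to `γ_{t - r}(s)`
  have hmap : map (tube γ) (𝓝 (s, t - r)) = 𝓝 (parallelCurve γ (t - r) s) :=
    (hasStrictFDerivAt_tube_equiv hΩ.smooth hΩ.unit_speed (s, t - r)
      (hm _ ⟨by linarith, by linarith⟩ s)).map_nhds_eq_of_equiv
  have hnear : tube γ '' {p | |p.2| < r} ∈ 𝓝 (parallelCurve γ (t - r) s) := by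
    rw [← hmap]
    refine image_mem_map (continuous_snd.abs.continuousAt.eventually_lt continuousAt_const ?_)
    exact abs_lt.2 ⟨by linarith, by linarith⟩
  have hcont : Continuous fun β : ℝ => parallelCurve γ t s +
      r * (Complex.I * (Complex.exp (β * Complex.I) * -deriv γ s)) := by fun_prop
  have hlim := hcont.tendsto 0
  have h0 : parallelCurve γ t s +
      r * (Complex.I * (Complex.exp ((0 : ℝ) * Complex.I) * -deriv γ s)) =
        parallelCurve γ (t - r) s := by
    simp only [parallelCurve, normal, Complex.ofReal_zero, zero_mul, Complex.exp_zero]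
    push_cast
    ring
  rw [h0] at hlim
  filter_upwards [hlim.eventually hnear] with β hβ
  obtain ⟨⟨s₁, u⟩, hu, hc⟩ := hβ
  rw [eq_planeEval_of_center hΩ hρ hr hrρ hΦ hP hxΩ (by rw [norm_mul, norm_exp_I, hw, one_mul])
    hu hc.symm, planeEval_C]

theorem exists_isTubular {γ : ℝ → ℂ} {L r : ℝ}
    (h : ENNReal.ofReal r < tubularRadius γ L / 2) : ∃ ρ, IsTubular γ L ρ ∧ 2 * r < ρ := by
  have h1 : ENNReal.ofReal r * 2 < tubularRadius γ L :=
    (ENNReal.lt_div_iff_mul_lt (Or.inl two_ne_zero) (Or.inl ENNReal.ofNat_ne_top)).1 h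
  obtain ⟨ρ, hρ⟩ := lt_iSup_iff.1 h1
  obtain ⟨hT, hρ⟩ := lt_iSup_iff.1 hρ
  refine ⟨ρ, hT, ?_⟩
  by_contra! hle
  refine absurd hρ (not_lt.2 ?_)
  have h2 : (ρ : ℝ≥0∞) = ENNReal.ofReal ρ := by simp
  have h3 : ENNReal.ofReal r * 2 = ENNReal.ofReal (2 * r) := by
    rw [mul_comm, ENNReal.ofReal_mul (by norm_num)]; simp
  rw [h2, h3]
  exact ENNReal.ofReal_le_ofReal hle

theorem IsTubular.one_sub_mul_curvature_ne_zero {γ : ℝ → ℂ} (hγ : ContDiff ℝ ∞ γ)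
    (hu : ∀ s, ‖deriv γ s‖ = 1) {L ρ : ℝ} (hρ : IsTubular γ L ρ) {t : ℝ}
    (ht : t ∈ Set.Ioo (-ρ) ρ) (s : ℝ) : 1 - t * curvature γ s ≠ 0 := by
  intro h
  refine hρ.2 t ht s ?_
  rw [(hasDerivAt_parallelCurve hγ hu t s).deriv, h]
  simp

/-- A polynomial that is even along the Larmor centres yields the algebraic curve. -/
theorem exists_isRealOval {Ω : Set ℂ} {γ : ℝ → ℂ} {L ρ t : ℝ} (hΩ : IsTable Ω γ L)
    (hρ : IsTubular γ L ρ) (ht0 : t ≠ 0) (ht : t ∈ Set.Ioo (-ρ) ρ) {P : MvPolynomial (Fin 2) ℝ}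
    (hP : ∀ c, P ≠ MvPolynomial.C c)
    (heven : ∀ s ε, planeEval P (larmorCenter γ t s ε) = planeEval P (larmorCenter γ t s (-ε))) :
    ∃ f : MvPolynomial (Fin 2) ℝ, Irreducible (MvPolynomial.map (algebraMap ℝ ℂ) f) ∧
      IsNonsingular f ∧ IsRealOval f (Set.range (parallelCurve γ t)) := by
  have hm := hρ.one_sub_mul_curvature_ne_zero hΩ.smooth hΩ.unit_speed ht
  obtain ⟨f, hirr, hns, hf, hl⟩ :=
    exists_nonsingular_curve hΩ.smooth hΩ.unit_speed ht0 hm hP heven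
  refine ⟨f, hirr, hns, isRealOval_of_isolated hΩ.length_pos
    (contDiff_parallelCurve hΩ.smooth t).continuous (parallelCurve_periodic hΩ.periodic t) ?_ hf
    fun s => eventually_mem_range_of_planeEval_eq_zero hΩ.smooth hΩ.unit_speed hf (hm s) (hl s)⟩
  intro a ha b hb hab
  exact congrArg Prod.fst (hρ.1 (show (a, t) ∈ _ from ⟨ha, ht⟩) (show (b, t) ∈ _ from ⟨hb, ht⟩) hab)

end MagneticBilliard

theorem theorem1p1 (Ω : Set ℂ) (γ : ℝ → ℂ) (L r : ℝ)
    (hΩ : MagneticBilliard.IsTable Ω γ L)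
    (hr : 0 < r)
    (hcurv : ENNReal.ofReal r < MagneticBilliard.tubularRadius γ L / 2)
    (Φ : ℂ → ℂ → ℝ)
    (hΦ : MagneticBilliard.IsPolynomialIntegral Ω γ r Φ)
    (hne : MagneticBilliard.IsNonconstantOn (MagneticBilliard.arcRegion γ r) Φ) :
    ∀ t : ℝ, t = r ∨ t = -r →
      ∃ f : MvPolynomial (Fin 2) ℝ,
        Irreducible (MvPolynomial.map (algebraMap ℝ ℂ) f) ∧
        MagneticBilliard.IsNonsingular f ∧
        MagneticBilliard.IsRealOval f (Set.range (MagneticBilliard.parallelCurve γ t)) := by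
  obtain ⟨ρ, hρ, hrρ⟩ := MagneticBilliard.exists_isTubular hcurv
  obtain ⟨P, hP⟩ := MagneticBilliard.exists_eq_planeEval_larmorCenter hΩ hρ hr hrρ hΦ
  have hP' := MagneticBilliard.eq_planeEval_larmorCenter hΩ.unit_speed hr hΦ.polynomial hP
  have hPC := MagneticBilliard.ne_C_of_isNonconstantOn hΩ hρ
    (fun t ht => hρ.one_sub_mul_curvature_ne_zero hΩ.smooth hΩ.unit_speed ht) hr hrρ hΦ hne hP'
  have heven := MagneticBilliard.planeEval_larmorCenter_neg hΩ.unit_speed hΦ hP'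
  rintro t (rfl | rfl)
  · exact MagneticBilliard.exists_isRealOval hΩ hρ hr.ne' ⟨by linarith, by linarith⟩ hPC heven
  · refine MagneticBilliard.exists_isRealOval hΩ hρ (neg_ne_zero.2 hr.ne')
      ⟨by linarith, by linarith⟩ hPC fun s ε => ?_
    rw [MagneticBilliard.larmorCenter_neg_left, MagneticBilliard.larmorCenter_neg_left, heven,
      ← MagneticBilliard.larmorCenter_add_two_pi]
    congr 2
    ring
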